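/- Let $X$ be a complex manifold, let $V$ be a holomorphic vector bundle of rank $r+1$ on $X$, $r\ge 1$, with a smooth hermitian metric $h$, and let $q:V\to F$ be a surjective morphism of holomorphic vector bundles onto a holomorphic line bundle $F$. Put $$F':=\mathrm{Coker}\Big(\bigwedge\nolimits^r\mathrm{Ker}(q)\to\bigwedge\nolimits^rV\Big),$$ a holomorphic quotient bundle of rank $r$ of $\bigwedge^rV$. For a holomorphic vector bundle $W$ let $\mathbb P(W)\to X$ be the bundle of one-dimensional quotients of the fibres of $W$ (equivalently, of lines in the fibres of $W^*$), and for a hermitian metric on $W$ let $\eta_W:=\frac{i}{2\pi}R^{\mathcal O(1)}$ be the relative Fubini–Study form on $\mathbb P(W)$, where $\mathcal O(1)$ carries the induced metric; thus $\eta_W=\frac{i}{2\pi}\partial\bar\partial\log|f|^2$ for any local holomorphic non-vanishing section $f$ of the tautological line subbundle $\mathcal O(-1)$ of the pull-back of $W^*$, with the dual metric. Let $\eta_V$ denote also the restriction of this form to $\mathbb P(F)\subset\mathbb P(V)$, and let $\eta_{\bigwedge}$ denote the form on $\mathbb P(\bigwedge^rV)$ for the metric induced by $h$ on $\bigwedge^rV$,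 as well as its restriction to $\mathbb P(F')\subset\mathbb P(\bigwedge^rV)$. Let $R^{\det V}$ be the curvature form of $\det V$ with the induced metric, that is, $R^{\det V}=-\partial\bar\partial\log\det(h(s_j,s_k))$ for any local holomorphic frame $(s_j)$ of $V$. Denote by $\int_{Y\to X}$ integration of differential forms along the fibres of $Y\to X$. All fibre integrals below exist. (1) One has $$\int_{\mathbb P(F)\to X}\eta_V=\int_{\mathbb P(F')\to X}\eta_{\bigwedge}^r-(r-1)\frac{i}{2\pi}R^{\det V}.$$ (2) If the metric $h$ is trivial, i.e. if around each point of $X$ the bundle $V$ has a holomorphic frame which is orthonormal at every point of its domain, then $$\alpha:=\int_{\mathbb P(F)\to X}\eta_V=\int_{\mathbb P(F')\to X}\eta_{\bigwedge}^r,$$ and for all positive integers $p$ $$\int_{\mathbb P(F)\to X}\eta_V^p=\alpha^p\qquad\text{and}\qquad\int_{\mathbb P(F')\to X}\eta_{\bigwedge}^{r+p}=0.$$ -/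

import Mathlib

open scoped Manifold ContDiff Bundle Topology ComplexConjugate

noncomputable section

namespace FibreIntegrals

/-! ### Differential forms on normed spaces -/

/-- Complex valued alternating `k`-forms (over the reals) on `N`. -/
abbrev Form (N : Type*) [AddCommGroup N] [Module ℝ N] (k : ℕ) : Type _ :=
  N [⋀^Fin k]→ₗ[ℝ] ℂ

/-- The wedge product, normalised by `(dx ∧ dy)(e₁, e₂) = 1`. -/
def wedge {N : Type*} [AddCommGroup N] [Module ℝ N] {k l : ℕ} (a : Form N k) (b : Form N l) :
    Form N (k + l) :=
  ((LinearMap.mul' ℝ ℂ).compAlternatingMap (a.domCoprod b)).domDomCongr finSumFinEquiv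

/-- The `p`-th wedge power of a `2`-form. -/
def wedgePow {N : Type*} [AddCommGroup N] [Module ℝ N] (a : Form N 2) : (p : ℕ) → Form N (2 * p)
  | 0 => AlternatingMap.constOfIsEmpty ℝ N (Fin 0) (1 : ℂ)
  | p + 1 => wedge (wedgePow a p) a

/-- The `(0,1)`-form `∂̄φ`, that is `v ↦ (dφ(v) + i dφ(iv)) / 2`. -/
def dbar {N : Type*} [NormedAddCommGroup N] [NormedSpace ℂ N] (φ : N → ℂ) (z : N) : N →L[ℝ] ℂ :=
  (1 / 2 : ℂ) • (fderiv ℝ φ z +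
    Complex.I • (fderiv ℝ φ z).comp ((Complex.I • ContinuousLinearMap.id ℂ N).restrictScalars ℝ))

/-- The `(1,1)`-form `∂∂̄φ` (which is `d∂̄φ`, as `∂̄∂̄φ = 0`) of a smooth function `φ`. -/
def ddbar {N : Type*} [NormedAddCommGroup N] [NormedSpace ℂ N] (φ : N → ℂ) (z : N) : Form N 2 :=
  (extDeriv (fun y => ContinuousAlternatingMap.ofSubsingleton ℝ N ℂ (0 : Fin 1) (dbar φ y))
    z).toAlternatingMap

/-! ### Hermitian forms -/

/-- Sesquilinear forms, linear in the first and antilinear in the second variable. -/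
abbrev SesqForm (W : Type*) [AddCommGroup W] [Module ℂ W] : Type _ := W →ₗ[ℂ] W →ₗ⋆[ℂ] ℂ

/-- The squared norm `|f|²` on the dual of `W` of the metric which is dual to `H`. -/
def dualNormSq {W : Type*} [AddCommGroup W] [Module ℂ W] (H : SesqForm W)
    (f : Module.Dual ℂ W) : ℝ :=
  ⨆ v : {v : W // v ≠ 0}, ‖f v‖ ^ 2 / (H v v).re

/-- The linear functional `w ↦ conj (H v w)`, which equals `w ↦ H w v` if `H` is hermitian. -/
def conjDual {W : Type*} [AddCommGroup W] [Module ℂ W] (H : SesqForm W) (v : W) :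
    Module.Dual ℂ W where
  toFun w := conj (H v w)
  map_add' a b := by simp
  map_smul' c a := by simp

/-- The functional `y ↦ H(v₁ ∧ … ∧ v_r, y)` of the form induced by `H` on `⋀^r W`. -/
def exteriorAux {W : Type*} [AddCommGroup W] [Module ℂ W] (H : SesqForm W) (r : ℕ)
    (v : Fin r → W) : (⋀[ℂ]^r W) →ₗ⋆[ℂ] ℂ where
  toFun y := conj (exteriorPower.pairingDual ℂ W r
    (exteriorPower.ιMulti ℂ r (fun i => conjDual H (v i))) y)
  map_add' a b := by simp
  map_smul' c a := by simp

/-- The hermitian form induced by `H` on `⋀^r W`; on decomposable vectors it is the Gram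
determinant, see `exteriorForm_apply`. -/
def exteriorForm {W : Type*} [AddCommGroup W] [Module ℂ W] (H : SesqForm W) (r : ℕ) :
    SesqForm (⋀[ℂ]^r W) :=
  exteriorPower.alternatingMapLinearEquiv
    { toFun := exteriorAux H r
      map_update_add' := by
        intro inst v i a b
        have h : ∀ a : W, (fun j => conjDual H (Function.update v i a j))
            = Function.update (fun j => conjDual H (v j)) i (conjDual H a) := by
          intro a; funext j; by_cases hj : j = i
          · subst hj; simp
          · simp [hj]
        have hab : conjDual H (a + b) = conjDual H a + conjDual H b := by
          ext w; simp [conjDual]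
        ext y
        obtain rfl : inst = instDecidableEqFin r := Subsingleton.elim _ _
        simp only [exteriorAux, LinearMap.coe_mk, AddHom.coe_mk, LinearMap.add_apply, h, hab,
          AlternatingMap.map_update_add, map_add]
      map_update_smul' := by
        intro inst v i c a
        have h : ∀ a : W, (fun j => conjDual H (Function.update v i a j))
            = Function.update (fun j => conjDual H (v j)) i (conjDual H a) := by
          intro a; funext j; by_cases hj : j = i
          · subst hj; simp
          · simp [hj]
        have hca : conjDual H (c • a) = conj c • conjDual H a := by
          ext w; simp [conjDual]
        ext y
        obtain rfl : inst = instDecidableEqFin r := Subsingleton.elim _ _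
        simp only [exteriorAux, LinearMap.coe_mk, AddHom.coe_mk, LinearMap.smul_apply, h, hca,
          AlternatingMap.map_update_smul, map_smul, smul_eq_mul, map_mul, Complex.conj_conj]
      map_eq_zero_of_eq' := by
        intro v i j hv hij
        ext y
        simp only [exteriorAux, LinearMap.coe_mk, AddHom.coe_mk, LinearMap.zero_apply]
        rw [AlternatingMap.map_eq_zero_of_eq (exteriorPower.ιMulti ℂ r)
          (fun l => conjDual H (v l)) (congrArg (conjDual H) hv) hij]
        simp }

theorem exteriorForm_apply {W : Type*} [AddCommGroup W] [Module ℂ W] (H : SesqForm W) (r : ℕ)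
    (v w : Fin r → W) :
    exteriorForm H r (exteriorPower.ιMulti ℂ r v) (exteriorPower.ιMulti ℂ r w)
      = Matrix.det (Matrix.of fun i j => H (v i) (w j)) := by
  have h : exteriorForm H r (exteriorPower.ιMulti ℂ r v) = exteriorAux H r v := by
    simp only [exteriorForm, exteriorPower.alternatingMapLinearEquiv_apply_ιMulti]
    rfl
  rw [h]
  simp only [exteriorAux, LinearMap.coe_mk, AddHom.coe_mk,
    exteriorPower.pairingDual_ιMulti_ιMulti, conjDual]
  rw [RingHom.map_det, ← Matrix.det_transpose]
  congr 1
  ext i j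
  simp [Matrix.transpose]

/-! ### Holomorphic bundles over a complex manifold -/

/-- `s` is a holomorphic section of `V` over the open set `U`. -/
def IsHolSection {E : Type*} [NormedAddCommGroup E] [NormedSpace ℂ E]
    {X : Type*} [TopologicalSpace X] [ChartedSpace E X]
    (M : Type*) [NormedAddCommGroup M] [NormedSpace ℂ M] {V : X → Type*}
    [TopologicalSpace (Bundle.TotalSpace M V)] [∀ x, TopologicalSpace (V x)] [FiberBundle M V]
    (U : Set X) (s : ∀ x, V x) : Prop :=
  ContMDiffOn 𝓘(ℂ, E) (𝓘(ℂ, E).prod 𝓘(ℂ, M)) ω (fun x => Bundle.TotalSpace.mk' M x (s x)) U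

/-- The decomposable holomorphic sections `s₁ ∧ … ∧ s_r` of `⋀^r V` over `U`, where the `s_i` are
holomorphic sections of `V`. They generate the sheaf of holomorphic sections of `⋀^r V`. -/
def IsDecomposableSection {E : Type*} [NormedAddCommGroup E] [NormedSpace ℂ E]
    {X : Type*} [TopologicalSpace X] [ChartedSpace E X]
    (M : Type*) [NormedAddCommGroup M] [NormedSpace ℂ M] {V : X → Type*}
    [TopologicalSpace (Bundle.TotalSpace M V)] [∀ x, TopologicalSpace (V x)] [FiberBundle M V]
    [∀ x, AddCommGroup (V x)] [∀ x, Module ℂ (V x)] (r : ℕ)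
    (U : Set X) (s : ∀ x, ⋀[ℂ]^r (V x)) : Prop :=
  ∃ t : Fin r → ∀ x, V x, (∀ i, IsHolSection (E := E) M U (t i)) ∧
    ∀ x ∈ U, s x = exteriorPower.ιMulti ℂ r (fun i => t i x)

/-- A (smooth) hermitian metric on a holomorphic vector bundle. -/
structure HermitianMetric (E : Type*) [NormedAddCommGroup E] [NormedSpace ℂ E]
    {X : Type*} [TopologicalSpace X] [ChartedSpace E X]
    (M : Type*) [NormedAddCommGroup M] [NormedSpace ℂ M] (V : X → Type*)
    [TopologicalSpace (Bundle.TotalSpace M V)] [∀ x, TopologicalSpace (V x)] [FiberBundle M V]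
    [∀ x, AddCommGroup (V x)] [∀ x, Module ℂ (V x)] where
  form : ∀ x, SesqForm (V x)
  conj_symm : ∀ x (v w : V x), conj (form x v w) = form x w v
  pos : ∀ x (v : V x), v ≠ 0 → 0 < (form x v v).re
  smooth : ∀ (U : Set X), IsOpen U → ∀ s t : ∀ x, V x,
    IsHolSection (E := E) M U s → IsHolSection (E := E) M U t →
      ContMDiffOn 𝓘(ℝ, E) 𝓘(ℝ, ℂ) ∞ (fun x => form x (s x) (t x)) U

/-- The metric is (locally) trivial: around each point there is a holomorphic frame of `V` which is
orthonormal at all points of its domain. -/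
def HermitianMetric.IsTrivial {E : Type*} [NormedAddCommGroup E] [NormedSpace ℂ E]
    {X : Type*} [TopologicalSpace X] [ChartedSpace E X]
    {M : Type*} [NormedAddCommGroup M] [NormedSpace ℂ M] {V : X → Type*}
    [TopologicalSpace (Bundle.TotalSpace M V)] [∀ x, TopologicalSpace (V x)] [FiberBundle M V]
    [∀ x, AddCommGroup (V x)] [∀ x, Module ℂ (V x)] (h : HermitianMetric E M V) : Prop :=
  ∀ x : X, ∃ U : Set X, IsOpen U ∧ x ∈ U ∧
    ∃ s : Fin (Module.finrank ℂ M) → ∀ y, V y,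
      IsLocalFrameOn 𝓘(ℂ, E) M ω s U ∧
      ∀ y ∈ U, ∀ i j, h.form y (s i y) (s j y) = if i = j then 1 else 0

/-- The curvature form `R^{det V} = -∂∂̄ log det (h(s_j, s_k))` at `x` of the determinant bundle with
the metric induced by `h`, for a holomorphic frame `(s_j)` of `V` around `x`. It is computed in the
chart of `X` at `x`, which identifies the tangent space at `x` with `E`. -/
def detCurvature {E : Type*} [NormedAddCommGroup E] [NormedSpace ℂ E]
    {X : Type*} [TopologicalSpace X] [ChartedSpace E X]
    {M : Type*} [NormedAddCommGroup M] [NormedSpace ℂ M] {V : X → Type*}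
    [TopologicalSpace (Bundle.TotalSpace M V)] [∀ x, TopologicalSpace (V x)] [FiberBundle M V]
    [∀ x, AddCommGroup (V x)] [∀ x, Module ℂ (V x)] [VectorBundle ℂ M V] [FiniteDimensional ℂ M]
    (h : HermitianMetric E M V) (x : X) : Form (TangentSpace 𝓘(ℂ, E) x) 2 :=
  let s := (trivializationAt M V x).localFrame (Module.finBasis ℂ M)
  let G : X → ℂ := fun y => Matrix.det (Matrix.of fun j k => h.form y (s j y) (s k y))
  (-ddbar (fun z : E => ((Real.log (G ((extChartAt 𝓘(ℂ, E) x).symm z)).re : ℝ) : ℂ))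
    (extChartAt 𝓘(ℂ, E) x x) : Form E 2)

/-! ### Projectivized bundles

Let `pr y : W y → Q y` be a quotient of a holomorphic bundle `W` over `X`, of rank `m + 1`. The
fibre at `y` of `P(Q)` is the projective space of one-dimensional quotients of `Q y`, that is, of
lines in the dual of `Q y`, and `P(Q)` is a subspace of `P(W)` through `f ↦ f ∘ pr`. A holomorphic
frame `κ₀, …, κ_m` of the dual of `Q` over an open subset `U` of `X` gives the affine chart
`(y, w) ↦ (y, [κ₀(y) + w₁ κ₁(y) + … + w_m κ_m(y)])` of `P(Q)`, from `U × ℂ^m` onto a dense open subset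
of `P(Q)` over `U` whose complement in each fibre is a hyperplane. -/

/-- Affine charts of `P(Q)` over a neighbourhood of `x`. The argument `gen` is a class of local
holomorphic sections that generate `W`; a section `κ` of the dual of `Q` is holomorphic
if and only if `κ (pr s)` is holomorphic for such `s`. -/
structure AffineChart (E : Type*) [NormedAddCommGroup E] [NormedSpace ℂ E]
    {X : Type*} [TopologicalSpace X] [ChartedSpace E X] {W Q : X → Type*}
    [∀ x, AddCommGroup (W x)] [∀ x, Module ℂ (W x)]
    [∀ x, AddCommGroup (Q x)] [∀ x, Module ℂ (Q x)]
    (gen : Set X → (∀ x, W x) → Prop) (pr : ∀ x, W x →ₗ[ℂ] Q x) (m : ℕ) (x : X) where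
  dom : Set X
  isOpen_dom : IsOpen dom
  mem_dom : x ∈ dom
  frame : Fin (m + 1) → ∀ y, Module.Dual ℂ (Q y)
  linearIndependent : ∀ y ∈ dom, LinearIndependent ℂ (fun i => frame i y)
  generating : ∀ y ∈ dom, ⊤ ≤ Submodule.span ℂ (Set.range fun i => frame i y)
  holomorphic : ∀ U ⊆ dom, IsOpen U → ∀ s : ∀ y, W y, gen U s →
    ∀ i, ContMDiffOn 𝓘(ℂ, E) 𝓘(ℂ, ℂ) ω (fun y => frame i y (pr y (s y))) U

/-- The vector of the tautological line in the dual of `Q` which represents the point with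
coordinates `w` in an affine chart, in the fibre over `y`. -/
def AffineChart.lift {E : Type*} [NormedAddCommGroup E] [NormedSpace ℂ E]
    {X : Type*} [TopologicalSpace X] [ChartedSpace E X] {W Q : X → Type*}
    [∀ x, AddCommGroup (W x)] [∀ x, Module ℂ (W x)]
    [∀ x, AddCommGroup (Q x)] [∀ x, Module ℂ (Q x)]
    {gen : Set X → (∀ x, W x) → Prop} {pr : ∀ x, W x →ₗ[ℂ] Q x} {m : ℕ} {x : X}
    (c : AffineChart E gen pr m x) (y : X) (w : Fin m → ℂ) : Module.Dual ℂ (Q y) :=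
  c.frame 0 y + ∑ j : Fin m, w j • c.frame j.succ y

/-- Differential `k`-forms on `P(Q)`, by their expressions in affine charts around the fibres over
the points `x` of `X`, in which `X` is identified with `E` by its chart at `x`. -/
abbrev ProjForm (E : Type*) [NormedAddCommGroup E] [NormedSpace ℂ E]
    {X : Type*} [TopologicalSpace X] [ChartedSpace E X] {W Q : X → Type*}
    [∀ x, AddCommGroup (W x)] [∀ x, Module ℂ (W x)]
    [∀ x, AddCommGroup (Q x)] [∀ x, Module ℂ (Q x)]
    (gen : Set X → (∀ x, W x) → Prop) (pr : ∀ x, W x →ₗ[ℂ] Q x) (m k : ℕ) : Type _ :=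
  ∀ x, AffineChart E gen pr m x → E × (Fin m → ℂ) → Form (E × (Fin m → ℂ)) k

/-- The restriction to `P(Q)` of the relative Fubini–Study form `η_W` on `P(W)` of the metric `H`,
that is `(i/2pr) R^{O(1)}`. The line bundle `O(1)` is dual to the tautological line bundle `O(-1)`,
which is a subbundle of the pull-back of the dual of `W` and has the induced metric. Hence
`η_W = (i/2pr) ∂∂̄ log |f|²` for any holomorphic non-vanishing local section `f` of `O(-1)`. -/
def fubiniStudy {E : Type*} [NormedAddCommGroup E] [NormedSpace ℂ E]
    {X : Type*} [TopologicalSpace X] [ChartedSpace E X] {W Q : X → Type*}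
    [∀ x, AddCommGroup (W x)] [∀ x, Module ℂ (W x)]
    [∀ x, AddCommGroup (Q x)] [∀ x, Module ℂ (Q x)]
    (gen : Set X → (∀ x, W x) → Prop) (H : ∀ x, SesqForm (W x)) (pr : ∀ x, W x →ₗ[ℂ] Q x)
    (m : ℕ) : ProjForm E gen pr m 2 := fun x c p =>
  (Complex.I / (2 * Real.pi)) • ddbar (fun q : E × (Fin m → ℂ) =>
    let y := (extChartAt 𝓘(ℂ, E) x).symm q.1
    ((Real.log (dualNormSq (H y) (c.lift y q.2 ∘ₗ pr y)) : ℝ) : ℂ)) p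

/-- The wedge powers of a `2`-form on `P(Q)`. -/
def ProjForm.pow {E : Type*} [NormedAddCommGroup E] [NormedSpace ℂ E]
    {X : Type*} [TopologicalSpace X] [ChartedSpace E X] {W Q : X → Type*}
    [∀ x, AddCommGroup (W x)] [∀ x, Module ℂ (W x)]
    [∀ x, AddCommGroup (Q x)] [∀ x, Module ℂ (Q x)]
    {gen : Set X → (∀ x, W x) → Prop} {pr : ∀ x, W x →ₗ[ℂ] Q x} {m : ℕ}
    (β : ProjForm E gen pr m 2) (p : ℕ) : ProjForm E gen pr m (2 * p) :=
  fun x c q => wedgePow (β x c q) p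

/-- The positively oriented real basis `e₁, i e₁, …, e_m, i e_m` of `ℂ^m`. -/
def stdRealFrame (m : ℕ) (i : Fin (2 * m)) : Fin m → ℂ :=
  Pi.single ⟨i / 2, by omega⟩ (if (i : ℕ) % 2 = 0 then 1 else Complex.I)

/-- `A` is the value at `x` of the fibre integral `∫_{P(Q) → X} β`, where `β` is a form of degree
`2p = 2k + 2m` on `P(Q)` and `m` is the dimension of the fibres: there are affine charts around the
fibre over `x`, and in each of them `A(u₁, …, u_{2k})` is the (absolutely convergent) integral over
the fibre of the contraction of `β` with lifts of the tangent vectors `u_i`. -/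
def HasFibreIntegral {E : Type*} [NormedAddCommGroup E] [NormedSpace ℂ E]
    {X : Type*} [TopologicalSpace X] [ChartedSpace E X] {W Q : X → Type*}
    [∀ x, AddCommGroup (W x)] [∀ x, Module ℂ (W x)]
    [∀ x, AddCommGroup (Q x)] [∀ x, Module ℂ (Q x)]
    {gen : Set X → (∀ x, W x) → Prop} {pr : ∀ x, W x →ₗ[ℂ] Q x} {m p : ℕ}
    (β : ProjForm E gen pr m (2 * p)) (k : ℕ) (hp : p = k + m) (x : X)
    (A : Form (TangentSpace 𝓘(ℂ, E) x) (2 * k)) : Prop :=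
  Nonempty (AffineChart E gen pr m x) ∧
  ∀ (c : AffineChart E gen pr m x) (u : Fin (2 * k) → E),
    let f : (Fin m → ℂ) → ℂ := fun w => β x c (extChartAt 𝓘(ℂ, E) x x, w)
      (Fin.append (fun i => ((u i, 0) : E × (Fin m → ℂ))) (fun j => (0, stdRealFrame m j)) ∘
        Fin.cast (by omega))
    MeasureTheory.Integrable f ∧ ∫ w, f w = A u

/-! ### The quotient of the exterior power -/

/-- The fibre of `F' = Coker(⋀^r Ker(V → F) → ⋀^r V)`. -/
abbrev ExtQuot {V F : Type*} [AddCommGroup V] [Module ℂ V] [AddCommGroup F] [Module ℂ F] (r : ℕ)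
    (q : V →ₗ[ℂ] F) : Type _ :=
  (⋀[ℂ]^r V) ⧸ LinearMap.range (exteriorPower.map r (LinearMap.ker q).subtype)

/-- The quotient map `⋀^r V → F'`. -/
def extQuotMap {V F : Type*} [AddCommGroup V] [Module ℂ V] [AddCommGroup F] [Module ℂ F] (r : ℕ)
    (q : V →ₗ[ℂ] F) : (⋀[ℂ]^r V) →ₗ[ℂ] ExtQuot r q :=
  Submodule.mkQ _

/-- The Fubini–Study form `η_V` of `h`, restricted to `P(F)`, for a line bundle quotient `F` of
`V`. -/
def etaV {E : Type*} [NormedAddCommGroup E] [NormedSpace ℂ E]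
    {X : Type*} [TopologicalSpace X] [ChartedSpace E X]
    {M : Type*} [NormedAddCommGroup M] [NormedSpace ℂ M] {V : X → Type*}
    [TopologicalSpace (Bundle.TotalSpace M V)] [∀ x, TopologicalSpace (V x)] [FiberBundle M V]
    [∀ x, AddCommGroup (V x)] [∀ x, Module ℂ (V x)] (h : HermitianMetric E M V)
    {F : X → Type*} [∀ x, AddCommGroup (F x)] [∀ x, Module ℂ (F x)] (q : ∀ x, V x →ₗ[ℂ] F x) :
    ProjForm E (IsHolSection (E := E) M) q 0 2 :=
  fubiniStudy _ h.form q 0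

/-- The Fubini–Study form `η_⋀` of the metric induced by `h` on `⋀^r V`, restricted to `P(F')`;
the fibres of `P(F')` have dimension `r - 1`. -/
def etaExt {E : Type*} [NormedAddCommGroup E] [NormedSpace ℂ E]
    {X : Type*} [TopologicalSpace X] [ChartedSpace E X]
    {M : Type*} [NormedAddCommGroup M] [NormedSpace ℂ M] {V : X → Type*}
    [TopologicalSpace (Bundle.TotalSpace M V)] [∀ x, TopologicalSpace (V x)] [FiberBundle M V]
    [∀ x, AddCommGroup (V x)] [∀ x, Module ℂ (V x)] (h : HermitianMetric E M V)
    {F : X → Type*} [∀ x, AddCommGroup (F x)] [∀ x, Module ℂ (F x)] (q : ∀ x, V x →ₗ[ℂ] F x)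
    (r : ℕ) :
    ProjForm E (W := fun x => ⋀[ℂ]^r (V x)) (Q := fun x => ExtQuot r (q x))
      (IsDecomposableSection (E := E) M r) (fun x => extQuotMap r (q x)) (r - 1) 2 :=
  fubiniStudy (W := fun x => ⋀[ℂ]^r (V x)) (Q := fun x => ExtQuot r (q x)) _
    (fun x => exteriorForm (h.form x) r) (fun x => extQuotMap r (q x)) (r - 1)

end FibreIntegrals

end

noncomputable section

namespace FibreIntegrals

/-! ### Wedge products of linear forms -/

section Wedge

variable {N N' : Type*} [AddCommGroup N] [Module ℝ N] [AddCommGroup N'] [Module ℝ N']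

/-! Choose a local holomorphic frame `e 0, …, e r` of `V` with `e 1, …, e r` in `Ker q`, and let `G`
and `K` be the Gram matrices of the whole frame and of its last `r` members. By Cramer's rule a
functional `f ∘ q` has squared dual norm `‖f (e 0)‖² det K / det G`. The fibres of `P(F)` are points
and the logarithm of the modulus of a holomorphic function is pluriharmonic, so the integral over
`P(F)` is `(i/2π) ∂∂̄ (log det K - log det G)`.

On the other side, `⋀^r V ≅ V* ⊗ det V` isometrically: the functionals on `⋀^r V` are `w ↦ det (v,
w)`, with squared norm `H v v / det G` (`dualNormSq_detFunctional`). Those which vanish on `⋀^r Ker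
q` come from `v` in `Ker q` (`comp_extQuotMap_eq`). So the dual of `F'` is `Ker q ⊗ (det V)*`, and
in an affine chart of `P(F')` its metric is given by a matrix `D = g K g* / det G` with `g`
holomorphic.

The fibre integral is computed in `integral_wedgePow_log_affineForm`: for a family `D` of positive
hermitian matrices of size `m + 1`, the top power of `(i/2π) ∂∂̄ log (∑ W_a conj(W_b) D_ab)`
integrates to `(i/2π) ∂∂̄ log det D`. Contraction with the fibre directions turns the power into a
determinant of Levi forms (`wedgePow_interleave`). A Schur complement (`det_levi_matrix`) rewrites
it as the value of `∂∂̄D - ∂D D⁻¹ ∂̄D` at `W`, divided by a power of the value of `D`. The resulting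
integral follows from `∫ D(W)^{-(m+1)} = π^m / (m! det D)` by differentiation in `D`, and the answer
is recognised as the trace formula `levi_log_det`.

For `m + 1 = r` one has `det D = |det g|² det K / (det G)^r`, so the integral over `P(F')` is
`(i/2π) ∂∂̄ (log det K - r log det G)`. The two integrals differ by `(r - 1) (i/2π) ∂∂̄ log det G`,
which is `-(r - 1) (i/2π) R^{det V}`.

If the metric is trivial, `log det G` is pluriharmonic and the curvature term disappears. The powers
over `P(F)` are powers of a form on the base. Over `P(F')` the dual norm is `∑ |κ_i|²` for a
holomorphic `κ` with `r + 1` components, so the form is a pull-back from projective `r`-space and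
its powers above the `r`-th vanish pointwise. -/

theorem wedge_apply {k l : ℕ} (a : Form N k) (b : Form N l) (v : Fin (k + l) → N) :
    wedge a b v = LinearMap.mul' ℝ ℂ (a.domCoprod b (fun i => v (finSumFinEquiv i))) := rfl

theorem alternatingMap_sum_apply {ι κ P : Type*} [AddCommGroup P] [Module ℝ P] (s : Finset ι)
    (a : ι → N [⋀^κ]→ₗ[ℝ] P) (v : κ → N) : (∑ i ∈ s, a i) v = ∑ i ∈ s, a i v :=
  map_sum (⟨⟨fun f : N [⋀^κ]→ₗ[ℝ] P => f v, rfl⟩, fun _ _ => rfl⟩ : (N [⋀^κ]→ₗ[ℝ] P) →+ P) a s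

theorem wedge_compLinearMap {k l : ℕ} (a : Form N k) (b : Form N l) (f : N' →ₗ[ℝ] N) :
    wedge (a.compLinearMap f) (b.compLinearMap f) = (wedge a b).compLinearMap f := by
  ext v
  rw [AlternatingMap.compLinearMap_apply, wedge_apply, wedge_apply]
  congr 1
  simp only [AlternatingMap.domCoprod_apply, _root_.sum_apply]
  refine Finset.sum_congr rfl fun σ _ => ?_
  induction σ using Quotient.inductionOn' with | _ σ
  rfl

theorem wedgePow_compLinearMap (a : Form N 2) (f : N' →ₗ[ℝ] N) (p : ℕ) :
    wedgePow (a.compLinearMap f) p = (wedgePow a p).compLinearMap f := by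
  induction p with
  | zero => rfl
  | succ p ih =>
    change wedge (wedgePow (a.compLinearMap f) p) (a.compLinearMap f) =
      (wedge (wedgePow a p) a).compLinearMap f
    rw [ih, wedge_compLinearMap]

/-- The wedge product of linear forms. -/
def wedgeProd {k : ℕ} (f : Fin k → (N →ₗ[ℝ] ℂ)) : Form N k :=
  MultilinearMap.alternatization ((MultilinearMap.mkPiAlgebra ℝ (Fin k) ℂ).compLinearMap f)

theorem wedgeProd_apply {k : ℕ} (f : Fin k → (N →ₗ[ℝ] ℂ)) (v : Fin k → N) :
    wedgeProd f v = Matrix.det (Matrix.of fun i j => f i (v j)) := by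
  rw [← Matrix.det_transpose, Matrix.det_apply, wedgeProd, MultilinearMap.alternatization_apply]
  rfl

/-- The coproduct of two antisymmetrisations is the antisymmetrisation of the product. In the chosen
normalisation no factorials appear. -/
theorem wedge_wedgeProd {k l : ℕ} (f : Fin k → (N →ₗ[ℝ] ℂ)) (g : Fin l → (N →ₗ[ℝ] ℂ)) :
    wedge (wedgeProd f) (wedgeProd g) = wedgeProd (Fin.append f g) := by
  ext v
  rw [wedge_apply, wedgeProd, wedgeProd, ← MultilinearMap.domCoprod_alternization,
    MultilinearMap.alternatization_apply, wedgeProd_apply,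
    ← Matrix.det_submatrix_equiv_self finSumFinEquiv, ← Matrix.det_transpose, Matrix.det_apply,
    map_sum]
  refine Finset.sum_congr rfl fun σ _ => ?_
  rw [map_zsmul_unit]
  congr 1
  simp [MultilinearMap.domCoprod_apply, Fintype.prod_sum_type]

theorem wedge_sum_sum {k l : ℕ} {ι κ : Type*} [Fintype ι] [Fintype κ] (a : ι → Form N k)
    (b : κ → Form N l) :
    wedge (∑ i, a i) (∑ j, b j) = ∑ i, ∑ j, wedge (a i) (b j) := by
  ext v
  simp only [wedge_apply, alternatingMap_sum_apply, ← AlternatingMap.domCoprod'_apply,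
    TensorProduct.sum_tmul, TensorProduct.tmul_sum, map_sum]
  rw [Finset.sum_comm]

/-- The family `a₀, b₀, a₁, b₁, …`. -/
def interleave {α : Type*} {n : ℕ} (a b : Fin n → α) (i : Fin (2 * n)) : α :=
  if (i : ℕ) % 2 = 0 then a ⟨i / 2, by omega⟩ else b ⟨i / 2, by omega⟩

/-- The index set of an interleaved family. -/
def interleaveEquiv (n : ℕ) : Fin n ⊕ Fin n ≃ Fin (2 * n) where
  toFun := Sum.elim (fun k => ⟨2 * k, by omega⟩) (fun k => ⟨2 * k + 1, by omega⟩)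
  invFun i := if (i : ℕ) % 2 = 0 then Sum.inl ⟨i / 2, by omega⟩ else Sum.inr ⟨i / 2, by omega⟩
  left_inv := by
    rintro (k | k)
    · simp
    · have h : (2 * (k : ℕ) + 1) % 2 = 1 := by omega
      have h' : (2 * (k : ℕ) + 1) / 2 = k := by omega
      simp [h, h']
  right_inv i := by
    dsimp only
    split_ifs with h
    · ext; simp; omega
    · ext; simp; omega

theorem interleave_inl {α : Type*} {n : ℕ} (a b : Fin n → α) (k : Fin n) :
    interleave a b (interleaveEquiv n (Sum.inl k)) = a k := by
  simp [interleave, interleaveEquiv]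

theorem interleave_inr {α : Type*} {n : ℕ} (a b : Fin n → α) (k : Fin n) :
    interleave a b (interleaveEquiv n (Sum.inr k)) = b k := by
  have h : (2 * (k : ℕ) + 1) % 2 = 1 := by omega
  have h' : (2 * (k : ℕ) + 1) / 2 = k := by omega
  simp [interleave, interleaveEquiv, h, h']

theorem interleave_snoc {α : Type*} {n : ℕ} (a b : Fin n → α) (x y : α) :
    interleave (Fin.snoc a x : Fin (n + 1) → α) (Fin.snoc b y : Fin (n + 1) → α) =
      Fin.append (interleave a b) ![x, y] := by
  funext i
  obtain ⟨i, rfl⟩ := (finSumFinEquiv (m := 2 * n) (n := 2)).surjective i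
  rcases i with i | i
  · have h : (i : ℕ) / 2 < n := by omega
    simp only [finSumFinEquiv_apply_left, Fin.append_left]
    simp [interleave, Fin.snoc, h]
  · rw [finSumFinEquiv_apply_right, Fin.append_right]
    fin_cases i
    · simp [interleave, Fin.snoc]
    · have h : (2 * n + 1) % 2 = 1 := by omega
      have h' : (2 * n + 1) / 2 = n := by omega
      simp [interleave, Fin.snoc, h, h']

/-- Multilinear expansion over all maps `t`. The non-injective ones are kept, since they drop out
later as determinants with a repeated row. -/
theorem wedgePow_sum {ι : Type*} [Fintype ι] (a b : ι → (N →ₗ[ℝ] ℂ)) (p : ℕ) :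
    wedgePow (∑ j, wedgeProd ![a j, b j]) p =
      ∑ t : Fin p → ι, wedgeProd (interleave (a ∘ t) (b ∘ t)) := by
  induction p with
  | zero =>
    ext v
    simp [wedgePow, wedgeProd_apply]
  | succ p ih =>
    change wedge (wedgePow _ p) _ = _
    rw [ih, wedge_sum_sum, ← (Fin.snocEquiv fun _ : Fin (p + 1) => ι).sum_comp,
      Fintype.sum_prod_type_right]
    refine Finset.sum_congr rfl fun t _ => Finset.sum_congr rfl fun j _ => ?_
    rw [wedge_wedgeProd, ← interleave_snoc]
    congr 1
    simp [Fin.snocEquiv, Fin.comp_snoc]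

end Wedge

/-! ### Top powers of forms of type `(1,1)` -/

section ComplexWedge

variable {N : Type*} [AddCommGroup N] [Module ℂ N]

/-- Subtracting `I` times the first block column from the second leaves a block triangular matrix
with diagonal blocks `A` and `-2 I B`. -/
theorem det_fromBlocks_conj {n : ℕ} (A B : Matrix (Fin n) (Fin n) ℂ) :
    (Matrix.fromBlocks A (Complex.I • A) B (-Complex.I • B)).det =
      (-2 * Complex.I) ^ n * (A.det * B.det) := by
  have h : Matrix.fromBlocks A (Complex.I • A) B (-Complex.I • B) =
      Matrix.fromBlocks A 0 B ((-2 * Complex.I) • B) *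
        Matrix.fromBlocks 1 (Complex.I • (1 : Matrix (Fin n) (Fin n) ℂ)) 0 1 := by
    rw [Matrix.fromBlocks_multiply]
    simp only [mul_one, mul_zero, add_zero, Matrix.mul_smul]
    congr 1
    module
  rw [h, Matrix.det_mul, Matrix.det_fromBlocks_zero₁₂, Matrix.det_fromBlocks_zero₂₁,
    Matrix.det_smul, Matrix.det_one, Fintype.card_fin]
  ring

theorem wedgeProd_interleave {n : ℕ} (a b : Fin n → (N →ₗ[ℝ] ℂ))
    (ha : ∀ j v, a j (Complex.I • v) = Complex.I * a j v)
    (hb : ∀ j v, b j (Complex.I • v) = -Complex.I * b j v) (v : Fin n → N) :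
    wedgeProd (interleave a b) (interleave v fun k => Complex.I • v k) =
      (-2 * Complex.I) ^ n * ((Matrix.of fun j k => a j (v k)).det *
        (Matrix.of fun j k => b j (v k)).det) := by
  -- Rows and columns are reordered by the same bijection, so no sign appears.
  rw [wedgeProd_apply, ← det_fromBlocks_conj, ← Matrix.det_submatrix_equiv_self (interleaveEquiv n)]
  congr 1
  ext (i | i) (j | j) <;>
    simp [interleave_inl, interleave_inr, ha, hb]

/-- A non-injective `t` repeats a row. For each of the `n!` permutations the sign enters twice and
cancels. -/
theorem sum_det_mul_det {n : ℕ} (A B : Matrix (Fin n) (Fin n) ℂ) :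
    ∑ t : Fin n → Fin n, (A.submatrix t id).det * (B.submatrix t id).det =
      n.factorial * (A.det * B.det) := by
  classical
  have h : ∀ t ∉ Finset.univ.image (fun σ : Equiv.Perm (Fin n) => (σ : Fin n → Fin n)),
      (A.submatrix t id).det * (B.submatrix t id).det = 0 := by
    intro t ht
    have : ¬ Function.Injective t := fun hi =>
      ht (Finset.mem_image.2 ⟨Equiv.ofBijective t (Finite.injective_iff_bijective.1 hi),
        Finset.mem_univ _, rfl⟩)
    simp only [Function.Injective, not_forall] at this
    obtain ⟨i, j, hij, hne⟩ := this
    rw [Matrix.det_zero_of_row_eq hne (by funext k; simp [hij]), zero_mul]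
  rw [← Finset.sum_subset (Finset.subset_univ _) fun t _ ht => h t ht,
    Finset.sum_image fun σ _ τ _ h => DFunLike.coe_injective h]
  simp only [Matrix.det_permute]
  have : ∀ σ : Equiv.Perm (Fin n), ((Equiv.Perm.sign σ : ℤ) : ℂ) * A.det *
      (((Equiv.Perm.sign σ : ℤ) : ℂ) * B.det) = A.det * B.det := by
    intro σ
    rcases Int.units_eq_one_or (Equiv.Perm.sign σ) with h | h <;> simp [h]
  simp [this, Fintype.card_perm]

/-- The top wedge power of a form of type `(1,1)` is a determinant. -/
theorem wedgePow_interleave {n : ℕ} (β : Form N 2) (S : SesqForm N)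
    (hβ : ∀ u v, β ![u, v] = S u v - S v u) (v : Fin n → N) :
    wedgePow β n (interleave v fun k => Complex.I • v k) =
      n.factorial * (-2 * Complex.I) ^ n * (Matrix.of fun j k => S (v j) (v k)).det := by
  -- Everything is pulled back to `ℂ^n` along `z ↦ ∑ z_j v_j`, where `a j` is the `j`-th coordinate
  -- and `b j` is antilinear.
  let L : (Fin n → ℂ) →ₗ[ℝ] N := (Fintype.linearCombination ℂ v).restrictScalars ℝ
  let a : Fin n → ((Fin n → ℂ) →ₗ[ℝ] ℂ) := fun j => (LinearMap.proj j : (Fin n → ℂ) →ₗ[ℂ] ℂ).restrictScalars ℝ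
  let b : Fin n → ((Fin n → ℂ) →ₗ[ℝ] ℂ) := fun j =>
    { toFun := fun z => S (v j) (L z)
      map_add' := by simp
      map_smul' := by
        intro c z
        have : c • z = (c : ℂ) • z := by ext; simp
        simp [this, L, -Complex.coe_smul, -map_smul] }
  -- Expanding `S` in its first variable alone writes the form as a sum of products `a j ∧ b j`.
  have hL : β.compLinearMap L = ∑ j, wedgeProd ![a j, b j] := by
    ext w
    have hw : (fun i => L (w i)) = ![L (w 0), L (w 1)] := by
      funext i; fin_cases i <;> rfl
    rw [AlternatingMap.compLinearMap_apply, hw, hβ]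
    have key : ∀ z y, S (L z) y = ∑ j, z j * S (v j) y := by
      intro z y
      simp [L, Fintype.linearCombination_apply]
    simp only [alternatingMap_sum_apply, wedgeProd_apply, Matrix.det_fin_two]
    rw [key, key, ← Finset.sum_sub_distrib]
    refine Finset.sum_congr rfl fun j _ => ?_
    simp [a, b]
  have hv : (interleave v fun k => Complex.I • v k) =
      fun i => L (interleave (fun k => Pi.single k 1) (fun k => Complex.I • Pi.single k 1) i) := by
    funext i
    obtain ⟨i, rfl⟩ := (interleaveEquiv n).surjective i
    rcases i with i | i
    · simp [interleave_inl, L, Fintype.linearCombination_apply_single]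
    · simp [interleave_inr, L, Fintype.linearCombination_apply_single]
  have : wedgePow β n (interleave v fun k => Complex.I • v k) =
      (wedgePow β n).compLinearMap L
        (interleave (fun k => Pi.single k 1) (fun k => Complex.I • Pi.single k 1)) := by
    rw [hv]; rfl
  rw [this, ← wedgePow_compLinearMap, hL, wedgePow_sum, alternatingMap_sum_apply]
  have h1 : ∀ t : Fin n → Fin n, wedgeProd (interleave (a ∘ t) (b ∘ t))
      (interleave (fun k => Pi.single k 1) (fun k => Complex.I • Pi.single k 1)) =
      (-2 * Complex.I) ^ n * ((Matrix.submatrix (1 : Matrix (Fin n) (Fin n) ℂ) t id).det *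
        (Matrix.submatrix (Matrix.of fun j k => S (v j) (v k)) t id).det) := by
    intro t
    rw [wedgeProd_interleave]
    · congr 3
      · ext j k
        simp [a, Matrix.one_apply, Pi.single_apply]
      · ext j k
        simp [b, L, Fintype.linearCombination_apply_single]
    · intro j z; simp [a]
    · intro j z; simp [b, L]
  rw [Finset.sum_congr rfl fun t _ => h1 t, ← Finset.mul_sum, sum_det_mul_det]
  simp
  ring

/-- A quarter turn in the plane of `a k`, `b k` is a transposition followed by a change of sign, and
the two signs cancel. -/
theorem map_interleave_update {n : ℕ} (g : Form N (2 * n)) (a b : Fin n → N) (k : Fin n) :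
    g (interleave (Function.update a k (b k)) (Function.update b k (-a k))) =
      g (interleave a b) := by
  set p := interleaveEquiv n (Sum.inl k) with hp
  set q := interleaveEquiv n (Sum.inr k) with hq
  have hpq : p ≠ q := by simp [hp, hq]
  have h : interleave (Function.update a k (b k)) (Function.update b k (-a k)) =
      Function.update (interleave a b ∘ Equiv.swap p q) q
        (-(interleave a b ∘ Equiv.swap p q) q) := by
    funext i
    obtain ⟨i, rfl⟩ := (interleaveEquiv n).surjective i
    rcases i with i | i
    · have hiq : interleaveEquiv n (Sum.inl i) ≠ q := by simp [hq]
      rw [interleave_inl, Function.update_of_ne hiq, Function.comp_apply]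
      by_cases hi : i = k
      · subst hi
        rw [← hp, Equiv.swap_apply_left, hq, interleave_inr, Function.update_self]
      · rw [Function.update_of_ne hi, Equiv.swap_apply_of_ne_of_ne
          (by simpa [hp] using hi) hiq, interleave_inl]
    · rw [interleave_inr]
      by_cases hi : i = k
      · subst hi
        rw [← hq, Function.update_self, Function.update_self, Function.comp_apply,
          Equiv.swap_apply_right, hp, interleave_inl]
      · have hiq : interleaveEquiv n (Sum.inr i) ≠ q := by simpa [hq] using hi
        rw [Function.update_of_ne hi, Function.update_of_ne hiq, Function.comp_apply,
          Equiv.swap_apply_of_ne_of_ne (by simp [hp]) hiq, interleave_inr]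
  rw [h, g.map_update_neg, Function.update_eq_self, g.map_swap _ hpq, neg_neg]

theorem map_interleave_rotate {n : ℕ} (g : Form N (2 * n)) (a b : Fin n → N) (s : Finset (Fin n)) :
    g (interleave (fun k => if k ∈ s then b k else a k) (fun k => if k ∈ s then -a k else b k)) =
      g (interleave a b) := by
  induction s using Finset.induction_on with
  | empty => simp
  | insert k s hk ih =>
    refine Eq.trans ?_ ih
    rw [← map_interleave_update g (fun k => if k ∈ s then b k else a k)
      (fun k => if k ∈ s then -a k else b k) k]
    congr 2 <;>
    · funext j
      by_cases hj : j = k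
      · subst hj; simp [hk]
      · simp [hj]

/-- The contraction of a form with a complex frame is invariant under the complex structure. -/
theorem map_cons_interleave_I {m : ℕ} (β : Form N (2 * (m + 1)))
    (hβ : ∀ v, β (fun i => Complex.I • v i) = β v) (x y : N) (e : Fin m → N) :
    β (interleave (Fin.cons (Complex.I • x) e : Fin (m + 1) → N)
      (Fin.cons (Complex.I • y) fun k => Complex.I • e k : Fin (m + 1) → N)) =
    β (interleave (Fin.cons x e : Fin (m + 1) → N)
      (Fin.cons y fun k => Complex.I • e k : Fin (m + 1) → N)) := by
  -- Multiplying all arguments by `I` turns each pair `(e k, I • e k)` into `(I • e k, -e k)`. This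
  -- is a quarter turn, which does not change the value, so only the first pair `(x, y)` is
  -- affected.
  rw [← hβ (interleave (Fin.cons x e) _), ← map_interleave_rotate β _ _ (Finset.univ.erase 0)]
  congr 1
  funext i
  obtain ⟨i, rfl⟩ := (interleaveEquiv _).surjective i
  rcases i with i | i
  · rw [interleave_inl, interleave_inl]
    refine Fin.cases ?_ (fun j => ?_) i <;> simp
  · rw [interleave_inr, interleave_inr]
    refine Fin.cases ?_ (fun j => ?_) i <;> simp [smul_smul]

/-- A `2`-form which is invariant under the complex structure is determined by its values on
complex lines. -/
theorem polarization_of_invariant (α : Form N 2)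
    (hα : ∀ x y, α ![Complex.I • x, Complex.I • y] = α ![x, y]) (u v : N) :
    α ![u, v] = (1 / 4) * (α ![u - Complex.I • v, Complex.I • (u - Complex.I • v)] -
      α ![u + Complex.I • v, Complex.I • (u + Complex.I • v)]) := by
  let B : N → N → ℂ := fun x y => α ![x, y]
  have hu : ∀ x y : N, Function.update ![0, y] 0 x = ![x, y] := fun x y => by
    funext i; fin_cases i <;> simp
  have hadd : ∀ x x' y, B (x + x') y = B x y + B x' y := fun x x' y => by
    have := α.map_update_add ![0, y] 0 x x'
    simpa only [hu] using this
  have hswap : ∀ x y, B y x = - B x y := fun x y => by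
    have := α.map_swap ![x, y] (i := 0) (j := 1) (by decide)
    have h : ![x, y] ∘ Equiv.swap 0 1 = ![y, x] := by
      funext i; fin_cases i <;> simp
    rwa [h] at this
  have hneg : ∀ x y, B (-x) y = - B x y := fun x y => by
    have := α.map_update_neg ![0, y] 0 x
    simpa only [hu] using this
  have hadd' : ∀ x y y', B x (y + y') = B x y + B x y' := fun x y y' => by
    rw [hswap, hadd, hswap y, hswap y']; ring
  have hneg' : ∀ x y, B x (-y) = - B x y := fun x y => by
    rw [hswap, hneg, hswap y]
  have hI : ∀ x y, B (Complex.I • x) (Complex.I • y) = B x y := hα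
  change B u v = 1 / 4 * (B _ _ - B _ _)
  have hII : ∀ x : N, Complex.I • Complex.I • x = -x := fun x => by simp [smul_smul]
  -- The terms `B u (I • u)` and `B (I • v) v` occur in both values and cancel, and four copies of
  -- `B u v` remain.
  simp only [sub_eq_add_neg, smul_add, smul_neg, hII, neg_neg, hadd, hadd', hneg, hneg', hI]
  have h1 : B v u = - B u v := hswap _ _
  have h2 : B (Complex.I • v) v = - B v (Complex.I • v) := hswap _ _
  rw [h1]
  ring

end ComplexWedge

/-! ### Wirtinger derivatives and the Levi form -/

section Levi

variable {N : Type*} [NormedAddCommGroup N] [NormedSpace ℂ N]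

theorem dbar_apply (φ : N → ℂ) (z v : N) :
    dbar φ z v = 1 / 2 * (fderiv ℝ φ z v + Complex.I * fderiv ℝ φ z (Complex.I • v)) := by
  simp [dbar]
  ring

/-- The `(1,0)`-part of the derivative of `φ`. -/
def del (φ : N → ℂ) (z v : N) : ℂ :=
  1 / 2 * (fderiv ℝ φ z v - Complex.I * fderiv ℝ φ z (Complex.I • v))

theorem real_smul_eq (c : ℝ) (v : N) : c • v = (c : ℂ) • v := (Complex.coe_smul c v).symm

/-- The Levi form `(u, v) ↦ ∂_u ∂̄_v φ`. -/
def levi (φ : N → ℂ) (z : N) : SesqForm N :=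
  let B := fderiv ℝ (fderiv ℝ φ) z
  LinearMap.mk₂'ₛₗ (RingHom.id ℂ) (starRingEnd ℂ)
    (fun u v => 1 / 4 * (B u v + Complex.I * B u (Complex.I • v) -
      Complex.I * B (Complex.I • u) v + B (Complex.I • u) (Complex.I • v)))
    (fun u u' v => by simp only [smul_add, map_add, _root_.add_apply]; ring)
    (fun c u v => by
      have h1 : c • u = c.re • u + c.im • (Complex.I • u) := by
        rw [real_smul_eq, real_smul_eq, smul_smul, ← add_smul, Complex.re_add_im]
      have h2 : Complex.I • c • u = c.re • (Complex.I • u) - c.im • u := by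
        rw [real_smul_eq, real_smul_eq, smul_smul, smul_smul, ← sub_smul]
        congr 1
        apply Complex.ext <;> simp
      rw [h2, h1]
      simp only [map_add, map_sub, map_smul, _root_.add_apply, _root_.sub_apply,
        _root_.smul_apply, Complex.real_smul, smul_eq_mul, RingHom.id_apply]
      conv_rhs => rw [← Complex.re_add_im c]
      linear_combination (c.im : ℂ) / 4 * (B (Complex.I • u) v - B u (Complex.I • v)) *
        Complex.I_sq)
    (fun u v v' => by simp only [smul_add, map_add]; ring)
    (fun c u v => by
      have h1 : c • v = c.re • v + c.im • (Complex.I • v) := by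
        rw [real_smul_eq, real_smul_eq, smul_smul, ← add_smul, Complex.re_add_im]
      have h2 : Complex.I • c • v = c.re • (Complex.I • v) - c.im • v := by
        rw [real_smul_eq, real_smul_eq, smul_smul, smul_smul, ← sub_smul]
        congr 1
        apply Complex.ext <;> simp
      rw [h2, h1]
      simp only [map_add, map_sub, map_smul, Complex.real_smul, smul_eq_mul]
      have h3 : (starRingEnd ℂ) c = c.re - c.im * Complex.I := by
        apply Complex.ext <;> simp
      rw [h3]
      linear_combination (c.im : ℂ) / 4 * (B u (Complex.I • v) - B (Complex.I • u) v) *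
        Complex.I_sq)

variable {φ ψ : N → ℂ} {z : N}

theorem levi_apply (φ : N → ℂ) (z u v : N) :
    levi φ z u v = 1 / 4 * (fderiv ℝ (fderiv ℝ φ) z u v
      + Complex.I * fderiv ℝ (fderiv ℝ φ) z u (Complex.I • v) -
      Complex.I * fderiv ℝ (fderiv ℝ φ) z (Complex.I • u) v +
      fderiv ℝ (fderiv ℝ φ) z (Complex.I • u) (Complex.I • v)) := rfl

theorem dbar_congr (h : φ =ᶠ[𝓝 z] ψ) : dbar φ z = dbar ψ z := by
  unfold dbar; rw [h.fderiv_eq]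

theorem del_congr (h : φ =ᶠ[𝓝 z] ψ) : del φ z = del ψ z := by
  funext u; unfold del; rw [h.fderiv_eq]

theorem levi_congr (h : φ =ᶠ[𝓝 z] ψ) : levi φ z = levi ψ z := by
  ext u v; rw [levi_apply, levi_apply, h.fderiv.fderiv_eq]

theorem ddbar_congr (h : φ =ᶠ[𝓝 z] ψ) : ddbar φ z = ddbar ψ z := by
  unfold ddbar
  rw [Filter.EventuallyEq.extDeriv_eq]
  filter_upwards [h.eventuallyEq_nhds] with y hy
  rw [dbar_congr hy]

theorem differentiableAt_fderiv (h : ContDiffAt ℝ 2 φ z) :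
    DifferentiableAt ℝ (fderiv ℝ φ) z :=
  (h.fderiv_right (m := 1) (by norm_num)).differentiableAt one_ne_zero

theorem hasFDerivAt_fderiv_apply (h : ContDiffAt ℝ 2 φ z) (v : N) :
    HasFDerivAt (fun y => fderiv ℝ φ y v) ((fderiv ℝ (fderiv ℝ φ) z).flip v) z :=
  (differentiableAt_fderiv h).hasFDerivAt.clm_apply (hasFDerivAt_const v z) |>.congr_fderiv (by
    ext; simp)

theorem hasFDerivAt_dbar_apply (h : ContDiffAt ℝ 2 φ z) (v : N) :
    HasFDerivAt (fun y => dbar φ y v) ((1 / 2 : ℂ) • ((fderiv ℝ (fderiv ℝ φ) z).flip v +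
      Complex.I • (fderiv ℝ (fderiv ℝ φ) z).flip (Complex.I • v))) z := by
  simp only [dbar_apply]
  exact ((hasFDerivAt_fderiv_apply h v).add
    ((hasFDerivAt_fderiv_apply h (Complex.I • v)).const_mul Complex.I)).const_mul _

theorem differentiableAt_dbar (h : ContDiffAt ℝ 2 φ z) (v : N) :
    DifferentiableAt ℝ (fun y => dbar φ y v) z :=
  (hasFDerivAt_dbar_apply h v).differentiableAt

/-- The second real derivative makes sesquilinearity of `levi` visible. The iterated form is the one
to which the product and chain rules apply. -/
theorem levi_eq_del_dbar (h : ContDiffAt ℝ 2 φ z) (u v : N) :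
    levi φ z u v = del (fun y => dbar φ y v) z u := by
  rw [del, (hasFDerivAt_dbar_apply h v).fderiv, levi_apply]
  simp
  linear_combination (1 / 4) * (fderiv ℝ (fderiv ℝ φ) z (Complex.I • u) (Complex.I • v)) *
    Complex.I_sq

/-- The exterior derivative antisymmetrises the derivative of `dbar φ`, and symmetry of the second
derivative removes its `(0,2)`-part. -/
theorem ddbar_apply (h : ContDiffAt ℝ 2 φ z) (u v : N) :
    ddbar φ z ![u, v] = levi φ z u v - levi φ z v u := by
  have hd : DifferentiableAt ℝ (dbar φ) z := by
    unfold dbar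
    have := differentiableAt_fderiv h
    fun_prop
  have hd' : DifferentiableAt ℝ
      (fun y => ContinuousAlternatingMap.ofSubsingleton ℝ N ℂ (0 : Fin 1) (dbar φ y)) z :=
    ((ContinuousAlternatingMap.ofSubsingletonLIE (𝕜 := ℝ) (E := N) (F := ℂ) (0 : Fin 1)).toContinuousLinearEquiv
      |>.differentiableAt).comp z hd
  have hs : ∀ a b, fderiv ℝ (fderiv ℝ φ) z a b = fderiv ℝ (fderiv ℝ φ) z b a := fun a b =>
    (h.isSymmSndFDerivAt (by simp)).eq a b
  change extDeriv _ z ![u, v] = _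
  rw [extDeriv_apply hd', Fin.sum_univ_two]
  have e0 : ∀ y, ContinuousAlternatingMap.ofSubsingleton ℝ N ℂ (0 : Fin 1) (dbar φ y)
      ((0 : Fin 2).removeNth ![u, v]) = dbar φ y v := fun y => rfl
  have e1 : ∀ y, ContinuousAlternatingMap.ofSubsingleton ℝ N ℂ (0 : Fin 1) (dbar φ y)
      ((1 : Fin 2).removeNth ![u, v]) = dbar φ y u := fun y => rfl
  simp only [e0, e1, (hasFDerivAt_dbar_apply h _).fderiv, levi_apply]
  simp
  rw [hs v u, hs (Complex.I • u) (Complex.I • v), hs v (Complex.I • u), hs (Complex.I • v) u]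
  ring

theorem del_mul (hφ : DifferentiableAt ℝ φ z) (hψ : DifferentiableAt ℝ ψ z) (u : N) :
    del (fun y => φ y * ψ y) z u = del φ z u * ψ z + φ z * del ψ z u := by
  simp only [del, (hφ.hasFDerivAt.fun_mul hψ.hasFDerivAt).fderiv, _root_.add_apply,
    _root_.smul_apply, smul_eq_mul]
  ring

theorem dbar_mul (hφ : DifferentiableAt ℝ φ z) (hψ : DifferentiableAt ℝ ψ z) (u : N) :
    dbar (fun y => φ y * ψ y) z u = dbar φ z u * ψ z + φ z * dbar ψ z u := by
  simp only [dbar_apply, (hφ.hasFDerivAt.fun_mul hψ.hasFDerivAt).fderiv, _root_.add_apply,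
    _root_.smul_apply, smul_eq_mul]
  ring

theorem del_add (hφ : DifferentiableAt ℝ φ z) (hψ : DifferentiableAt ℝ ψ z) (u : N) :
    del (fun y => φ y + ψ y) z u = del φ z u + del ψ z u := by
  simp only [del, (hφ.hasFDerivAt.fun_add hψ.hasFDerivAt).fderiv, _root_.add_apply]
  ring

theorem del_sum {ι : Type*} (s : Finset ι) {φ : ι → N → ℂ}
    (hφ : ∀ i ∈ s, DifferentiableAt ℝ (φ i) z) (u : N) :
    del (fun y => ∑ i ∈ s, φ i y) z u = ∑ i ∈ s, del (φ i) z u := by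
  simp only [del, (HasFDerivAt.fun_sum fun i hi => (hφ i hi).hasFDerivAt).fderiv,
    _root_.sum_apply, Finset.mul_sum, ← Finset.sum_sub_distrib]

theorem dbar_sum {ι : Type*} (s : Finset ι) {φ : ι → N → ℂ}
    (hφ : ∀ i ∈ s, DifferentiableAt ℝ (φ i) z) (u : N) :
    dbar (fun y => ∑ i ∈ s, φ i y) z u = ∑ i ∈ s, dbar (φ i) z u := by
  simp only [dbar_apply, (HasFDerivAt.fun_sum fun i hi => (hφ i hi).hasFDerivAt).fderiv,
    _root_.sum_apply, Finset.mul_sum, ← Finset.sum_add_distrib]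

theorem fderiv_conj (φ : N → ℂ) (z v : N) :
    fderiv ℝ (fun y => conj (φ y)) z v = conj (fderiv ℝ φ z v) := by
  have := (Complex.conjCLE.toContinuousLinearEquiv.comp_fderiv (f := φ) (x := z))
  exact congrArg (fun f => f v) this

theorem del_conj (φ : N → ℂ) (z v : N) : del (fun y => conj (φ y)) z v = conj (dbar φ z v) := by
  simp only [del, dbar_apply, fderiv_conj, map_mul, map_add, map_div₀, map_one, map_ofNat,
    Complex.conj_I]
  ring

theorem dbar_conj (φ : N → ℂ) (z v : N) : dbar (fun y => conj (φ y)) z v = conj (del φ z v) := by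
  simp only [del, dbar_apply, fderiv_conj, map_mul, map_sub, map_div₀, map_one, map_ofNat,
    Complex.conj_I]
  ring

theorem eventually_contDiffAt_two (h : ContDiffAt ℝ 2 φ z) : ∀ᶠ y in 𝓝 z, ContDiffAt ℝ 2 φ y :=
  h.eventually (by simp)

theorem eventually_differentiableAt (h : ContDiffAt ℝ 2 φ z) :
    ∀ᶠ y in 𝓝 z, DifferentiableAt ℝ φ y :=
  (eventually_contDiffAt_two h).mono fun _ h => h.differentiableAt two_ne_zero

theorem contDiffAt_conj (h : ContDiffAt ℝ 2 φ z) : ContDiffAt ℝ 2 (fun y => conj (φ y)) z :=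
  (Complex.conjCLE.toContinuousLinearEquiv.contDiff.contDiffAt).comp z h

theorem levi_mul (hφ : ContDiffAt ℝ 2 φ z) (hψ : ContDiffAt ℝ 2 ψ z) (u v : N) :
    levi (fun y => φ y * ψ y) z u v = levi φ z u v * ψ z + dbar φ z v * del ψ z u +
      del φ z u * dbar ψ z v + φ z * levi ψ z u v := by
  have hφ1 := hφ.differentiableAt two_ne_zero
  have hψ1 := hψ.differentiableAt two_ne_zero
  have h : (fun y => dbar (fun y => φ y * ψ y) y v) =ᶠ[𝓝 z]
      fun y => dbar φ y v * ψ y + φ y * dbar ψ y v := by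
    filter_upwards [eventually_differentiableAt hφ, eventually_differentiableAt hψ] with y h1 h2
      using dbar_mul h1 h2 v
  rw [levi_eq_del_dbar (hφ.mul hψ), levi_eq_del_dbar hφ, levi_eq_del_dbar hψ, del_congr h,
    del_add ((differentiableAt_dbar hφ v).fun_mul hψ1) (hφ1.fun_mul (differentiableAt_dbar hψ v)),
    del_mul (differentiableAt_dbar hφ v) hψ1, del_mul hφ1 (differentiableAt_dbar hψ v)]
  ring

theorem levi_sum {ι : Type*} (s : Finset ι) {φ : ι → N → ℂ}
    (hφ : ∀ i ∈ s, ContDiffAt ℝ 2 (φ i) z) (u v : N) :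
    levi (fun y => ∑ i ∈ s, φ i y) z u v = ∑ i ∈ s, levi (φ i) z u v := by
  have h : (fun y => dbar (fun y => ∑ i ∈ s, φ i y) y v) =ᶠ[𝓝 z]
      fun y => ∑ i ∈ s, dbar (φ i) y v := by
    filter_upwards [(Finset.eventually_all s).2 fun i hi =>
      eventually_differentiableAt (hφ i hi)] with y h using dbar_sum s h v
  rw [levi_eq_del_dbar (ContDiffAt.sum hφ), del_congr h,
    del_sum s fun i hi => differentiableAt_dbar (hφ i hi) v]
  exact Finset.sum_congr rfl fun i hi => (levi_eq_del_dbar (hφ i hi) u v).symm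

theorem levi_conj (h : ContDiffAt ℝ 2 φ z) (u v : N) :
    levi (fun y => conj (φ y)) z u v = conj (levi φ z v u) := by
  have hs : ∀ a b, fderiv ℝ (fderiv ℝ φ) z a b = fderiv ℝ (fderiv ℝ φ) z b a := fun a b =>
    (h.isSymmSndFDerivAt (by simp)).eq a b
  have h2 : ∀ a b, fderiv ℝ (fderiv ℝ fun y => conj (φ y)) z a b =
      conj (fderiv ℝ (fderiv ℝ φ) z a b) := by
    intro a b
    have e1 := (hasFDerivAt_fderiv_apply (contDiffAt_conj h) b).fderiv
    have e2 := (hasFDerivAt_fderiv_apply h b).fderiv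
    simp only [fderiv_conj] at e1
    have e3 := congrArg (fun f => f a) e1
    simp only [fderiv_conj, e2] at e3
    exact e3.symm
  simp only [levi_apply, h2]
  rw [hs v u, hs v (Complex.I • u), hs (Complex.I • v) u, hs (Complex.I • v) (Complex.I • u)]
  simp only [map_mul, map_sub, map_add, map_div₀, map_one, map_ofNat, Complex.conj_I]
  ring

theorem dbar_of_differentiableAt (h : DifferentiableAt ℂ φ z) (v : N) : dbar φ z v = 0 := by
  have h1 : fderiv ℝ φ z = (fderiv ℂ φ z).restrictScalars ℝ :=
    (h.hasFDerivAt.restrictScalars ℝ).fderiv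
  simp only [dbar_apply, h1, ContinuousLinearMap.coe_restrictScalars', map_smul, smul_eq_mul]
  linear_combination (1 / 2) * (fderiv ℂ φ z v) * Complex.I_sq

theorem del_of_differentiableAt (h : DifferentiableAt ℂ φ z) (v : N) :
    del φ z v = fderiv ℂ φ z v := by
  have h1 : fderiv ℝ φ z = (fderiv ℂ φ z).restrictScalars ℝ :=
    (h.hasFDerivAt.restrictScalars ℝ).fderiv
  simp only [del, h1, ContinuousLinearMap.coe_restrictScalars', map_smul, smul_eq_mul]
  linear_combination (-1 / 2) * (fderiv ℂ φ z v) * Complex.I_sq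

theorem levi_of_contDiffAt (h : ContDiffAt ℂ 2 φ z) (u v : N) : levi φ z u v = 0 := by
  have h1 : (fun y => dbar φ y v) =ᶠ[𝓝 z] fun _ => 0 := by
    filter_upwards [h.eventually (by simp)] with y hy
      using dbar_of_differentiableAt (hy.differentiableAt two_ne_zero) v
  rw [levi_eq_del_dbar (h.restrict_scalars ℝ), del_congr h1]
  simp [del]

theorem contDiffAt_log_re (h : ContDiffAt ℝ 2 φ z) (hp : 0 < (φ z).re) :
    ContDiffAt ℝ 2 (fun y => ((Real.log (φ y).re : ℝ) : ℂ)) z := by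
  have h1 : ContDiffAt ℝ 2 (fun y => (φ y).re) z :=
    (Complex.reCLM.contDiff.contDiffAt).comp z h
  exact (Complex.ofRealCLM.contDiff.contDiffAt).comp z (h1.log hp.ne')

theorem dbar_log_re (h : DifferentiableAt ℝ φ z) (hr : ∀ᶠ y in 𝓝 z, φ y = ((φ y).re : ℂ))
    (hp : 0 < (φ z).re) (v : N) :
    dbar (fun y => ((Real.log (φ y).re : ℝ) : ℂ)) z v = (φ z)⁻¹ * dbar φ z v := by
  have hpos : ∀ᶠ y in 𝓝 z, 0 < (φ y).re :=
    (Complex.continuous_re.continuousAt.comp h.continuousAt).eventually (lt_mem_nhds hp)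
  -- Near `z` the function has positive real values, so the real logarithm is the holomorphic one
  -- composed with `φ`.
  have h0 : (fun y => ((Real.log (φ y).re : ℝ) : ℂ)) =ᶠ[𝓝 z] fun y => Complex.log (φ y) := by
    filter_upwards [hr, hpos] with y hy hy'
    rw [Complex.ofReal_log hy'.le, ← hy]
  have h1 := (Complex.hasStrictDerivAt_log (x := φ z) (Or.inl hp)).hasDerivAt.complexToReal_fderiv
  have h2 : HasFDerivAt (fun y => Complex.log (φ y)) _ z := h1.comp z h.hasFDerivAt
  rw [dbar_congr h0, dbar_apply, dbar_apply, h2.fderiv]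
  simp
  ring

theorem levi_log (h : ContDiffAt ℝ 2 φ z) (hr : ∀ᶠ y in 𝓝 z, φ y = ((φ y).re : ℂ))
    (hp : 0 < (φ z).re) (u v : N) :
    levi (fun y => ((Real.log (φ y).re : ℝ) : ℂ)) z u v =
      levi φ z u v / φ z - del φ z u * dbar φ z v / φ z ^ 2 := by
  have hne : φ z ≠ 0 := Complex.slitPlane_ne_zero (Or.inl hp)
  have hpos : ∀ᶠ y in 𝓝 z, 0 < (φ y).re :=
    (Complex.continuous_re.continuousAt.comp h.continuousAt).eventually (lt_mem_nhds hp)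
  have h1 : (fun y => dbar (fun y => ((Real.log (φ y).re : ℝ) : ℂ)) y v) =ᶠ[𝓝 z]
      fun y => (φ y)⁻¹ * dbar φ y v := by
    filter_upwards [eventually_differentiableAt h, hpos, hr.eventually_nhds] with y hy hy' hry
      using dbar_log_re hy hry hy' v
  have hinv : HasFDerivAt (fun y => (φ y)⁻¹) (-(φ z ^ 2)⁻¹ • fderiv ℝ φ z) z := by
    have := ((hasDerivAt_inv hne).complexToReal_fderiv).comp z
      (h.differentiableAt two_ne_zero).hasFDerivAt
    refine this.congr_fderiv ?_
    ext; simp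
  rw [levi_eq_del_dbar (contDiffAt_log_re h hp), del_congr h1,
    del_mul hinv.differentiableAt (differentiableAt_dbar h v), levi_eq_del_dbar h,
    del, del, del, hinv.fderiv]
  simp
  field_simp
  ring

/-- The logarithm of the modulus of a holomorphic function is pluriharmonic. -/
theorem levi_log_normSq (h : ContDiffAt ℂ 2 φ z) (hz : φ z ≠ 0) (u v : N) :
    levi (fun y => ((Real.log (‖φ y‖ ^ 2) : ℝ) : ℂ)) z u v = 0 := by
  have hR := h.restrict_scalars ℝ
  have hd := h.differentiableAt two_ne_zero
  have h1 : ∀ y, (φ y * conj (φ y)).re = ‖φ y‖ ^ 2 := fun y => by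
    rw [Complex.mul_conj, Complex.ofReal_re, Complex.normSq_eq_norm_sq]
  have h2 := levi_log (φ := fun y => φ y * conj (φ y)) (hR.mul (contDiffAt_conj hR))
    (Filter.Eventually.of_forall fun y => by rw [Complex.mul_conj]; simp)
    (by rw [h1]; positivity) u v
  simp only [h1] at h2
  have hR1 := hR.differentiableAt two_ne_zero
  have hR2 := (contDiffAt_conj hR).differentiableAt two_ne_zero
  have hc : conj (φ z) ≠ 0 := by simpa using hz
  -- For holomorphic `φ` only `∂φ · conj ∂φ` survives in the Levi form of `|φ|²`. It cancels against
  -- the product of first derivatives.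
  rw [h2, levi_mul hR (contDiffAt_conj hR), del_mul hR1 hR2, dbar_mul hR1 hR2, levi_conj hR,
    levi_of_contDiffAt h, levi_of_contDiffAt h, dbar_conj, del_conj, dbar_of_differentiableAt hd,
    dbar_of_differentiableAt hd]
  field_simp
  simp
  ring

end Levi

/-! ### The Levi form of the logarithm of a determinant -/

section LogDet

variable {N : Type*} [NormedAddCommGroup N] [NormedSpace ℂ N]
  {ι : Type*} [Fintype ι] [DecidableEq ι]

/-- Jacobi's formula: the Leibniz expansion is differentiated column by column, and Cramer's rule
identifies a determinant with one replaced column. -/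
theorem hasFDerivAt_det {𝕜 N : Type*} [NontriviallyNormedField 𝕜] [NormedAddCommGroup N]
    [NormedSpace 𝕜 N] {A : Type*} [NormedField A] [NormedAlgebra 𝕜 A]
    {D : N → Matrix ι ι A} {D' : ι → ι → N →L[𝕜] A} {z : N}
    (hD : ∀ i j, HasFDerivAt (fun y => D y i j) (D' i j) z) :
    HasFDerivAt (fun y => (D y).det) (∑ i, ∑ j, (D z).adjugate i j • D' j i) z := by
  have h1 : HasFDerivAt (fun y => ∑ σ : Equiv.Perm ι, ((Equiv.Perm.sign σ : ℤ) : A) *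
      ∏ i, D y (σ i) i) (∑ σ : Equiv.Perm ι, ((Equiv.Perm.sign σ : ℤ) : A) •
        ∑ i, (∏ j ∈ Finset.univ.erase i, D z (σ j) j) • D' (σ i) i) z :=
    HasFDerivAt.fun_sum fun σ _ => (HasFDerivAt.finsetProd fun i _ => hD (σ i) i).const_mul _
  simp only [Matrix.det_apply']
  refine h1.congr_fderiv ?_
  ext u
  simp only [_root_.sum_apply, _root_.smul_apply, smul_eq_mul]
  have h2 : ∀ i, ∑ j, (D z).adjugate i j * D' j i u =
      ((D z).updateCol i fun j => D' j i u).det := by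
    intro i
    rw [← Matrix.cramer_apply, Matrix.cramer_eq_adjugate_mulVec]
    rfl
  simp only [h2, Matrix.det_apply', Finset.mul_sum]
  rw [Finset.sum_comm]
  refine Finset.sum_congr rfl fun i _ => Finset.sum_congr rfl fun σ _ => ?_
  rw [← Finset.mul_prod_erase _ _ (Finset.mem_univ i), Matrix.updateCol_self,
    mul_comm (D' (σ i) i u)]
  congr 2
  refine Finset.prod_congr rfl fun j hj => ?_
  rw [Matrix.updateCol_ne (Finset.ne_of_mem_erase hj)]

variable {D : N → Matrix ι ι ℂ} {z : N}

theorem contDiffAt_det {𝕜 N : Type*} [NontriviallyNormedField 𝕜] [NormedAddCommGroup N]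
    [NormedSpace 𝕜 N] {A : Type*} [NormedField A] [NormedAlgebra 𝕜 A] {n : WithTop ℕ∞}
    {D : N → Matrix ι ι A} {z : N} (hD : ∀ i j, ContDiffAt 𝕜 n (fun y => D y i j) z) :
    ContDiffAt 𝕜 n (fun y => (D y).det) z := by
  simp only [Matrix.det_apply']
  exact ContDiffAt.sum fun σ _ => contDiffAt_const.mul (contDiffAt_prod fun i _ => hD (σ i) i)

theorem contDiffAt_inv_apply (hD : ∀ i j, ContDiffAt ℝ 2 (fun y => D y i j) z)
    (hz : (D z).det ≠ 0) (i j : ι) : ContDiffAt ℝ 2 (fun y => (D y)⁻¹ i j) z := by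
  simp only [Matrix.inv_def, Matrix.smul_apply, smul_eq_mul, Ring.inverse_eq_inv',
    Matrix.adjugate_apply]
  refine ((contDiffAt_det hD).inv hz).mul (contDiffAt_det fun k l => ?_)
  by_cases hk : k = j
  · subst hk; simpa using contDiffAt_const
  · simpa [Matrix.updateRow_ne hk] using hD k l

theorem dbar_det (hD : ∀ i j, DifferentiableAt ℝ (fun y => D y i j) z) (v : N) :
    dbar (fun y => (D y).det) z v =
      ∑ i, ∑ j, (D z).adjugate i j * dbar (fun y => D y j i) z v := by
  rw [dbar_apply, (hasFDerivAt_det fun i j => (hD i j).hasFDerivAt).fderiv]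
  simp only [_root_.sum_apply, _root_.smul_apply, smul_eq_mul, dbar_apply, Finset.mul_sum,
    ← Finset.sum_add_distrib]
  refine Finset.sum_congr rfl fun i _ => Finset.sum_congr rfl fun j _ => ?_
  ring

/-- Differentiate `D * D⁻¹ = 1`, which holds near `z` because the determinant stays nonzero there.
-/
theorem del_inv (hD : ∀ i j, ContDiffAt ℝ 2 (fun y => D y i j) z) (hz : (D z).det ≠ 0) (u : N) :
    (Matrix.of fun i j => del (fun y => (D y)⁻¹ i j) z u) =
      -((D z)⁻¹ * (Matrix.of fun i j => del (fun y => D y i j) z u) * (D z)⁻¹) := by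
  have hu : IsUnit (D z).det := isUnit_iff_ne_zero.2 hz
  have hd := fun i j => (hD i j).differentiableAt two_ne_zero
  have hd' := fun i j => (contDiffAt_inv_apply hD hz i j).differentiableAt two_ne_zero
  have h1 : (Matrix.of fun i j => del (fun y => D y i j) z u) * (D z)⁻¹ +
      D z * (Matrix.of fun i j => del (fun y => (D y)⁻¹ i j) z u) = 0 := by
    ext i j
    have h2 : (fun y => ∑ k, D y i k * (D y)⁻¹ k j) =ᶠ[𝓝 z]
        fun _ => (1 : Matrix ι ι ℂ) i j := by
      filter_upwards [(contDiffAt_det hD).continuousAt.eventually_ne hz] with y hy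
      rw [← Matrix.mul_nonsing_inv (D y) (isUnit_iff_ne_zero.2 hy)]
      rfl
    have h3 := congrFun (del_congr h2) u
    rw [del_sum _ fun k _ => (hd i k).fun_mul (hd' k j)] at h3
    simp only [del_mul (hd i _) (hd' _ j), Finset.sum_add_distrib] at h3
    simpa [Matrix.mul_apply, del] using h3
  have h4 := congrArg (fun M => (D z)⁻¹ * M) h1
  simp only [mul_add, mul_zero, ← mul_assoc, Matrix.nonsing_inv_mul _ hu, one_mul] at h4
  exact eq_neg_of_add_eq_zero_right h4

/-- Jacobi's formula gives `∂̄ log det D = tr (D⁻¹ ∂̄D)` near `z`. Applying `∂` and `del_inv` yields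
the trace. -/
theorem levi_log_det (hD : ∀ i j, ContDiffAt ℝ 2 (fun y => D y i j) z)
    (hr : ∀ᶠ y in 𝓝 z, (D y).det = ((D y).det.re : ℂ)) (hp : 0 < (D z).det.re) (u v : N) :
    levi (fun y => ((Real.log (D y).det.re : ℝ) : ℂ)) z u v =
      ((D z)⁻¹ * ((Matrix.of fun i j => levi (fun y => D y i j) z u v) -
        (Matrix.of fun i j => del (fun y => D y i j) z u) * (D z)⁻¹ *
          (Matrix.of fun i j => dbar (fun y => D y i j) z v))).trace := by
  have hdet := contDiffAt_det hD
  have hne : (D z).det ≠ 0 := fun h => by simp [h] at hp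
  have hd := fun i j => (hD i j).differentiableAt two_ne_zero
  have hd' := fun i j => (contDiffAt_inv_apply hD hne i j).differentiableAt two_ne_zero
  have hlog := contDiffAt_log_re hdet hp
  have h1 : (fun y => dbar (fun y => ((Real.log (D y).det.re : ℝ) : ℂ)) y v) =ᶠ[𝓝 z]
      fun y => ∑ i, ∑ j, (D y)⁻¹ i j * dbar (fun y => D y j i) y v := by
    have hpos : ∀ᶠ y in 𝓝 z, 0 < (D y).det.re :=
      (Complex.continuous_re.continuousAt.comp hdet.continuousAt).eventually (lt_mem_nhds hp)
    have hev : ∀ᶠ y in 𝓝 z, ∀ i j, DifferentiableAt ℝ (fun y => D y i j) y := by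
      simp only [Filter.eventually_all]
      exact fun i j => eventually_differentiableAt (hD i j)
    filter_upwards [hev, hpos, hr.eventually_nhds] with y hy hy' hry
    rw [dbar_log_re (hasFDerivAt_det fun i j => (hy i j).hasFDerivAt).differentiableAt hry hy',
      dbar_det hy, Finset.mul_sum]
    refine Finset.sum_congr rfl fun i _ => ?_
    rw [Finset.mul_sum]
    refine Finset.sum_congr rfl fun j _ => ?_
    rw [Matrix.inv_def, Matrix.smul_apply, Ring.inverse_eq_inv', smul_eq_mul, mul_assoc]
  have hdd : ∀ i j, DifferentiableAt ℝ (fun y => (D y)⁻¹ i j * dbar (fun y => D y j i) y v) z :=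
    fun i j => (hd' i j).fun_mul (differentiableAt_dbar (hD j i) v)
  rw [levi_eq_del_dbar hlog, del_congr h1,
    del_sum _ fun i _ => DifferentiableAt.fun_sum fun j _ => hdd i j]
  simp only [del_sum _ fun j _ => hdd _ j,
    del_mul (hd' _ _) (differentiableAt_dbar (hD _ _) v), ← levi_eq_del_dbar (hD _ _)]
  have hinv : ∀ i j, del (fun y => (D y)⁻¹ i j) z u =
      (-((D z)⁻¹ * (Matrix.of fun i j => del (fun y => D y i j) z u) * (D z)⁻¹)) i j :=
    fun i j => congrFun (congrFun (del_inv hD hne u) i) j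
  simp only [hinv]
  rw [mul_sub, Matrix.trace_sub, ← mul_assoc, ← mul_assoc]
  simp only [Matrix.trace, Matrix.diag_apply, ← Finset.sum_sub_distrib]
  refine Finset.sum_congr rfl fun i _ => ?_
  rw [Matrix.mul_apply, Matrix.mul_apply, ← Finset.sum_sub_distrib]
  refine Finset.sum_congr rfl fun j _ => ?_
  simp
  ring

end LogDet

/-! ### The Levi determinant of the logarithm of a hermitian form -/

section Bordered

open Matrix

/-- Schur complement of the corner `q`. The rank-one correction which the logarithm adds to a Levi
form is absorbed into one more row and column. -/
theorem det_bordered {ι : Type*} [Fintype ι] [DecidableEq ι] (q : ℂ) (hq : q ≠ 0) (r c : ι → ℂ)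
    (A : Matrix ι ι ℂ) :
    (fromBlocks (of fun _ _ : Unit => q) (of fun _ k => r k) (of fun j _ => c j) A).det =
      q ^ (Fintype.card ι + 1) * (of fun j k => A j k / q - c j * r k / q ^ 2).det := by
  have hu : IsUnit (of fun _ _ : Unit => q).det := by simpa using hq
  let _ := (of fun _ _ : Unit => q).invertibleOfIsUnitDet hu
  rw [det_fromBlocks₁₁, pow_succ', mul_assoc, ← det_smul]
  congr 1
  · simp
  · congr 1
    ext j k
    rw [invOf_eq_nonsing_inv]
    simp [Matrix.mul_apply]
    field_simp

theorem det_updateRow_one {m : ℕ} (W : Fin (m + 1) → ℂ) :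
    (updateRow (1 : Matrix (Fin (m + 1)) (Fin (m + 1)) ℂ) 0 W).det = W 0 := by
  rw [det_of_isUpperTriangular, Fin.prod_univ_succ]
  · simp
  · intro i j hij
    have hi : i ≠ 0 := fun h => by simp [h] at hij
    rw [updateRow_ne hi, one_apply_ne]
    exact (ne_of_lt hij).symm

/-- The determinant of the Levi matrix of `log (Wᵀ D V)` in terms of the derivatives `P`, `P'`, `R`
of `D` in a direction, where the other directions are those of the coordinates `W₁, …, W_m`. -/
theorem det_levi_matrix {m : ℕ} (D P P' R : Matrix (Fin (m + 1)) (Fin (m + 1)) ℂ)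
    (hD : D.det ≠ 0) (W V : Fin (m + 1) → ℂ) (hW : W 0 = 1) (hV : V 0 = 1) (q : ℂ) (hq : q ≠ 0)
    (hq' : q = W ⬝ᵥ D *ᵥ V) (S : Matrix (Fin (m + 1)) (Fin (m + 1)) ℂ)
    (r c : Fin (m + 1) → ℂ) (hr0 : r 0 = W ⬝ᵥ P' *ᵥ V) (hc0 : c 0 = W ⬝ᵥ P *ᵥ V)
    (hr : ∀ k : Fin m, r k.succ = (W ᵥ* D) k.succ) (hc : ∀ k : Fin m, c k.succ = (D *ᵥ V) k.succ)
    (hS00 : S 0 0 = W ⬝ᵥ R *ᵥ V) (hS0 : ∀ k : Fin m, S 0 k.succ = (W ᵥ* P) k.succ)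
    (hS1 : ∀ k : Fin m, S k.succ 0 = (P' *ᵥ V) k.succ)
    (hS : ∀ j k : Fin m, S j.succ k.succ = D j.succ k.succ) :
    q ^ (m + 2) * (of fun j k => S j k / q - c j * r k / q ^ 2).det =
      D.det * (W ⬝ᵥ (R - P * D⁻¹ * P') *ᵥ V) := by
  have hcard : m + 2 = Fintype.card (Fin (m + 1)) + 1 := by simp
  rw [hcard, ← det_bordered q hq]
  -- `K` borders `D` by the derivatives in the horizontal direction, and its Schur complement with
  -- respect to `D` is the right-hand side. The matrices `T W` and `T V` replace row and column `0`
  -- by the combinations with coefficients `W` and `V`. They are unimodular since `W 0 = V 0 = 1`.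
  let K : Matrix (Fin (m + 1) ⊕ Unit) (Fin (m + 1) ⊕ Unit) ℂ :=
    fromBlocks D (of fun j _ => (P' *ᵥ V) j) (of fun _ k => (W ᵥ* P) k)
      (of fun _ _ => W ⬝ᵥ R *ᵥ V)
  let T : (Fin (m + 1) → ℂ) → Matrix (Fin (m + 1) ⊕ Unit) (Fin (m + 1) ⊕ Unit) ℂ := fun W =>
    fromBlocks (updateRow 1 0 W) 0 0 1
  have hT : ∀ W, (T W).det = W 0 := fun W => by
    simp only [T, det_fromBlocks_zero₂₁, det_updateRow_one, det_one, mul_one]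
  have hK : K.det = D.det * (W ⬝ᵥ (R - P * D⁻¹ * P') *ᵥ V) := by
    let _ := D.invertibleOfIsUnitDet (isUnit_iff_ne_zero.2 hD)
    rw [det_fromBlocks₁₁, invOf_eq_nonsing_inv]
    congr 1
    rw [det_unique, sub_mulVec, dotProduct_sub, Matrix.sub_apply]
    congr 1
    have : (of fun (_ : Unit) k => (W ᵥ* P) k) * D⁻¹ * (of fun j (_ : Unit) => (P' *ᵥ V) j) =
        of fun _ _ => W ⬝ᵥ (P * D⁻¹ * P') *ᵥ V := by
      ext i j
      rw [← mulVec_mulVec, ← mulVec_mulVec, dotProduct_mulVec, dotProduct_mulVec]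
      rfl
    rw [this]
    rfl
  -- The border of the Levi matrix carries `q`, which comes from index `0` of `D`, while its index
  -- `0` is the horizontal direction, which is the border of `K`. The two must be exchanged.
  let e : Unit ⊕ Fin (m + 1) ≃ Fin (m + 1) ⊕ Unit :=
    (Equiv.sumComm _ _).trans (Equiv.swap (Sum.inl 0) (Sum.inr ()))
  have e0 : e (Sum.inl ()) = Sum.inl 0 := by simp [e]
  have e1 : e (Sum.inr 0) = Sum.inr () := by simp [e]
  have e2 : ∀ k : Fin m, e (Sum.inr k.succ) = Sum.inl k.succ := fun k => by
    simp only [e, Equiv.trans_apply, Equiv.sumComm_apply, Sum.swap_inr]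
    exact Equiv.swap_apply_of_ne_of_ne (by simp) (by simp)
  have hM : fromBlocks (of fun _ _ : Unit => q) (of fun _ k => r k) (of fun j _ => c j) S =
      (T W * K * (T V)ᵀ).submatrix e e := by
    have hTK : T W * K * (T V)ᵀ = fromBlocks (updateRow 1 0 W * D * (updateRow 1 0 V)ᵀ)
        (of fun j _ => (updateRow 1 0 W *ᵥ (P' *ᵥ V)) j)
        (of fun _ k => ((W ᵥ* P) ᵥ* (updateRow 1 0 V)ᵀ) k) (of fun _ _ => W ⬝ᵥ R *ᵥ V) := by
      simp only [T, K, fromBlocks_transpose, fromBlocks_multiply, Matrix.zero_mul, Matrix.mul_zero,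
        add_zero, zero_add, transpose_zero, transpose_one, Matrix.mul_one, Matrix.one_mul]
      rfl
    have u0 : ∀ (W : Fin (m + 1) → ℂ) (X : Fin (m + 1) → ℂ),
        (updateRow 1 0 W *ᵥ X) (0 : Fin (m + 1)) = W ⬝ᵥ X := fun W X => by simp [mulVec]
    have u1 : ∀ (W : Fin (m + 1) → ℂ) (X : Fin (m + 1) → ℂ) (k : Fin m),
        (updateRow 1 0 W *ᵥ X) k.succ = X k.succ := fun W X k => by
      rw [mulVec, updateRow_ne (Fin.succ_ne_zero _)]
      exact congrFun (one_mulVec X) k.succ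
    have hDW : ∀ i j : Fin (m + 1), (updateRow 1 0 W * D * (updateRow 1 0 V)ᵀ) i j =
        (updateRow 1 0 W *ᵥ fun k => (updateRow 1 0 V *ᵥ D k) j) i := by
      intro i j
      rw [mul_assoc, Matrix.mul_apply, mulVec, dotProduct]
      refine Finset.sum_congr rfl fun k _ => ?_
      rw [Matrix.mul_apply, mulVec, dotProduct]
      congr 1
      exact Finset.sum_congr rfl fun l _ => mul_comm _ _
    rw [hTK]
    ext (i | i) (j | j)
    · rw [submatrix_apply, e0, fromBlocks_apply₁₁, fromBlocks_apply₁₁, hDW, u0]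
      simp only [u0, of_apply, hq']
      congr 1; funext i; exact dotProduct_comm _ _
    · refine Fin.cases ?_ (fun k => ?_) j
      · rw [submatrix_apply, e0, e1, fromBlocks_apply₁₂, fromBlocks_apply₁₂]
        simp only [of_apply, u0, hr0]
      · rw [submatrix_apply, e0, e2, fromBlocks_apply₁₂, fromBlocks_apply₁₁, hDW, u0]
        simp only [of_apply, hr, u1]
        rfl
    · refine Fin.cases ?_ (fun k => ?_) i
      · rw [submatrix_apply, e0, e1, fromBlocks_apply₂₁, fromBlocks_apply₂₁]
        simp only [of_apply, vecMul_transpose, u0, hc0]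
        rw [dotProduct_mulVec, dotProduct_comm]
      · rw [submatrix_apply, e0, e2, fromBlocks_apply₂₁, fromBlocks_apply₁₁, hDW, u1, u0]
        simp only [of_apply, hc]
        exact dotProduct_comm _ _
    · refine Fin.cases ?_ (fun k => ?_) i <;> refine Fin.cases ?_ (fun l => ?_) j
      · rw [submatrix_apply, e1, fromBlocks_apply₂₂, fromBlocks_apply₂₂, hS00]
        rfl
      · rw [submatrix_apply, e1, e2, fromBlocks_apply₂₂, fromBlocks_apply₂₁, hS0]
        simp only [of_apply, vecMul_transpose, u1]
      · rw [submatrix_apply, e1, e2, fromBlocks_apply₂₂, fromBlocks_apply₁₂, hS1]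
        simp only [of_apply, u1]
      · rw [submatrix_apply, e2, e2, fromBlocks_apply₂₂, fromBlocks_apply₁₁, hS, hDW, u1, u1]
  rw [hM, det_submatrix_equiv_self, det_mul, det_mul, det_transpose, hT, hT, hW, hV, hK]
  ring

end Bordered

/-! ### Derivatives of a family of hermitian forms in affine fibre coordinates -/

section QuadraticForm

variable {E : Type*} [NormedAddCommGroup E] [NormedSpace ℂ E] {m : ℕ}

/-- The values `∑ W_a conj(W_b) D_ab` of a family of hermitian forms, in the affine coordinates
`W = (1, w)`. -/
def affineForm (D : E → Matrix (Fin (m + 1)) (Fin (m + 1)) ℂ) (p : E × (Fin m → ℂ)) : ℂ :=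
  ∑ a, ∑ b, (Fin.cons 1 p.2 : Fin (m + 1) → ℂ) a *
    conj ((Fin.cons 1 p.2 : Fin (m + 1) → ℂ) b) * D p.1 a b

theorem fderiv_comp_fst {F : Type*} [NormedAddCommGroup F] [NormedSpace ℂ F] {f : E → ℂ}
    {p : E × F} (hf : DifferentiableAt ℝ f p.1) (u : E × F) :
    fderiv ℝ (fun q : E × F => f q.1) p u = fderiv ℝ f p.1 u.1 := by
  have := (hf.hasFDerivAt.comp p (hasFDerivAt_fst (𝕜 := ℝ) (E := E) (F := F))).fderiv
  exact congrArg (fun g => g u) this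

theorem del_comp_fst {F : Type*} [NormedAddCommGroup F] [NormedSpace ℂ F] {f : E → ℂ}
    {p : E × F} (hf : DifferentiableAt ℝ f p.1) (u : E × F) :
    del (fun q : E × F => f q.1) p u = del f p.1 u.1 := by
  simp only [del, fderiv_comp_fst hf, Prod.smul_fst]

theorem dbar_comp_fst {F : Type*} [NormedAddCommGroup F] [NormedSpace ℂ F] {f : E → ℂ}
    {p : E × F} (hf : DifferentiableAt ℝ f p.1) (u : E × F) :
    dbar (fun q : E × F => f q.1) p u = dbar f p.1 u.1 := by
  simp only [dbar_apply, fderiv_comp_fst hf, Prod.smul_fst]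

theorem contDiffAt_comp_fst {F : Type*} [NormedAddCommGroup F] [NormedSpace ℂ F] {f : E → ℂ}
    {p : E × F} (hf : ContDiffAt ℝ 2 f p.1) : ContDiffAt ℝ 2 (fun q : E × F => f q.1) p :=
  hf.comp p contDiffAt_fst

theorem levi_comp_fst {F : Type*} [NormedAddCommGroup F] [NormedSpace ℂ F] {f : E → ℂ}
    {p : E × F} (hf : ContDiffAt ℝ 2 f p.1) (u v : E × F) :
    levi (fun q : E × F => f q.1) p u v = levi f p.1 u.1 v.1 := by
  have h : (fun q => dbar (fun q : E × F => f q.1) q v) =ᶠ[𝓝 p] fun q => dbar f q.1 v.1 := by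
    filter_upwards [continuousAt_fst.eventually (eventually_differentiableAt hf)] with q hq
      using dbar_comp_fst hq v
  rw [levi_eq_del_dbar (contDiffAt_comp_fst hf), del_congr h,
    del_comp_fst (differentiableAt_dbar hf v.1), levi_eq_del_dbar hf]

theorem contDiff_cons_apply (a : Fin (m + 1)) :
    ContDiff ℂ 2 (fun q : E × (Fin m → ℂ) => (Fin.cons 1 q.2 : Fin (m + 1) → ℂ) a) := by
  refine Fin.cases ?_ (fun k => ?_) a
  · simpa using contDiff_const
  · simp only [Fin.cons_succ]
    fun_prop

theorem del_cons_apply (a : Fin (m + 1)) (p u : E × (Fin m → ℂ)) :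
    del (fun q : E × (Fin m → ℂ) => (Fin.cons 1 q.2 : Fin (m + 1) → ℂ) a) p u =
      (Fin.cons 0 u.2 : Fin (m + 1) → ℂ) a := by
  rw [del_of_differentiableAt ((contDiff_cons_apply a).differentiable two_ne_zero p)]
  refine Fin.cases ?_ (fun k => ?_) a
  · simp
  · simp only [Fin.cons_succ]
    have := ((ContinuousLinearMap.proj (R := ℂ) (φ := fun _ : Fin m => ℂ) k).comp
        (ContinuousLinearMap.snd ℂ E (Fin m → ℂ))).hasFDerivAt (x := p)
    exact congrArg (fun f => f u) this.fderiv

variable {D : E → Matrix (Fin (m + 1)) (Fin (m + 1)) ℂ} {p : E × (Fin m → ℂ)}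

theorem contDiffAt_affineForm (hD : ∀ i j, ContDiffAt ℝ 2 (fun y => D y i j) p.1) :
    ContDiffAt ℝ 2 (affineForm D) p := by
  have hW : ∀ a, ContDiffAt ℝ 2
    (fun q : E × (Fin m → ℂ) => (Fin.cons 1 q.2 : Fin (m + 1) → ℂ) a) p := fun a =>
    ((contDiff_cons_apply a).restrict_scalars ℝ).contDiffAt
  exact ContDiffAt.sum fun a _ => ContDiffAt.sum fun b _ =>
    ((hW a).mul (contDiffAt_conj (hW b))).mul (contDiffAt_comp_fst (hD a b))

/-- The coordinates `W_a` are holomorphic, so `del` sees `W_a` and `D` only, and `dbar` sees `conj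
W_b` and `D` only. The matrix `D` depends on the base point alone. -/
theorem affineForm_derivatives (hD : ∀ i j, ContDiffAt ℝ 2 (fun y => D y i j) p.1)
    (u v : E × (Fin m → ℂ)) :
    del (affineForm D) p u = ∑ a, ∑ b, ((Fin.cons 0 u.2 : Fin (m + 1) → ℂ) a *
      conj ((Fin.cons 1 p.2 : Fin (m + 1) → ℂ) b) * D p.1 a b +
      (Fin.cons 1 p.2 : Fin (m + 1) → ℂ) a * conj ((Fin.cons 1 p.2 : Fin (m + 1) → ℂ) b) *
        del (fun y => D y a b) p.1 u.1) ∧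
    dbar (affineForm D) p v = ∑ a, ∑ b, ((Fin.cons 1 p.2 : Fin (m + 1) → ℂ) a *
      conj ((Fin.cons 0 v.2 : Fin (m + 1) → ℂ) b) * D p.1 a b +
      (Fin.cons 1 p.2 : Fin (m + 1) → ℂ) a * conj ((Fin.cons 1 p.2 : Fin (m + 1) → ℂ) b) *
        dbar (fun y => D y a b) p.1 v.1) ∧
    levi (affineForm D) p u v = ∑ a, ∑ b, ((Fin.cons 0 u.2 : Fin (m + 1) → ℂ) a *
      conj ((Fin.cons 0 v.2 : Fin (m + 1) → ℂ) b) * D p.1 a b +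
      (Fin.cons 1 p.2 : Fin (m + 1) → ℂ) a * conj ((Fin.cons 0 v.2 : Fin (m + 1) → ℂ) b) *
        del (fun y => D y a b) p.1 u.1 +
      (Fin.cons 0 u.2 : Fin (m + 1) → ℂ) a * conj ((Fin.cons 1 p.2 : Fin (m + 1) → ℂ) b) *
        dbar (fun y => D y a b) p.1 v.1 +
      (Fin.cons 1 p.2 : Fin (m + 1) → ℂ) a * conj ((Fin.cons 1 p.2 : Fin (m + 1) → ℂ) b) *
        levi (fun y => D y a b) p.1 u.1 v.1) := by
  have hWC := fun a => (contDiff_cons_apply (E := E) (m := m) a).contDiffAt (x := p)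
  have hW := fun a => (hWC a).restrict_scalars ℝ
  have hW' := fun a => contDiffAt_conj (hW a)
  have hWW := fun a b => (hW a).mul (hW' b)
  have hDf := fun a b => contDiffAt_comp_fst (F := Fin m → ℂ) (hD a b)
  have dW := fun a => (hW a).differentiableAt two_ne_zero
  have dW' := fun a => (hW' a).differentiableAt two_ne_zero
  have dWW := fun a b => (dW a).fun_mul (dW' b)
  have dDf := fun a b => (hDf a b).differentiableAt two_ne_zero
  have dD := fun a b => (hD a b).differentiableAt two_ne_zero
  have dWC := fun a => (hWC a).differentiableAt two_ne_zero
  refine ⟨?_, ?_, ?_⟩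
  · unfold affineForm
    rw [del_sum _ fun a _ => DifferentiableAt.fun_sum fun b _ => (dWW a b).fun_mul (dDf a b)]
    refine Finset.sum_congr rfl fun a _ => ?_
    rw [del_sum _ fun b _ => (dWW a b).fun_mul (dDf a b)]
    refine Finset.sum_congr rfl fun b _ => ?_
    rw [del_mul (dWW a b) (dDf a b), del_mul (dW a) (dW' b), del_comp_fst (dD a b), del_conj,
      dbar_of_differentiableAt (dWC b), del_cons_apply]
    simp
  · unfold affineForm
    rw [dbar_sum _ fun a _ => DifferentiableAt.fun_sum fun b _ => (dWW a b).fun_mul (dDf a b)]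
    refine Finset.sum_congr rfl fun a _ => ?_
    rw [dbar_sum _ fun b _ => (dWW a b).fun_mul (dDf a b)]
    refine Finset.sum_congr rfl fun b _ => ?_
    rw [dbar_mul (dWW a b) (dDf a b), dbar_mul (dW a) (dW' b), dbar_comp_fst (dD a b), dbar_conj,
      dbar_of_differentiableAt (dWC a), del_cons_apply]
    simp
  · unfold affineForm
    rw [levi_sum _ fun a _ => ContDiffAt.sum fun b _ => (hWW a b).mul (hDf a b)]
    refine Finset.sum_congr rfl fun a _ => ?_
    rw [levi_sum _ fun b _ => (hWW a b).mul (hDf a b)]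
    refine Finset.sum_congr rfl fun b _ => ?_
    rw [levi_mul (hWW a b) (hDf a b), del_mul (dW a) (dW' b), dbar_mul (dW a) (dW' b),
      levi_mul (hW a) (hW' b), levi_conj (hW b), levi_of_contDiffAt (hWC a),
      levi_of_contDiffAt (hWC b), del_comp_fst (dD a b), dbar_comp_fst (dD a b),
      levi_comp_fst (hD a b), del_conj, dbar_conj, dbar_of_differentiableAt (dWC a),
      dbar_of_differentiableAt (dWC b), del_cons_apply, del_cons_apply]
    simp

end QuadraticForm

/-! ### Positive hermitian matrices -/

section PosHerm

variable {ι : Type*} [Fintype ι]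

/-- The value `∑ W_a conj(W_b) D_ab` of a sesquilinear form. -/
def sesqValue (D : Matrix ι ι ℂ) (W : ι → ℂ) : ℂ := ∑ a, ∑ b, W a * conj (W b) * D a b

/-- Positive definite hermitian matrices. -/
structure PosHerm (D : Matrix ι ι ℂ) : Prop where
  conj_apply : ∀ a b, conj (D a b) = D b a
  pos : ∀ W : ι → ℂ, W ≠ 0 → 0 < (sesqValue D W).re

theorem conj_sesqValue {D : Matrix ι ι ℂ} (hD : ∀ a b, conj (D a b) = D b a) (W : ι → ℂ) :
    conj (sesqValue D W) = sesqValue D W := by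
  simp only [sesqValue, map_sum, map_mul, hD, Complex.conj_conj]
  rw [Finset.sum_comm]
  exact Finset.sum_congr rfl fun _ _ => Finset.sum_congr rfl fun _ _ => by ring

theorem sesqValue_eq_re {D : Matrix ι ι ℂ} (hD : ∀ a b, conj (D a b) = D b a) (W : ι → ℂ) :
    sesqValue D W = ((sesqValue D W).re : ℂ) :=
  (Complex.conj_eq_iff_re.1 (conj_sesqValue hD W)).symm

theorem sesqValue_add_smul (D T : Matrix ι ι ℂ) (t : ℂ) (W : ι → ℂ) :
    sesqValue (D + t • T) W = sesqValue D W + t * sesqValue T W := by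
  simp only [sesqValue, Finset.mul_sum, ← Finset.sum_add_distrib]
  refine Finset.sum_congr rfl fun _ _ => Finset.sum_congr rfl fun _ _ => ?_
  simp
  ring

theorem sesqValue_smul_vec (D : Matrix ι ι ℂ) (t : ℂ) (W : ι → ℂ) :
    sesqValue D (t • W) = ((‖t‖ ^ 2 : ℝ) : ℂ) * sesqValue D W := by
  have : ((‖t‖ ^ 2 : ℝ) : ℂ) = t * conj t := by rw [Complex.mul_conj, Complex.normSq_eq_norm_sq]
  simp only [sesqValue, Finset.mul_sum, this]
  refine Finset.sum_congr rfl fun _ _ => Finset.sum_congr rfl fun _ _ => ?_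
  simp
  ring

theorem continuous_sesqValue (D : Matrix ι ι ℂ) : Continuous (sesqValue D) := by
  unfold sesqValue
  fun_prop

theorem PosHerm.sesqValue_ne_zero {D : Matrix ι ι ℂ} (hD : PosHerm D) {W : ι → ℂ} (hW : W ≠ 0) :
    sesqValue D W ≠ 0 := fun h => by
  have := hD.pos W hW
  simp [h] at this

theorem PosHerm.norm_sesqValue {D : Matrix ι ι ℂ} (hD : PosHerm D) (W : ι → ℂ) :
    ‖sesqValue D W‖ = (sesqValue D W).re := by
  by_cases hW : W = 0
  · subst hW; simp [sesqValue]
  · rw [sesqValue_eq_re hD.conj_apply, Complex.norm_real, Complex.ofReal_re,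
      Real.norm_of_nonneg (hD.pos W hW).le]

open scoped ComplexOrder in
theorem PosHerm.posDef {D : Matrix ι ι ℂ} (hD : PosHerm D) : D.PosDef := by
  refine Matrix.PosDef.of_dotProduct_mulVec_pos (Matrix.IsHermitian.ext fun i j => hD.conj_apply j i)
    fun x hx => ?_
  -- `sesqValue` conjugates the second index and the matrix convention the first, hence the `star`.
  have h1 : star x ⬝ᵥ (D.mulVec x) = sesqValue D (star x) := by
    simp only [dotProduct, Matrix.mulVec, sesqValue, Finset.mul_sum]
    refine Finset.sum_congr rfl fun _ _ => Finset.sum_congr rfl fun _ _ => ?_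
    simp
    ring
  rw [h1, sesqValue_eq_re hD.conj_apply]
  exact Complex.zero_lt_real.2 (hD.pos _ (by simpa using hx))

open scoped ComplexOrder in
theorem PosHerm.det_re_pos [DecidableEq ι] {D : Matrix ι ι ℂ} (hD : PosHerm D) :
    0 < D.det.re ∧ D.det = (D.det.re : ℂ) := by
  have := hD.posDef.det_pos
  rw [Complex.lt_def] at this
  exact ⟨by simpa using this.1, Complex.ext (by simp) (by simpa using this.2.symm)⟩

theorem PosHerm.det_ne_zero [DecidableEq ι] {D : Matrix ι ι ℂ} (hD : PosHerm D) : D.det ≠ 0 :=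
  fun h => by
    have := hD.det_re_pos.1
    simp [h] at this

/-- A sesquilinear form is bounded by a positive definite one. -/
theorem PosHerm.exists_bound {D : Matrix ι ι ℂ} (hD : PosHerm D) (T : Matrix ι ι ℂ) :
    ∃ K : ℝ, 0 < K ∧ ∀ W, ‖sesqValue T W‖ ≤ K * (sesqValue D W).re := by
  -- Both sides are homogeneous of degree two, so a bound on the compact unit sphere suffices.
  -- Below, `max K 1` makes the constant positive.
  have hcomp : IsCompact (Metric.sphere (0 : ι → ℂ) 1) := isCompact_sphere 0 1
  have hcont : ContinuousOn (fun W => ‖sesqValue T W‖ / (sesqValue D W).re)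
      (Metric.sphere (0 : ι → ℂ) 1) := by
    refine ((continuous_sesqValue T).norm.continuousOn).div
      ((Complex.continuous_re.comp (continuous_sesqValue D)).continuousOn) fun W hW => ?_
    exact (hD.pos W (ne_zero_of_mem_unit_sphere ⟨W, hW⟩)).ne'
  obtain ⟨K, hK⟩ := hcomp.bddAbove_image hcont
  refine ⟨max K 1, by positivity, fun W => ?_⟩
  by_cases hW : W = 0
  · subst hW; simp [sesqValue]
  · have hn : ‖W‖ ≠ 0 := by simpa using hW
    set V : ι → ℂ := ((‖W‖⁻¹ : ℝ) : ℂ) • W with hV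
    have hVs : V ∈ Metric.sphere (0 : ι → ℂ) 1 := by
      simp [hV, norm_smul, hn]
    have hWV : W = (‖W‖ : ℂ) • V := by
      rw [hV, smul_smul, ← Complex.ofReal_mul, mul_inv_cancel₀ hn]; simp
    have h1 : ‖sesqValue T V‖ / (sesqValue D V).re ≤ K := hK ⟨V, hVs, rfl⟩
    have hpos := hD.pos V (ne_zero_of_mem_unit_sphere ⟨V, hVs⟩)
    rw [div_le_iff₀ hpos] at h1
    have hT := sesqValue_smul_vec T (‖W‖ : ℂ) V
    have hDV := sesqValue_smul_vec D (‖W‖ : ℂ) V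
    rw [← hWV, Complex.norm_real, norm_norm] at hT hDV
    rw [hT, hDV, norm_mul, Complex.re_ofReal_mul, Complex.norm_real, norm_pow, norm_norm]
    have h2 : K * (sesqValue D V).re ≤ max K 1 * (sesqValue D V).re :=
      mul_le_mul_of_nonneg_right (le_max_left _ _) hpos.le
    nlinarith [mul_le_mul_of_nonneg_left (h1.trans h2) (sq_nonneg ‖W‖)]

/-- The Schur complement of the last diagonal entry. -/
def schurLast {n : ℕ} (D : Matrix (Fin (n + 1)) (Fin (n + 1)) ℂ) : Matrix (Fin n) (Fin n) ℂ :=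
  fun a b => D a.castSucc b.castSucc -
    D a.castSucc (Fin.last n) * D (Fin.last n) b.castSucc / D (Fin.last n) (Fin.last n)

theorem PosHerm.last_pos {n : ℕ} {D : Matrix (Fin (n + 1)) (Fin (n + 1)) ℂ} (hD : PosHerm D) :
    0 < (D (Fin.last n) (Fin.last n)).re ∧
      D (Fin.last n) (Fin.last n) = ((D (Fin.last n) (Fin.last n)).re : ℂ) := by
  refine ⟨?_, (Complex.conj_eq_iff_re.1 (hD.conj_apply _ _)).symm⟩
  have := hD.pos (Pi.single (Fin.last n) 1) (by simp)
  simpa [sesqValue, Pi.single_apply] using this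

/-- Completing the square in the last coordinate. -/
theorem sesqValue_snoc {n : ℕ} {D : Matrix (Fin (n + 1)) (Fin (n + 1)) ℂ} (hD : PosHerm D)
    (W : Fin n → ℂ) (t : ℂ) :
    sesqValue D (Fin.snoc W t) = sesqValue (schurLast D) W +
      D (Fin.last n) (Fin.last n) * ((‖t + (∑ a, W a * D a.castSucc (Fin.last n)) /
        D (Fin.last n) (Fin.last n)‖ ^ 2 : ℝ) : ℂ) := by
  obtain ⟨hc, hc'⟩ := hD.last_pos
  set c := D (Fin.last n) (Fin.last n) with hcdef
  have hc0 : c ≠ 0 := fun h => by rw [h] at hc; simp at hc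
  have hcc : conj c = c := hD.conj_apply _ _
  set β := ∑ a, W a * D a.castSucc (Fin.last n) with hβ
  have hβc : conj β = ∑ b, conj (W b) * D (Fin.last n) b.castSucc := by
    simp only [hβ, map_sum, map_mul, hD.conj_apply]
  have e1 : ((‖t + β / c‖ ^ 2 : ℝ) : ℂ) = (t + β / c) * (conj t + conj β / c) := by
    rw [← Complex.normSq_eq_norm_sq, ← Complex.mul_conj]
    simp [hcc]
  have e2 : sesqValue (schurLast D) W = (∑ a, ∑ b, W a * conj (W b) * D a.castSucc b.castSucc) -
      β * conj β / c := by
    rw [hβc, hβ, Finset.sum_mul_sum, Finset.sum_div, ← Finset.sum_sub_distrib]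
    refine Finset.sum_congr rfl fun a _ => ?_
    rw [Finset.sum_div, ← Finset.sum_sub_distrib]
    refine Finset.sum_congr rfl fun b _ => ?_
    rw [schurLast]
    ring
  have e3 : sesqValue D (Fin.snoc W t) = (∑ a, ∑ b, W a * conj (W b) * D a.castSucc b.castSucc) +
      β * conj t + t * conj β + t * conj t * c := by
    rw [hβc, hβ, sesqValue, Fin.sum_univ_castSucc]
    simp only [Fin.sum_univ_castSucc, Fin.snoc_castSucc, Fin.snoc_last, Finset.sum_add_distrib,
      Finset.mul_sum, Finset.sum_mul]
    rw [← hcdef]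
    have s1 : ∀ a, W a * conj t * D (Fin.castSucc a) (Fin.last n) =
      W a * D (Fin.castSucc a) (Fin.last n) * conj t := fun a => by ring
    simp only [s1, mul_assoc]
    ring
  rw [e1, e2, e3]
  field_simp
  ring

theorem PosHerm.schurLast {n : ℕ} {D : Matrix (Fin (n + 1)) (Fin (n + 1)) ℂ} (hD : PosHerm D) :
    PosHerm (schurLast D) := by
  refine ⟨fun a b => ?_, fun W hW => ?_⟩
  · simp only [FibreIntegrals.schurLast, map_sub, map_mul, map_div₀, hD.conj_apply]
    ring
  -- This last coordinate annihilates the square, so the Schur complement takes a value of the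
  -- positive form `D`.
  · have h := sesqValue_snoc hD W (-((∑ a, W a * D a.castSucc (Fin.last n)) /
        D (Fin.last n) (Fin.last n)))
    simp only [neg_add_cancel, norm_zero, ne_eq, OfNat.ofNat_ne_zero, not_false_eq_true, zero_pow,
      Complex.ofReal_zero, mul_zero, add_zero] at h
    rw [← h]
    refine hD.pos _ fun h0 => hW ?_
    funext a
    have := congrFun h0 a.castSucc
    simpa using this

theorem det_eq_schurLast {n : ℕ} {D : Matrix (Fin (n + 1)) (Fin (n + 1)) ℂ}
    (hc : D (Fin.last n) (Fin.last n) ≠ 0) :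
    D.det = D (Fin.last n) (Fin.last n) * (schurLast D).det := by
  let A : Matrix (Fin 1) (Fin 1) ℂ :=
    Matrix.of fun _ _ => D (Fin.last n) (Fin.last n)
  have hA : A.det = D (Fin.last n) (Fin.last n) := by
    rw [Matrix.det_fin_one]; rfl
  let _ := A.invertibleOfIsUnitDet (by rw [hA]; exact isUnit_iff_ne_zero.2 hc)
  have h : D.submatrix finSumFinEquiv finSumFinEquiv = Matrix.fromBlocks
      (Matrix.of fun a b => D a.castSucc b.castSucc)
      (Matrix.of fun a _ => D a.castSucc (Fin.last n))
      (Matrix.of fun _ b => D (Fin.last n) b.castSucc) A := by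
    have hl : ∀ j : Fin 1, Fin.natAdd n j = Fin.last n := fun j => by
      ext; simp
    ext (i | i) (j | j) <;> simp [hl, A] <;> rfl
  rw [← Matrix.det_submatrix_equiv_self finSumFinEquiv, h, Matrix.det_fromBlocks₂₂, hA]
  congr 2
  ext a b
  rw [Matrix.invOf_eq_nonsing_inv, Matrix.sub_apply]
  simp [Matrix.mul_apply, schurLast, A]
  field_simp

end PosHerm

/-! ### Integrals over affine space -/

section Integrals

open MeasureTheory Set Filter

/-- After a translation, polar coordinates leave the integrand `r (A + c r²)^{-(k+2)}`, which has
the elementary primitive `g`. -/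
theorem integral_radial (A c : ℝ) (hA : 0 < A) (hc : 0 < c) (k : ℕ) (γ : ℂ) :
    Integrable (fun t : ℂ => ((A + c * ‖t + γ‖ ^ 2)⁻¹) ^ (k + 2)) ∧
    ∫ t : ℂ, ((A + c * ‖t + γ‖ ^ 2)⁻¹) ^ (k + 2) = Real.pi / ((k + 1) * c) * (A⁻¹) ^ (k + 1) := by
  have hpos : ∀ r : ℝ, 0 < A + c * r ^ 2 := fun r => by positivity
  let g : ℝ → ℝ := fun r => -(1 / (2 * (k + 1) * c)) * ((A + c * r ^ 2)⁻¹) ^ (k + 1)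
  have hg : ∀ r : ℝ, HasDerivAt g (r * ((A + c * r ^ 2)⁻¹) ^ (k + 2)) r := by
    intro r
    have h1 : HasDerivAt (fun r : ℝ => A + c * r ^ 2) (c * (2 * r)) r := by
      simpa using ((hasDerivAt_pow 2 r).const_mul c).const_add A
    have h2 := ((h1.inv (hpos r).ne').pow (k + 1)).const_mul (-(1 / (2 * ((k : ℝ) + 1) * c)))
    refine h2.congr_deriv ?_
    have := (hpos r).ne'
    simp only [Nat.add_sub_cancel, Pi.inv_apply, Nat.cast_add, Nat.cast_one]
    rw [pow_add _ k 2, inv_pow _ 2]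
    generalize ((A + c * r ^ 2)⁻¹) ^ k = b
    field_simp
  have hlim : Tendsto g atTop (𝓝 0) := by
    have h1 : Tendsto (fun r : ℝ => A + c * r ^ 2) atTop atTop :=
      tendsto_atTop_add_const_left _ _ ((tendsto_pow_atTop two_ne_zero).const_mul_atTop hc)
    have h2 := ((h1.inv_tendsto_atTop).pow (k + 1)).const_mul (-(1 / (2 * ((k : ℝ) + 1) * c)))
    rw [zero_pow (Nat.succ_ne_zero k), mul_zero] at h2
    exact h2
  have hnn : ∀ r ∈ Ioi (0 : ℝ), 0 ≤ r * ((A + c * r ^ 2)⁻¹) ^ (k + 2) := fun r hr => by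
    have := hpos r
    have : 0 < r := hr
    positivity
  have hint := integrableOn_Ioi_deriv_of_nonneg' (fun r _ => hg r) hnn hlim
  have hval := integral_Ioi_of_hasDerivAt_of_tendsto' (fun r _ => hg r) hint hlim
  have hI : Integrable (fun t : ℂ => ((A + c * ‖t‖ ^ 2)⁻¹) ^ (k + 2)) := by
    have := (integrable_fun_norm_addHaar (volume : Measure ℂ)
      (f := fun r : ℝ => ((A + c * r ^ 2)⁻¹) ^ (k + 2))).2
    refine this ?_
    simpa [Complex.finrank_real_complex] using hint
  have hV : ∫ t : ℂ, ((A + c * ‖t‖ ^ 2)⁻¹) ^ (k + 2) =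
      Real.pi / ((k + 1) * c) * (A⁻¹) ^ (k + 1) := by
    rw [integral_fun_norm_addHaar (volume : Measure ℂ)
      (fun r : ℝ => ((A + c * r ^ 2)⁻¹) ^ (k + 2))]
    simp only [Complex.finrank_real_complex, smul_eq_mul, Nat.add_one_sub_one, pow_one]
    rw [hval, measureReal_def, Complex.volume_ball]
    simp [g]
    field_simp
  refine ⟨hI.comp_add_right γ, ?_⟩
  rw [integral_add_right_eq_self (fun t : ℂ => ((A + c * ‖t‖ ^ 2)⁻¹) ^ (k + 2)) γ, hV]

theorem cons_one_ne_zero {m : ℕ} (w : Fin m → ℂ) : (Fin.cons 1 w : Fin (m + 1) → ℂ) ≠ 0 :=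
  fun h => by simpa using congrFun h 0

/-- Induction on the number of coordinates. By `sesqValue_snoc` the last coordinate integrates to `π
/ ((m + 1) c)` times the next lower power for the Schur complement, and `det D` is `c` times the
determinant of the latter. -/
theorem integral_sesqValue_re (m : ℕ) (D : Matrix (Fin (m + 1)) (Fin (m + 1)) ℂ)
    (hD : PosHerm D) :
    Integrable (fun w : Fin m → ℂ => ((sesqValue D (Fin.cons 1 w)).re⁻¹) ^ (m + 1)) ∧
    ∫ w : Fin m → ℂ, ((sesqValue D (Fin.cons 1 w)).re⁻¹) ^ (m + 1) =
      Real.pi ^ m / m.factorial * (D.det.re)⁻¹ := by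
  induction m with
  | zero =>
    have h : ∀ w : Fin 0 → ℂ, (sesqValue D (Fin.cons 1 w)).re = D.det.re := fun w => by
      simp [sesqValue]
    simp only [h]
    refine ⟨Integrable.of_finite, ?_⟩
    rw [volume_pi, Measure.pi_of_empty]
    simp
  | succ m ih =>
    obtain ⟨ihI, ihV⟩ := ih (schurLast D) hD.schurLast
    obtain ⟨hc, hc'⟩ := hD.last_pos
    set c := (D (Fin.last (m + 1)) (Fin.last (m + 1))).re with hcdef
    let γ : (Fin m → ℂ) → ℂ := fun w =>
      (∑ a, (Fin.cons 1 w : Fin (m + 1) → ℂ) a * D a.castSucc (Fin.last (m + 1))) /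
        D (Fin.last (m + 1)) (Fin.last (m + 1))
    let Q : (Fin m → ℂ) → ℝ := fun w => (sesqValue (schurLast D) (Fin.cons 1 w)).re
    have hQ : ∀ w, 0 < Q w := fun w => hD.schurLast.pos _ (cons_one_ne_zero w)
    have hsnoc : ∀ (w : Fin m → ℂ) (t : ℂ),
        (sesqValue D (Fin.cons 1 (Fin.snoc w t : Fin (m + 1) → ℂ))).re =
          Q w + c * ‖t + γ w‖ ^ 2 := by
      intro w t
      rw [Fin.cons_snoc_eq_snoc_cons, sesqValue_snoc hD, hc', Complex.add_re,
        Complex.re_ofReal_mul, Complex.ofReal_re, ← hc']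
    let f : (Fin (m + 1) → ℂ) → ℝ := fun w =>
      ((sesqValue D (Fin.cons 1 w)).re⁻¹) ^ (m + 1 + 1)
    -- Splits off the last coordinate for Fubini's theorem. Integrability on the product comes from
    -- the nonnegative integrand and the induction hypothesis.
    let e := MeasurableEquiv.piFinSuccAbove (fun _ : Fin (m + 1) => ℂ) (Fin.last m)
    have he : MeasurePreserving e := volume_preserving_piFinSuccAbove (fun _ => ℂ) (Fin.last m)
    have hes : ∀ p : ℂ × (Fin m → ℂ), f (e.symm p) = ((Q p.2 + c * ‖p.1 + γ p.2‖ ^ 2)⁻¹) ^ (m + 2) := by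
      intro p
      have : e.symm p = (Fin.snoc p.2 p.1 : Fin (m + 1) → ℂ) := by
        change (Fin.last m).insertNth (α := fun _ => ℂ) p.1 p.2 = _
        rw [Fin.insertNth_last']
      rw [this, ← hsnoc]
    have hfc : Continuous f := by
      refine Continuous.pow (Continuous.inv₀ (Complex.continuous_re.comp
        ((continuous_sesqValue D).comp (by fun_prop))) fun w => ?_) _
      exact (hD.pos _ (cons_one_ne_zero w)).ne'
    have hmeas : AEStronglyMeasurable (fun p => f (e.symm p)) (volume : Measure (ℂ × (Fin m → ℂ))) :=
      (hfc.measurable.comp e.symm.measurable).aestronglyMeasurable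
    have hrad := fun w => integral_radial (Q w) c (hQ w) hc m (γ w)
    have hprod : Integrable (fun p => f (e.symm p)) (volume : Measure (ℂ × (Fin m → ℂ))) := by
      refine (integrable_prod_iff' hmeas).2 ⟨Filter.Eventually.of_forall fun w => ?_, ?_⟩
      · simp only [hes]; exact (hrad w).1
      · have h0 : ∀ (w : Fin m → ℂ) (t : ℂ), ‖f (e.symm (t, w))‖ =
            ((Q w + c * ‖t + γ w‖ ^ 2)⁻¹) ^ (m + 2) := fun w t => by
          rw [hes, Real.norm_of_nonneg]
          have := hQ w
          positivity
        simp only [h0, fun w => (hrad w).2]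
        exact ihI.const_mul _
    have hI : Integrable f := by
      have := he.integrable_comp_emb e.measurableEmbedding (g := fun p => f (e.symm p))
      rw [← this] at hprod
      simpa [Function.comp_def] using hprod
    refine ⟨hI, ?_⟩
    have h1 : ∫ w, f w = ∫ p, f (e.symm p) := by
      rw [← he.integral_comp e.measurableEmbedding]
      simp
    change ∫ w, f w = _
    rw [h1, Measure.volume_eq_prod, integral_prod_symm _ hprod]
    simp only [hes, fun w => (hrad w).2]
    rw [integral_const_mul, ihV, det_eq_schurLast (D := D) (fun h => by
      rw [hcdef, h] at hc; simp at hc), hc', Complex.re_ofReal_mul, mul_inv, Nat.factorial_succ]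
    have := hD.schurLast.det_re_pos.1
    push_cast
    field_simp
    ring

end Integrals

/-! ### Variation of the volume integral with the hermitian matrix -/

section FibreIntegral

open MeasureTheory Set Filter

/-- A perturbation bounded by half of `D` preserves positivity, with a lower bound uniform in `t`
for dominated convergence. -/
theorem PosHerm.add_smul {ι : Type*} [Fintype ι] {D T : Matrix ι ι ℂ} (hD : PosHerm D)
    (hT : ∀ a b, conj (T a b) = T b a) {K : ℝ}
    (hK : ∀ W, ‖sesqValue T W‖ ≤ K * (sesqValue D W).re) {t : ℝ} (ht : |t| * K ≤ 1 / 2) :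
    PosHerm (D + (t : ℂ) • T) ∧
      ∀ W, (sesqValue D W).re / 2 ≤ (sesqValue (D + (t : ℂ) • T) W).re := by
  have h : ∀ W, (sesqValue D W).re / 2 ≤ (sesqValue (D + (t : ℂ) • T) W).re := by
    intro W
    rw [sesqValue_add_smul, Complex.add_re, Complex.re_ofReal_mul]
    have h0 : 0 ≤ (sesqValue D W).re := by rw [← hD.norm_sesqValue]; positivity
    have h1 : |t * (sesqValue T W).re| ≤ (sesqValue D W).re / 2 := by
      rw [abs_mul]
      calc |t| * |(sesqValue T W).re| ≤ |t| * (K * (sesqValue D W).re) :=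
            mul_le_mul_of_nonneg_left ((Complex.abs_re_le_norm _).trans (hK W)) (abs_nonneg _)
        _ = (|t| * K) * (sesqValue D W).re := by ring
        _ ≤ 1 / 2 * (sesqValue D W).re := mul_le_mul_of_nonneg_right ht h0
        _ = _ := by ring
    have := neg_le_of_abs_le h1
    linarith
  refine ⟨⟨fun a b => ?_, fun W hW => ?_⟩, h⟩
  · simp [hD.conj_apply, hT]
  · have := hD.pos W hW
    have := h W
    linarith

theorem hasDerivAt_det_add_smul {ι : Type*} [Fintype ι] [DecidableEq ι] (D T : Matrix ι ι ℂ) :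
    HasDerivAt (fun t : ℝ => (D + (t : ℂ) • T).det) (D.adjugate * T).trace 0 := by
  have h1 : ∀ i j, HasFDerivAt (fun t : ℝ => (D + (t : ℂ) • T) i j)
      (ContinuousLinearMap.toSpanSingleton ℝ (T i j)) 0 := by
    intro i j
    have h2 : HasDerivAt (fun t : ℝ => D i j + (t : ℂ) * T i j) (T i j) 0 := by
      simpa using ((Complex.ofRealCLM.hasDerivAt (x := 0)).mul_const (T i j)).const_add (D i j)
    exact h2.hasFDerivAt
  have h2 := (hasFDerivAt_det h1).hasDerivAt
  refine h2.congr_deriv ?_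
  simp [Matrix.trace, Matrix.mul_apply, _root_.sum_apply]

/-- Derivative at `t = 0` of `integral_sesqValue_re` for `D + t T`. The left side is differentiated
under the integral sign, which gives the factor `-(m + 1)`, and the right side by Jacobi's formula.
-/
theorem integral_sesqValue_div {m : ℕ} {D T : Matrix (Fin (m + 1)) (Fin (m + 1)) ℂ}
    (hD : PosHerm D) (hT : ∀ a b, conj (T a b) = T b a) :
    Integrable (fun w : Fin m → ℂ =>
      sesqValue T (Fin.cons 1 w) / sesqValue D (Fin.cons 1 w) ^ (m + 2)) ∧
    ∫ w : Fin m → ℂ, sesqValue T (Fin.cons 1 w) / sesqValue D (Fin.cons 1 w) ^ (m + 2) =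
      (Real.pi : ℂ) ^ m / (m + 1).factorial * ((D⁻¹ * T).trace / D.det) := by
  obtain ⟨K, hK0, hK⟩ := hD.exists_bound T
  let n : (Fin m → ℂ) → ℝ := fun w => (sesqValue D (Fin.cons 1 w)).re
  let τ : (Fin m → ℂ) → ℝ := fun w => (sesqValue T (Fin.cons 1 w)).re
  have hn : ∀ w, 0 < n w := fun w => hD.pos _ (cons_one_ne_zero w)
  have hτ : ∀ w, |τ w| ≤ K * n w := fun w => (Complex.abs_re_le_norm _).trans (hK _)
  -- With this radius `t T` is at most half of `D`.
  let s : Set ℝ := Metric.ball 0 (1 / (2 * K))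
  have hs : s ∈ 𝓝 (0 : ℝ) := Metric.ball_mem_nhds _ (by positivity)
  have hsK : ∀ t ∈ s, |t| * K ≤ 1 / 2 := fun t ht => by
    rw [Metric.mem_ball, dist_zero_right, Real.norm_eq_abs, lt_div_iff₀ (by positivity)] at ht
    linarith
  have hval : ∀ (t : ℝ) w, (sesqValue (D + (t : ℂ) • T) (Fin.cons 1 w)).re = n w + t * τ w :=
    fun t w => by rw [sesqValue_add_smul, Complex.add_re, Complex.re_ofReal_mul]
  have hlow : ∀ t ∈ s, ∀ w, n w / 2 ≤ n w + t * τ w := fun t ht w => by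
    rw [← hval]; exact (hD.add_smul hT hK (hsK t ht)).2 _
  let F : ℝ → (Fin m → ℂ) → ℝ := fun t w => ((n w + t * τ w)⁻¹) ^ (m + 1)
  let F' : ℝ → (Fin m → ℂ) → ℝ := fun t w => -((m + 1) * (τ w * ((n w + t * τ w)⁻¹) ^ (m + 2)))
  have hFI : ∀ t ∈ s, Integrable (F t) ∧ ∫ w, F t w =
      Real.pi ^ m / m.factorial * ((D + (t : ℂ) • T).det.re)⁻¹ := fun t ht => by
    have := integral_sesqValue_re m _ (hD.add_smul hT hK (hsK t ht)).1
    simpa only [hval] using this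
  have h0s : (0 : ℝ) ∈ s := mem_of_mem_nhds hs
  have hnc : Continuous n := Complex.continuous_re.comp ((continuous_sesqValue D).comp (by fun_prop))
  have hτc : Continuous τ := Complex.continuous_re.comp ((continuous_sesqValue T).comp (by fun_prop))
  have hn0 : ∀ t ∈ s, ∀ w, 0 < n w + t * τ w := fun t ht w => by
    have := hlow t ht w
    have := hn w
    linarith
  have hF'c : Continuous (F' 0) := by
    refine (continuous_const.mul (hτc.mul (Continuous.pow (Continuous.inv₀ (by fun_prop)
      fun w => (hn0 0 h0s w).ne') _))).neg
  -- From `|τ| ≤ K n` and `n + t τ ≥ n / 2`. The dominating function is a multiple of the integrand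
  -- at `t = 0`.
  have hbound : ∀ w, ∀ t ∈ s, ‖F' t w‖ ≤ ((m + 1) * K * 2 ^ (m + 2)) * ((n w)⁻¹) ^ (m + 1) := by
    intro w t ht
    have hw := hn w
    have h1 : (n w + t * τ w)⁻¹ ≤ 2 * (n w)⁻¹ := by
      rw [← div_eq_mul_inv, inv_le_comm₀ (hn0 t ht w) (by positivity), inv_div]
      exact hlow t ht w
    have h2 : 0 ≤ (n w + t * τ w)⁻¹ := inv_nonneg.2 (hn0 t ht w).le
    simp only [F', norm_neg, norm_mul, Real.norm_eq_abs, norm_pow, abs_of_nonneg h2]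
    rw [abs_of_nonneg (by positivity : (0 : ℝ) ≤ (m : ℝ) + 1)]
    calc ((m : ℝ) + 1) * (|τ w| * ((n w + t * τ w)⁻¹) ^ (m + 2))
        ≤ (m + 1) * ((K * n w) * (2 * (n w)⁻¹) ^ (m + 2)) := by
          gcongr
          exact hτ w
      _ = ((m + 1) * K * 2 ^ (m + 2)) * ((n w)⁻¹) ^ (m + 1) := by
          rw [mul_pow, pow_succ (n w)⁻¹ (m + 1)]
          field_simp
  have hdiff : ∀ w, ∀ t ∈ s, HasDerivAt (fun t => F t w) (F' t w) t := by
    intro w t ht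
    have h1 : HasDerivAt (fun t : ℝ => n w + t * τ w) (τ w) t := by
      simpa using ((hasDerivAt_id t).mul_const (τ w)).const_add (n w)
    have h2 := (h1.inv (hn0 t ht w).ne').pow (m + 1)
    refine h2.congr_deriv ?_
    simp only [Nat.add_sub_cancel, Pi.inv_apply, Nat.cast_add, Nat.cast_one, F']
    rw [pow_add _ m 2, inv_pow _ 2]
    generalize ((n w + t * τ w)⁻¹) ^ m = b
    ring
  obtain ⟨hI, hder⟩ := hasDerivAt_integral_of_dominated_loc_of_deriv_le (μ := volume) hs
    (Filter.eventually_of_mem hs fun t ht => (hFI t ht).1.aestronglyMeasurable) (hFI 0 h0s).1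
    hF'c.aestronglyMeasurable (Filter.Eventually.of_forall hbound)
    ((by simpa only [F, zero_mul, add_zero] using (hFI 0 h0s).1.const_mul ((m + 1) * K * 2 ^ (m + 2)) :
      Integrable (fun w => ((m + 1) * K * 2 ^ (m + 2)) * ((n w)⁻¹) ^ (m + 1)) volume))
    (Filter.Eventually.of_forall hdiff)
  have hdet := hasDerivAt_det_add_smul D T
  set d := (D.adjugate * T).trace with hd
  have hdre : HasDerivAt (fun t : ℝ => (D + (t : ℂ) • T).det.re) d.re 0 :=
    Complex.reCLM.hasFDerivAt.comp_hasDerivAt 0 hdet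
  -- The trace is real because it is the derivative of a determinant which is real for all small
  -- `t`.
  have hdreal : d = (d.re : ℂ) := by
    refine hdet.unique ((Complex.ofRealCLM.hasFDerivAt.comp_hasDerivAt 0 hdre).congr_of_eventuallyEq
      (Filter.eventuallyEq_of_mem hs fun t ht => ?_))
    exact (hD.add_smul hT hK (hsK t ht)).1.det_re_pos.2
  have hp := hD.det_re_pos
  have hder2 : HasDerivAt (fun t => ∫ w, F t w)
      (Real.pi ^ m / m.factorial * (-d.re / D.det.re ^ 2)) 0 := by
    have h1 := (hdre.inv (by simpa using hp.1.ne')).const_mul (Real.pi ^ m / (m.factorial : ℝ))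
    simp only [Complex.ofReal_zero, zero_smul, add_zero] at h1
    exact h1.congr_of_eventuallyEq (Filter.eventuallyEq_of_mem hs fun t ht => (hFI t ht).2)
  have hval0 := hder.unique hder2
  have hf : ∀ w : Fin m → ℂ, sesqValue T (Fin.cons 1 w) / sesqValue D (Fin.cons 1 w) ^ (m + 2) =
      ((-(1 / (m + 1 : ℝ)) * F' 0 w : ℝ) : ℂ) := by
    intro w
    have hm : ((m : ℝ) + 1) ≠ 0 := by positivity
    have : -(1 / (m + 1 : ℝ)) * F' 0 w = τ w / n w ^ (m + 2) := by
      simp only [F', zero_mul, add_zero, inv_pow]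
      field_simp
    rw [this, sesqValue_eq_re hT, sesqValue_eq_re hD.conj_apply]
    push_cast
    rfl
  simp only [hf]
  refine ⟨(hI.const_mul _).ofReal, ?_⟩
  rw [integral_complex_ofReal, integral_const_mul, hval0]
  have htr : (D⁻¹ * T).trace = d / D.det := by
    rw [Matrix.inv_def, Matrix.smul_mul, Matrix.trace_smul, Ring.inverse_eq_inv', smul_eq_mul]
    field_simp
    rw [← hd]
  rw [htr, hdreal, hp.2, Nat.factorial_succ]
  push_cast
  have h1 : ((m : ℂ) + 1) ≠ 0 := by exact_mod_cast Nat.succ_ne_zero m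
  have h2 : (D.det.re : ℂ) ≠ 0 := by exact_mod_cast hp.1.ne'
  simp only [Complex.ofReal_re]
  field_simp

end FibreIntegral

/-! ### The fibre integral of the Fubini–Study volume -/

section Contraction

variable {N : Type*} [NormedAddCommGroup N] [NormedSpace ℂ N]

/-- The contraction of a form with the last vectors of its argument, pulled back by a linear map. -/
def contractForm {E : Type*} [AddCommGroup E] [Module ℝ E] {k l : ℕ} (g : Form N (k + l))
    (f : E →ₗ[ℝ] N) (b : Fin l → N) : Form E k where
  toFun u := g (Fin.append (fun i => f (u i)) b)
  map_update_add' := by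
    intro inst u i x y
    obtain rfl : inst = instDecidableEqFin k := Subsingleton.elim _ _
    have h : ∀ x, Fin.append (fun j => f (Function.update u i x j)) b =
        Function.update (Fin.append (fun j => f (u j)) b) (Fin.castAdd l i) (f x) := by
      intro x
      funext j
      refine Fin.addCases (fun j => ?_) (fun j => ?_) j
      · by_cases hj : j = i
        · subst hj; simp
        · rw [Function.update_of_ne (by simpa using hj)]
          simp [hj]
      · rw [Function.update_of_ne]
        · simp
        · intro h
          have := congrArg Fin.val h
          simp at this
          omega
    simp only [h, map_add, AlternatingMap.map_update_add]
  map_update_smul' := by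
    intro inst u i c x
    obtain rfl : inst = instDecidableEqFin k := Subsingleton.elim _ _
    have h : ∀ x, Fin.append (fun j => f (Function.update u i x j)) b =
        Function.update (Fin.append (fun j => f (u j)) b) (Fin.castAdd l i) (f x) := by
      intro x
      funext j
      refine Fin.addCases (fun j => ?_) (fun j => ?_) j
      · by_cases hj : j = i
        · subst hj; simp
        · rw [Function.update_of_ne (by simpa using hj)]
          simp [hj]
      · rw [Function.update_of_ne]
        · simp
        · intro h
          have := congrArg Fin.val h
          simp at this
          omega
    simp only [h, map_smul, AlternatingMap.map_update_smul]
  map_eq_zero_of_eq' := by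
    intro u i j hij hne
    exact g.map_eq_zero_of_eq _ (i := Fin.castAdd l i) (j := Fin.castAdd l j) (by simp [hij])
      (by simpa using hne)

theorem form_two_apply_eq (β : Form N 2) (u : Fin 2 → N) : β u = β ![u 0, u 1] := by
  congr 1
  funext i
  fin_cases i <;> rfl

theorem wedgePow_map_I (β : Form N 2)
    (hβ : ∀ x y, β ![Complex.I • x, Complex.I • y] = β ![x, y]) (p : ℕ) (v : Fin (2 * p) → N) :
    wedgePow β p (fun i => Complex.I • v i) = wedgePow β p v := by
  let f : N →ₗ[ℝ] N := ((LinearMap.lsmul ℂ N Complex.I)).restrictScalars ℝ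
  have h : β.compLinearMap f = β := by
    ext u
    rw [AlternatingMap.compLinearMap_apply, form_two_apply_eq, form_two_apply_eq β u]
    exact hβ _ _
  have h2 := wedgePow_compLinearMap β f p
  rw [h] at h2
  conv_rhs => rw [h2]
  rfl

/-- The arguments of a fibre integral in the shape required by `map_cons_interleave_I`: the two
horizontal vectors form the first pair and each fibre coordinate gives a pair `e_k`, `i e_k`. -/
theorem append_stdRealFrame_eq_interleave {E : Type*} [AddCommGroup E] {m : ℕ}
    (hc : 2 * (m + 1) = 2 * 1 + 2 * m) (u : Fin (2 * 1) → E) :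
    (Fin.append (fun i => ((u i, 0) : E × (Fin m → ℂ))) (fun j => (0, stdRealFrame m j)) ∘
      Fin.cast hc) = interleave
        (Fin.cons (u 0, 0) fun k => (0, Pi.single k 1) : Fin (m + 1) → E × (Fin m → ℂ))
        (Fin.cons (u 1, 0) fun k => (0, Pi.single k Complex.I) : Fin (m + 1) → E × (Fin m → ℂ)) := by
  have hl : ∀ (i : Fin (2 * (m + 1))) (j : Fin (2 * 1)), (i : ℕ) = j →
      Fin.cast hc i = Fin.castAdd (2 * m) j := fun i j h => Fin.ext h
  have hr : ∀ (i : Fin (2 * (m + 1))) (j : Fin (2 * m)), (i : ℕ) = 2 * 1 + j →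
      Fin.cast hc i = Fin.natAdd (2 * 1) j := fun i j h => Fin.ext h
  funext i
  obtain ⟨i, rfl⟩ := (interleaveEquiv _).surjective i
  rw [Function.comp_apply]
  rcases i with i | i
  · rw [interleave_inl]
    refine Fin.cases ?_ (fun j => ?_) i
    · rw [hl _ 0 (by simp [interleaveEquiv])]
      simp
    · rw [hr _ ⟨2 * j, by omega⟩ (by simp [interleaveEquiv]; omega), Fin.append_right]
      simp [stdRealFrame]
  · rw [interleave_inr]
    refine Fin.cases ?_ (fun j => ?_) i
    · rw [hl _ 1 (by rfl)]
      simp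
    · rw [hr _ ⟨2 * j + 1, by omega⟩ (by simp [interleaveEquiv]; omega), Fin.append_right]
      have h : (2 * (j : ℕ) + 1) % 2 = 1 := by omega
      have h' : (2 * (j : ℕ) + 1) / 2 = j := by omega
      simp [stdRealFrame, h, h']

end Contraction

/-! ### The fibre integral of the top power is the curvature of the determinant -/

section Core

open MeasureTheory

variable {E : Type*} [NormedAddCommGroup E] [NormedSpace ℂ E] {m : ℕ}
  {D : E → Matrix (Fin (m + 1)) (Fin (m + 1)) ℂ} {z : E}

theorem affineForm_eq_sesqValue {E : Type*}
    {D : E → Matrix (Fin (m + 1)) (Fin (m + 1)) ℂ} (p : E × (Fin m → ℂ)) :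
    affineForm D p = sesqValue (D p.1) (Fin.cons 1 p.2) := rfl

/-- The matrix `∂_u ∂̄_u D - ∂_u D D⁻¹ ∂̄_u D`. -/
def curvatureMatrix (D : E → Matrix (Fin (m + 1)) (Fin (m + 1)) ℂ) (z u : E) :
    Matrix (Fin (m + 1)) (Fin (m + 1)) ℂ :=
  (Matrix.of fun i j => levi (fun y => D y i j) z u u) -
    (Matrix.of fun i j => del (fun y => D y i j) z u) * (D z)⁻¹ *
      (Matrix.of fun i j => dbar (fun y => D y i j) z u)

/-- Conjugation exchanges `del` and `dbar` and transposes the hermitian family `D`. Hermitian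
symmetry is needed to apply `integral_sesqValue_div`. -/
theorem conj_curvatureMatrix (hD : ∀ i j, ContDiffAt ℝ 2 (fun y => D y i j) z)
    (hP : ∀ᶠ y in 𝓝 z, PosHerm (D y)) (u : E) (a b : Fin (m + 1)) :
    conj (curvatureMatrix D z u a b) = curvatureMatrix D z u b a := by
  have hc : ∀ a b, (fun y => conj (D y a b)) =ᶠ[𝓝 z] fun y => D y b a := fun a b => by
    filter_upwards [hP] with y hy using hy.conj_apply a b
  have h1 : ∀ a b, conj (levi (fun y => D y a b) z u u) = levi (fun y => D y b a) z u u :=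
    fun a b => by rw [← levi_conj (hD a b), levi_congr (hc a b)]
  have h2 : ∀ a b, conj (del (fun y => D y a b) z u) = dbar (fun y => D y b a) z u :=
    fun a b => by rw [← dbar_conj, dbar_congr (hc a b)]
  have h3 : ∀ a b, conj (dbar (fun y => D y a b) z u) = del (fun y => D y b a) z u :=
    fun a b => by rw [← del_conj, del_congr (hc a b)]
  have h4 : ((D z)⁻¹).conjTranspose = (D z)⁻¹ := by
    rw [Matrix.conjTranspose_nonsing_inv]
    congr 1
    ext i j
    exact (hP.self_of_nhds).conj_apply j i
  have h5 : (curvatureMatrix D z u).conjTranspose = curvatureMatrix D z u := by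
    rw [curvatureMatrix, Matrix.conjTranspose_sub, Matrix.conjTranspose_mul,
      Matrix.conjTranspose_mul, h4, ← mul_assoc]
    congr 2
    · ext i j
      simpa using h1 j i
    · congr 1
      ext i j
      simpa using h3 j i
    · ext i j
      simpa using h2 j i
  exact congrFun (congrFun h5 b) a

theorem levi_log_det_eq_trace (hD : ∀ i j, ContDiffAt ℝ 2 (fun y => D y i j) z)
    (hP : ∀ᶠ y in 𝓝 z, PosHerm (D y)) (u : E) :
    levi (fun y => ((Real.log (D y).det.re : ℝ) : ℂ)) z u u =
      ((D z)⁻¹ * curvatureMatrix D z u).trace :=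
  levi_log_det hD (hP.mono fun _ hy => hy.det_re_pos.2) hP.self_of_nhds.det_re_pos.1 u u

theorem ddbar_map_I {N : Type*} [NormedAddCommGroup N] [NormedSpace ℂ N] {φ : N → ℂ} {z : N}
    (h : ContDiffAt ℝ 2 φ z) (x y : N) :
    ddbar φ z ![Complex.I • x, Complex.I • y] = ddbar φ z ![x, y] := by
  have hI : ∀ a : ℂ, Complex.I * (Complex.I * a) = -a := fun a => by
    rw [← mul_assoc, Complex.I_mul_I, neg_one_mul]
  rw [ddbar_apply h, ddbar_apply h]
  simp [hI]

theorem contDiffAt_log_affineForm {w : Fin m → ℂ}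
    (hD : ∀ i j, ContDiffAt ℝ 2 (fun y => D y i j) z) (hP : PosHerm (D z)) :
    ContDiffAt ℝ 2 (fun q => ((Real.log (affineForm D q).re : ℝ) : ℂ)) (z, w) :=
  contDiffAt_log_re (contDiffAt_affineForm hD) (hP.pos _ (cons_one_ne_zero w))

/-- The Levi determinant of the logarithm of a hermitian form in the direction of a horizontal
vector and of the fibres. -/
theorem det_levi_log_affineForm (hD : ∀ i j, ContDiffAt ℝ 2 (fun y => D y i j) z)
    (hP : ∀ᶠ y in 𝓝 z, PosHerm (D y)) (u : E) (w : Fin m → ℂ) :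
    (Matrix.of fun j k => levi (fun q => ((Real.log (affineForm D q).re : ℝ) : ℂ)) (z, w)
      ((Fin.cons (u, 0) fun k => (0, Pi.single k 1) : Fin (m + 1) → E × (Fin m → ℂ)) j)
      ((Fin.cons (u, 0) fun k => (0, Pi.single k 1) : Fin (m + 1) → E × (Fin m → ℂ)) k)).det =
    (D z).det * (sesqValue (curvatureMatrix D z u) (Fin.cons 1 w) /
      sesqValue (D z) (Fin.cons 1 w) ^ (m + 2)) := by
  have hPz := hP.self_of_nhds
  set v : Fin (m + 1) → E × (Fin m → ℂ) := Fin.cons (u, 0) fun k => (0, Pi.single k 1) with hv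
  have hr : ∀ᶠ q in 𝓝 (z, w), affineForm D q = ((affineForm D q).re : ℂ) := by
    filter_upwards [continuousAt_fst.eventually hP] with q hq using sesqValue_eq_re hq.conj_apply _
  have hpos := hPz.pos _ (cons_one_ne_zero w)
  have hq : sesqValue (D z) (Fin.cons 1 w) ≠ 0 := hPz.sesqValue_ne_zero (cons_one_ne_zero w)
  -- The subtracted product of first derivatives is the rank-one correction treated by
  -- `det_bordered`.
  have hL : ∀ j k, levi (fun q => ((Real.log (affineForm D q).re : ℝ) : ℂ)) (z, w) (v j) (v k) =
      levi (affineForm D) (z, w) (v j) (v k) / sesqValue (D z) (Fin.cons 1 w) -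
        del (affineForm D) (z, w) (v j) * dbar (affineForm D) (z, w) (v k) /
          sesqValue (D z) (Fin.cons 1 w) ^ 2 := fun j k =>
    levi_log (contDiffAt_affineForm (p := (z, w)) hD) hr hpos _ _
  simp only [hL]
  have hval : ∀ T : Matrix (Fin (m + 1)) (Fin (m + 1)) ℂ, ∀ W V : Fin (m + 1) → ℂ,
      dotProduct W (T.mulVec V) = ∑ a, ∑ b, W a * V b * T a b := fun T W V => by
    simp only [dotProduct, Matrix.mulVec, Finset.mul_sum]
    exact Finset.sum_congr rfl fun _ _ => Finset.sum_congr rfl fun _ _ => by ring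
  have hder := fun u v => affineForm_derivatives (p := (z, w)) hD u v
  have v0 : v 0 = (u, 0) := rfl
  have vs : ∀ k : Fin m, v k.succ = (0, Pi.single k 1) := fun k => rfl
  have c0 : (Fin.cons 0 (0 : Fin m → ℂ) : Fin (m + 1) → ℂ) = 0 := by
    funext a; refine Fin.cases ?_ (fun k => ?_) a <;> simp
  have cs : ∀ k : Fin m, (Fin.cons 0 (Pi.single k 1 : Fin m → ℂ) : Fin (m + 1) → ℂ) =
      Pi.single k.succ 1 := fun k => by
    funext a
    refine Fin.cases ?_ (fun l => ?_) a
    · simp [(Fin.succ_ne_zero k).symm]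
    · simp [Pi.single_apply]
  have hdel0 : ∀ φ : E → ℂ, del φ z 0 = 0 := fun φ => by simp [del]
  have hs : ∀ (k : Fin (m + 1)) (a : Fin (m + 1)), conj ((Pi.single k 1 : Fin (m + 1) → ℂ) a) =
      if a = k then 1 else 0 := fun k a => by
    rw [Pi.single_apply]; split_ifs <;> simp
  have hs' : ∀ (k : Fin (m + 1)) (a : Fin (m + 1)), ((Pi.single k 1 : Fin (m + 1) → ℂ) a) =
      if a = k then 1 else 0 := fun k a => by rw [Pi.single_apply]
  -- Index `0` is the horizontal direction `u`, and the others are the fibre coordinates. The vector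
  -- `V` is the conjugate of `W = (1, w)`.
  have key := det_levi_matrix (D z) (Matrix.of fun i j => del (fun y => D y i j) z u)
    (Matrix.of fun i j => dbar (fun y => D y i j) z u)
    (Matrix.of fun i j => levi (fun y => D y i j) z u u) hPz.det_ne_zero
    (Fin.cons 1 w) (fun b => conj ((Fin.cons 1 w : Fin (m + 1) → ℂ) b)) rfl (by simp)
    (sesqValue (D z) (Fin.cons 1 w)) hq (by rw [hval]; rfl)
    (Matrix.of fun j k => levi (affineForm D) (z, w) (v j) (v k))
    (fun k => dbar (affineForm D) (z, w) (v k)) (fun j => del (affineForm D) (z, w) (v j))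
    (by rw [hval, v0, (hder 0 _).2.1]; simp [c0])
    (by rw [hval, v0, (hder _ 0).1]; simp [c0])
    (fun k => by
      simp only [vs, (hder 0 _).2.1, cs, map_zero, mul_zero, add_zero, hs, mul_ite, ite_mul,
        mul_one, zero_mul, Finset.sum_ite_eq', Finset.mem_univ, if_true]
      rfl)
    (fun k => by
      simp only [vs, (hder _ 0).1, cs, hdel0, mul_zero, add_zero, hs', ite_mul, one_mul, zero_mul]
      rw [Finset.sum_comm]
      simp only [Finset.sum_ite_eq', Finset.mem_univ, if_true]
      exact Finset.sum_congr rfl fun _ _ => mul_comm _ _)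
    (by rw [hval, Matrix.of_apply, v0, (hder _ _).2.2]; simp [c0])
    (fun k => by
      simp only [Matrix.of_apply, vs, v0, (hder _ _).2.2, cs, c0, map_zero, mul_zero, add_zero, hs,
        mul_ite, ite_mul, mul_one, zero_mul, zero_add, Pi.zero_apply, Finset.sum_ite_eq',
        Finset.mem_univ, if_true, ite_self]
      rfl)
    (fun k => by
      simp only [Matrix.of_apply, vs, v0, (hder _ _).2.2, cs, c0, map_zero, mul_zero, add_zero, hs',
        hdel0, LinearMap.zero_apply,
        ite_mul, one_mul, zero_mul, zero_add, Pi.zero_apply]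
      rw [Finset.sum_comm]
      simp only [Finset.sum_ite_eq', Finset.mem_univ, if_true]
      exact Finset.sum_congr rfl fun _ _ => mul_comm _ _)
    (fun j k => by
      simp only [Matrix.of_apply, vs, (hder _ _).2.2, cs, map_zero, mul_zero, add_zero, hs',
        hdel0, ite_mul, one_mul, zero_mul,
        Finset.sum_ite_eq', Finset.mem_univ, if_true, Finset.sum_ite_irrel, Finset.sum_const_zero]
      simp [apply_ite (starRingEnd ℂ)])
  rw [← mul_div_assoc, eq_div_iff (pow_ne_zero _ hq), mul_comm]
  refine key.trans ?_
  rw [hval]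
  rfl

/-- The integral over the fibres of the top power of the Fubini–Study form of a family of hermitian
forms is the curvature of the determinant. -/
theorem integral_wedgePow_log_affineForm (hD : ∀ i j, ContDiffAt ℝ 2 (fun y => D y i j) z)
    (hP : ∀ᶠ y in 𝓝 z, PosHerm (D y)) (hc : 2 * (m + 1) = 2 * 1 + 2 * m) (u : Fin (2 * 1) → E) :
    let f : (Fin m → ℂ) → ℂ := fun w =>
      wedgePow ((Complex.I / (2 * Real.pi)) •
        ddbar (fun q => ((Real.log (affineForm D q).re : ℝ) : ℂ)) (z, w)) (m + 1)
      (Fin.append (fun i => ((u i, 0) : E × (Fin m → ℂ))) (fun j => (0, stdRealFrame m j)) ∘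
        Fin.cast hc)
    Integrable f ∧ ∫ w, f w = ((Complex.I / (2 * Real.pi)) •
      ddbar (fun y => ((Real.log (D y).det.re : ℝ) : ℂ)) z) u := by
  intro f
  have hPz := hP.self_of_nhds
  let β : (Fin m → ℂ) → Form (E × (Fin m → ℂ)) 2 := fun w => (Complex.I / (2 * Real.pi)) •
        ddbar (fun q => ((Real.log (affineForm D q).re : ℝ) : ℂ)) (z, w)
  let S : (Fin m → ℂ) → SesqForm (E × (Fin m → ℂ)) := fun w => (Complex.I / (2 * Real.pi)) •
        levi (fun q => ((Real.log (affineForm D q).re : ℝ) : ℂ)) (z, w)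
  have hS : ∀ w x y, β w ![x, y] = S w x y - S w y x := fun w x y => by
    simp only [β, S, AlternatingMap.smul_apply, ddbar_apply (contDiffAt_log_affineForm hD hPz),
      LinearMap.smul_apply, smul_sub]
  have hβI : ∀ w x y, β w ![Complex.I • x, Complex.I • y] = β w ![x, y] := fun w x y => by
    simp only [β, AlternatingMap.smul_apply, ddbar_map_I (contDiffAt_log_affineForm hD hPz)]
  let e : Fin m → E × (Fin m → ℂ) := fun k => (0, Pi.single k 1)
  have he : (fun k => (0, Pi.single k Complex.I) : Fin m → E × (Fin m → ℂ)) =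
      fun k => Complex.I • e k := by
    funext k
    refine Prod.ext (by simp [e]) ?_
    change Pi.single k Complex.I = Complex.I • (Pi.single k 1 : Fin m → ℂ)
    rw [← Pi.single_smul, smul_eq_mul, mul_one]
  -- For each `w` the contracted power is a `2`-form on the base which is invariant under `I`.
  let α : (Fin m → ℂ) → Form E (2 * 1) := fun w =>
    contractForm ((wedgePow (β w) (m + 1)).domDomCongr (finCongr hc))
      ((LinearMap.inl ℂ E (Fin m → ℂ)).restrictScalars ℝ) (fun j => (0, stdRealFrame m j))
  have hα : ∀ w (u : Fin (2 * 1) → E), α w u = wedgePow (β w) (m + 1) (interleave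
      (Fin.cons (u 0, 0) e : Fin (m + 1) → E × (Fin m → ℂ))
      (Fin.cons (u 1, 0) fun k => Complex.I • e k : Fin (m + 1) → E × (Fin m → ℂ))) := by
    intro w u
    rw [← he, ← append_stdRealFrame_eq_interleave hc]
    rfl
  have hαI : ∀ w x y, α w ![Complex.I • x, Complex.I • y] = α w ![x, y] := fun w x y => by
    rw [hα, hα]
    have := map_cons_interleave_I (wedgePow (β w) (m + 1)) (wedgePow_map_I (β w) (hβI w) (m + 1))
      (x, 0) (y, 0) e
    simpa using this
  have hdet : ContDiffAt ℝ 2 (fun y => ((Real.log (D y).det.re : ℝ) : ℂ)) z :=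
    contDiffAt_log_re (contDiffAt_det hD) hPz.det_re_pos.1
  let A : Form E (2 * 1) := (Complex.I / (2 * Real.pi)) •
      ddbar (fun y => ((Real.log (D y).det.re : ℝ) : ℂ)) z
  have hAI : ∀ x y, A ![Complex.I • x, Complex.I • y] = A ![x, y] := fun x y => by
    exact congrArg (fun t => Complex.I / (2 * Real.pi) * t) (ddbar_map_I hdet x y)
  -- By polarization it suffices to integrate on the pairs `x`, `I • x`, where the arguments form a
  -- complex frame together with its multiple by `I`.
  have hdiag : ∀ x : E, Integrable (fun w => α w ![x, Complex.I • x]) ∧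
      ∫ w, α w ![x, Complex.I • x] = A ![x, Complex.I • x] := by
    intro x
    have h1 : ∀ w, α w ![x, Complex.I • x] = ((m + 1).factorial / (Real.pi : ℂ) ^ (m + 1) *
        (D z).det) * (sesqValue (curvatureMatrix D z x) (Fin.cons 1 w) /
          sesqValue (D z) (Fin.cons 1 w) ^ (m + 2)) := by
      intro w
      have h2 : (Fin.cons ((Complex.I • x, 0) : E × (Fin m → ℂ)) fun k => Complex.I • e k :
          Fin (m + 1) → E × (Fin m → ℂ)) = fun k => Complex.I •
            (Fin.cons (x, 0) e : Fin (m + 1) → E × (Fin m → ℂ)) k := by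
        funext k
        refine Fin.cases ?_ (fun k => ?_) k <;> simp
      rw [hα]
      simp only [Matrix.cons_val_zero, Matrix.cons_val_one]
      rw [h2, wedgePow_interleave (β w) (S w) (hS w)]
      have h3 := det_levi_log_affineForm hD hP x w
      have h4 : (Matrix.of fun j k => S w ((Fin.cons (x, 0) e : Fin (m + 1) → E × (Fin m → ℂ)) j)
          ((Fin.cons (x, 0) e : Fin (m + 1) → E × (Fin m → ℂ)) k)) = (Complex.I / (2 * Real.pi)) •
          (Matrix.of fun j k => levi (fun q => ((Real.log (affineForm D q).re : ℝ) : ℂ)) (z, w)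
      ((Fin.cons (x, 0) e : Fin (m + 1) → E × (Fin m → ℂ)) j)
      ((Fin.cons (x, 0) e : Fin (m + 1) → E × (Fin m → ℂ)) k)) := rfl
      rw [h4, Matrix.det_smul, h3, Fintype.card_fin, mul_assoc, ← mul_assoc (_ ^ _) (_ ^ _),
        ← mul_pow]
      -- The factor `-2 I` from the top power and the normalisation `I / 2π` combine to `1 / π` in
      -- each of the `m + 1` dimensions. After integration a single `1 / π` is left.
      have h5 : -2 * Complex.I * (Complex.I / (2 * Real.pi)) = 1 / (Real.pi : ℂ) := by
        have : (Real.pi : ℂ) ≠ 0 := by exact_mod_cast Real.pi_ne_zero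
        field_simp
        rw [Complex.I_sq]
        ring
      rw [h5]
      ring
    have h2 := integral_sesqValue_div hPz (conj_curvatureMatrix hD hP x)
    simp only [h1]
    refine ⟨h2.1.const_mul _, ?_⟩
    rw [integral_const_mul, h2.2, ← levi_log_det_eq_trace hD hP]
    -- On `x`, `I • x` the form `A` is `1 / π` times the Levi form of `log det D` at `(x, x)`, that
    -- is, the trace above.
    have h3 : A ![x, Complex.I • x] = (Complex.I / (2 * Real.pi)) *
      (levi (fun y => ((Real.log (D y).det.re : ℝ) : ℂ)) z x (Complex.I • x) -
       levi (fun y => ((Real.log (D y).det.re : ℝ) : ℂ)) z (Complex.I • x) x) := by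
      rw [← ddbar_apply hdet]
      rfl
    rw [h3]
    simp only [map_smul, LinearMap.map_smulₛₗ, LinearMap.smul_apply, smul_eq_mul, Complex.conj_I]
    have : (Real.pi : ℂ) ≠ 0 := by exact_mod_cast Real.pi_ne_zero
    have := hPz.det_ne_zero
    have := Nat.factorial_ne_zero (m + 1)
    field_simp
    rw [Complex.I_sq]
    ring
  have hf : f = fun w => (1 / 4 : ℂ) *
      (α w ![u 0 - Complex.I • u 1, Complex.I • (u 0 - Complex.I • u 1)] -
        α w ![u 0 + Complex.I • u 1, Complex.I • (u 0 + Complex.I • u 1)]) := by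
    funext w
    rw [← polarization_of_invariant (α w) (hαI w), ← form_two_apply_eq (α w) u]
    rfl
  have hA := polarization_of_invariant A hAI (u 0) (u 1)
  have h1 := hdiag (u 0 - Complex.I • u 1)
  have h2 := hdiag (u 0 + Complex.I • u 1)
  rw [hf]
  refine ⟨(h1.1.sub h2.1).const_mul _, ?_⟩
  rw [integral_const_mul, integral_sub h1.1 h2.1, h1.2, h2.2, ← hA]
  exact (form_two_apply_eq A u).symm

end Core

/-! ### Dual norms and exterior powers of hermitian vector spaces -/

section DualNorm

variable {W : Type*} [AddCommGroup W] [Module ℂ W]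

theorem norm_sesqForm_sq_le {H : SesqForm W} (hs : ∀ v w, conj (H v w) = H w v)
    (hp : ∀ v, 0 ≤ (H v v).re) (v w : W) : ‖H w v‖ ^ 2 ≤ (H w w).re * (H v v).re := by
  -- The arguments are exchanged because `inner` is antilinear in the first one.
  let c : PreInnerProductSpace.Core ℂ W :=
    { inner := fun x y => H y x
      conj_inner_symm := fun x y => hs x y
      re_inner_nonneg := hp
      add_left := fun x y z => map_add _ _ _
      smul_left := fun x y r => by simp }
  have h := InnerProductSpace.Core.inner_mul_inner_self_le (𝕜 := ℂ) v w
  change ‖H w v‖ * ‖H v w‖ ≤ (H v v).re * (H w w).re at h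
  rw [← hs w v, Complex.norm_conj, ← pow_two] at h
  rwa [mul_comm]

/-- Cauchy–Schwarz, with equality at the representing vector. Semidefiniteness suffices, as a
quotient by zero has the value `0`. -/
theorem dualNormSq_eq_of_riesz {H : SesqForm W} (hs : ∀ v w, conj (H v w) = H w v)
    (hp : ∀ v, 0 ≤ (H v v).re) {f : Module.Dual ℂ W} {v : W} (hf : ∀ w, f w = H w v) :
    dualNormSq H f = (H v v).re := by
  have hle : ∀ w, ‖f w‖ ^ 2 / (H w w).re ≤ (H v v).re := fun w => by
    rw [hf]
    exact div_le_of_le_mul₀ (hp w) (hp v) (by rw [mul_comm]; exact norm_sesqForm_sq_le hs hp v w)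
  apply le_antisymm
  · exact Real.iSup_le (fun w => hle w) (hp v)
  · by_cases hv : v = 0
    -- Here `v` is not an admissible test vector, but the supremum of nonnegative numbers is
    -- nonnegative.
    · subst hv
      simp only [map_zero, Complex.zero_re]
      refine Real.iSup_nonneg fun w => div_nonneg (sq_nonneg _) (hp _)
    · refine le_trans ?_ (le_ciSup (f := fun w : {v : W // v ≠ 0} => ‖f w‖ ^ 2 / (H w w).re)
        ⟨(H v v).re, ?_⟩ ⟨v, hv⟩)
      · have h1 : H v v = ((H v v).re : ℂ) := (Complex.conj_eq_iff_re.1 (hs v v)).symm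
        dsimp only
        rw [hf, h1, Complex.norm_real, Complex.ofReal_re, Real.norm_eq_abs, sq_abs]
        by_cases h0 : (H v v).re = 0
        · simp [h0]
        · rw [pow_two, mul_div_assoc, div_self h0, mul_one]
      · rintro _ ⟨w, rfl⟩
        exact hle w

theorem sesqForm_sum_smul {ι : Type*} [Fintype ι] (H : SesqForm W) (b : ι → W) (x y : ι → ℂ) :
    H (∑ i, x i • b i) (∑ j, y j • b j) = ∑ i, ∑ j, x i * conj (y j) * H (b i) (b j) := by
  simp only [map_sum, LinearMap.sum_apply, map_smul, LinearMap.smul_apply, LinearMap.map_smulₛₗ,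
    smul_eq_mul, Finset.mul_sum]
  rw [Finset.sum_comm]
  exact Finset.sum_congr rfl fun _ _ => Finset.sum_congr rfl fun _ _ => by ring

theorem sesqForm_eq_sum_repr {ι : Type*} [Fintype ι] [DecidableEq ι] {H : SesqForm W}
    (b : Module.Basis ι ℂ W) (hb : ∀ i j, H (b i) (b j) = if i = j then 1 else 0) (x y : W) :
    H x y = ∑ i, b.repr x i * conj (b.repr y i) := by
  conv_lhs => rw [← b.sum_repr x, ← b.sum_repr y, sesqForm_sum_smul]
  simp [hb]

theorem sesqForm_hermitian_of_orthonormal {ι : Type*} [Fintype ι] [DecidableEq ι] {H : SesqForm W}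
    (b : Module.Basis ι ℂ W) (hb : ∀ i j, H (b i) (b j) = if i = j then 1 else 0) :
    (∀ v w, conj (H v w) = H w v) ∧ ∀ v, 0 ≤ (H v v).re := by
  refine ⟨fun v w => ?_, fun v => ?_⟩
  · simp only [sesqForm_eq_sum_repr b hb, map_sum, map_mul, Complex.conj_conj]
    exact Finset.sum_congr rfl fun _ _ => mul_comm _ _
  · rw [sesqForm_eq_sum_repr b hb, Complex.re_sum]
    refine Finset.sum_nonneg fun i _ => ?_
    rw [Complex.mul_conj, Complex.ofReal_re]
    exact Complex.normSq_nonneg _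

theorem exists_orthonormal_basis {n : ℕ} (hn : Module.finrank ℂ W = n + 1) {H : SesqForm W}
    (hs : ∀ v w, conj (H v w) = H w v) (hp : ∀ v, v ≠ 0 → 0 < (H v v).re) {v : W} (hv : v ≠ 0) :
    ∃ b : Module.Basis (Fin (n + 1)) ℂ W, (∀ i j, H (b i) (b j) = if i = j then 1 else 0) ∧
      ∃ c : ℂ, v = c • b 0 := by
  have hp' : ∀ v, 0 ≤ (H v v).re := fun v => by
    by_cases h : v = 0
    · simp [h]
    · exact (hp v h).le
  let c : InnerProductSpace.Core ℂ W :=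
    { inner := fun x y => H y x
      conj_inner_symm := fun x y => hs x y
      re_inner_nonneg := hp'
      add_left := fun x y z => map_add _ _ _
      smul_left := fun x y r => by simp
      definite := fun x hx => by
        by_contra h
        have h1 := hp x h
        change H x x = 0 at hx
        simp [hx] at h1 }
  let _ : NormedAddCommGroup W := InnerProductSpace.Core.toNormedAddCommGroup (𝕜 := ℂ)
  let _ : InnerProductSpace ℂ W := InnerProductSpace.ofCore c.toCore
  have : FiniteDimensional ℂ W := Module.finite_of_finrank_eq_succ hn
  let u : Fin (n + 1) → W := fun _ => ((‖v‖ : ℂ)⁻¹) • v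
  have hu : Orthonormal ℂ (({0} : Set (Fin (n + 1))).domRestrict u) := by
    refine ⟨fun i => ?_, fun i j hij => ?_⟩
    · change ‖((‖v‖ : ℂ)⁻¹) • v‖ = 1
      rw [norm_smul, norm_inv, Complex.norm_real, norm_norm, inv_mul_cancel₀ (norm_ne_zero_iff.2 hv)]
    · exact absurd (Subtype.ext (i.2.trans (Eq.symm j.2))) hij
  obtain ⟨b, hb⟩ := hu.exists_orthonormalBasis_extension_of_card_eq (by simp [hn])
  refine ⟨b.toBasis, fun i j => ?_, (‖v‖ : ℂ), ?_⟩
  · have := orthonormal_iff_ite.1 b.orthonormal j i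
    rw [OrthonormalBasis.coe_toBasis]
    exact this.trans (by simp only [eq_comm])
  · rw [OrthonormalBasis.coe_toBasis, hb 0 rfl]
    have : (‖v‖ : ℂ) ≠ 0 := by exact_mod_cast norm_ne_zero_iff.2 hv
    simp [u, smul_smul, this]

end DualNorm

/-! ### Gram matrices and the dual norm -/

section Gram

variable {V : Type*} [AddCommGroup V] [Module ℂ V] {n : ℕ}

/-- The Gram matrix of a family of vectors. -/
def gram {ι : Type*} (H : SesqForm V) (e : ι → V) : Matrix ι ι ℂ := Matrix.of fun i j => H (e i) (e j)

theorem sesqValue_gram {ι : Type*} [Fintype ι] (H : SesqForm V) (e : ι → V) (x : ι → ℂ) :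
    sesqValue (gram H e) x = H (∑ i, x i • e i) (∑ i, x i • e i) :=
  (sesqForm_sum_smul H e x x).symm

theorem posHerm_gram {ι : Type*} [Fintype ι] {H : SesqForm V} (hs : ∀ v w, conj (H v w) = H w v)
    (hp : ∀ v, v ≠ 0 → 0 < (H v v).re) {e : ι → V} (he : LinearIndependent ℂ e) :
    PosHerm (gram H e) := by
  refine ⟨fun a b => hs _ _, fun x hx => ?_⟩
  rw [sesqValue_gram]
  exact hp _ fun h => hx (funext (Fintype.linearIndependent_iff.1 he x h))

theorem gram_sum_smul {ι κ : Type*} [Fintype ι] [Fintype κ] (H : SesqForm V) (e : ι → V)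
    (g : Matrix κ ι ℂ) :
    gram H (fun a => ∑ i, g a i • e i) = g * gram H e * g.conjTranspose := by
  ext a b
  simp only [gram, Matrix.of_apply, sesqForm_sum_smul, Matrix.mul_apply, Finset.sum_mul,
    Matrix.conjTranspose_apply, RCLike.star_def]
  rw [Finset.sum_comm]
  exact Finset.sum_congr rfl fun _ _ => Finset.sum_congr rfl fun _ _ => by ring

/-- For a holomorphic change of frame the factor `|det g|²` has a pluriharmonic logarithm, so `∂∂̄
log det` of the Gram matrix does not see the frame. -/
theorem det_gram_sum_smul {ι : Type*} [Fintype ι] [DecidableEq ι] (H : SesqForm V) (e : ι → V)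
    (g : Matrix ι ι ℂ) :
    (gram H (fun a => ∑ i, g a i • e i)).det = ((‖g.det‖ ^ 2 : ℝ) : ℂ) * (gram H e).det := by
  rw [gram_sum_smul, Matrix.det_mul, Matrix.det_mul, Matrix.det_conjTranspose, RCLike.star_def,
    mul_right_comm, Complex.mul_conj, Complex.normSq_eq_norm_sq]

/-- The dual norm of a functional which vanishes on all vectors of a basis but the first. -/
theorem dualNormSq_eq_det_div_det {H : SesqForm V} (hs : ∀ v w, conj (H v w) = H w v)
    (hp : ∀ v, v ≠ 0 → 0 < (H v v).re) (e : Module.Basis (Fin (n + 1)) ℂ V)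
    {f : Module.Dual ℂ V} (hf : ∀ j : Fin n, f (e j.succ) = 0) :
    dualNormSq H f = ‖f (e 0)‖ ^ 2 *
      ((gram H fun j : Fin n => e j.succ).det.re / (gram H e).det.re) := by
  have hp' : ∀ v, 0 ≤ (H v v).re := fun v => by
    by_cases h : v = 0
    · simp [h]
    · exact (hp v h).le
  have hG := posHerm_gram hs hp e.linearIndependent
  have hGK := posHerm_gram hs hp (e.linearIndependent.comp _ (Fin.succ_injective n))
  set G := gram H e with hGdef
  set c := f (e 0) with hc
  -- Column `0` of the inverse Gram matrix solves the linear system for the vector which represents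
  -- `f`.
  let x : Fin (n + 1) → ℂ := fun i => c * G⁻¹ i 0
  let v : V := ∑ i, conj (x i) • e i
  have hv : ∀ w, f w = H w v := by
    intro w
    have : f = H.flip v := by
      refine e.ext fun j => ?_
      have h1 : H.flip v (e j) = ∑ i, G j i * x i := by
        rw [LinearMap.flip_apply]
        simp only [v, map_sum, LinearMap.map_smulₛₗ, Complex.conj_conj,
          smul_eq_mul]
        exact Finset.sum_congr rfl fun _ _ => mul_comm _ _
      have h2 : ∑ i, G j i * x i = c * (G * G⁻¹) j 0 := by
        simp only [x, Matrix.mul_apply, Finset.mul_sum]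
        exact Finset.sum_congr rfl fun _ _ => by ring
      rw [h1, h2, Matrix.mul_nonsing_inv _ (isUnit_iff_ne_zero.2 hG.det_ne_zero)]
      refine Fin.cases ?_ (fun j => ?_) j
      · simp [hc]
      · rw [hf, Matrix.one_apply_ne (Fin.succ_ne_zero j), mul_zero]
    rw [this, LinearMap.flip_apply]
  rw [dualNormSq_eq_of_riesz hs hp' hv, ← hv]
  have h0 : f v = conj (x 0) * c := by
    simp only [v, map_sum, map_smul, smul_eq_mul]
    rw [Fin.sum_univ_succ]
    simp [hf, hc]
  -- Cramer's rule: the cofactor at `(0, 0)` is the Gram determinant of the remaining basis vectors.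
  have hadj : G⁻¹ 0 0 = (gram H fun j : Fin n => e j.succ).det / G.det := by
    rw [Matrix.inv_def, Matrix.smul_apply, Matrix.adjugate_fin_succ_eq_det_submatrix,
      Ring.inverse_eq_inv', smul_eq_mul, inv_mul_eq_div]
    simp [hGdef, gram, Matrix.submatrix]
  have hr : ((gram H fun j : Fin n => e j.succ).det / G.det) =
      (((gram H fun j : Fin n => e j.succ).det.re / G.det.re : ℝ) : ℂ) := by
    rw [hG.det_re_pos.2, Complex.ofReal_div]
    congr 1
    exact hGK.det_re_pos.2
  rw [h0]
  simp only [x, hadj, hr, map_mul, Complex.conj_ofReal]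
  rw [mul_right_comm, mul_comm (conj c), Complex.mul_conj, Complex.normSq_eq_norm_sq,
    ← Complex.ofReal_mul, Complex.ofReal_re]

end Gram

/-! ### The isometry between `⋀^n V` and `V* ⊗ det V` for `dim V = n + 1` -/

section Exterior

variable {V : Type*} [AddCommGroup V] [Module ℂ V] {n : ℕ}

/-- The functional `w₁ ∧ … ∧ w_n ↦ det(v, w₁, …, w_n)` in the coordinates of a basis. -/
def detFunctional (e : Module.Basis (Fin (n + 1)) ℂ V) : V →ₗ[ℂ] Module.Dual ℂ (⋀[ℂ]^n V) :=
  (exteriorPower.alternatingMapLinearEquiv (R := ℂ) (M := V) (N := ℂ) (n := n)).toLinearMap ∘ₗ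
    AlternatingMap.curryLeft e.det

theorem detFunctional_ιMulti (e : Module.Basis (Fin (n + 1)) ℂ V) (v : V) (w : Fin n → V) :
    detFunctional e v (exteriorPower.ιMulti ℂ n w) = e.det (Fin.cons v w) := by
  simp only [detFunctional, LinearMap.comp_apply, LinearEquiv.coe_coe,
    exteriorPower.alternatingMapLinearEquiv_apply_ιMulti]
  rfl

/-- The exterior products of an orthonormal basis are orthonormal for the induced form. -/
theorem exteriorForm_hermitian {H : SesqForm V} {ι : Type*} [Fintype ι] [LinearOrder ι]
    (b : Module.Basis ι ℂ V) (hb : ∀ i j, H (b i) (b j) = if i = j then 1 else 0) (n : ℕ) :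
    (∀ x y, conj (exteriorForm H n x y) = exteriorForm H n y x) ∧
      ∀ x, 0 ≤ (exteriorForm H n x x).re := by
  classical
  refine sesqForm_hermitian_of_orthonormal (b.exteriorPower n) fun s t => ?_
  have h := exteriorPower.ιMultiDual_apply_ιMulti ℂ n b t
    (b ∘ Set.powersetCard.ofFinEmbEquiv.symm s)
  have h2 : exteriorForm H n (b.exteriorPower n s) (b.exteriorPower n t) =
      exteriorPower.ιMultiDual ℂ n b t (exteriorPower.ιMulti_family ℂ n b s) := by
    simp only [exteriorPower.coe_basis, exteriorPower.ιMulti_family]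
    rw [exteriorForm_apply, h]
    congr 1
    ext i j
    simp [hb, Finsupp.single_apply]
  rw [h2]
  split_ifs with hst
  · rw [hst, exteriorPower.ιMultiDual_apply_diag]
  · exact exteriorPower.ιMultiDual_apply_nondiag ℂ n b t s (Ne.symm hst)

/-- In an orthonormal basis `b` with `v = c b_0` the functional is `c · det_e(b)` times the pairing
with the unit vector `b_1 ∧ … ∧ b_n`. Comparing Gram determinants gives `|det_e(b)|² = 1 / det (gram
H e)`. -/
theorem dualNormSq_detFunctional {H : SesqForm V} (hs : ∀ v w, conj (H v w) = H w v)
    (hp : ∀ v, v ≠ 0 → 0 < (H v v).re) (e : Module.Basis (Fin (n + 1)) ℂ V) (v : V) :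
    dualNormSq (exteriorForm H n) (detFunctional e v) = (H v v).re / (gram H e).det.re := by
  by_cases hv : v = 0
  · subst hv
    simp [dualNormSq]
  obtain ⟨b, hb, c, hc⟩ := exists_orthonormal_basis (Module.finrank_eq_card_basis e |>.trans
    (Fintype.card_fin _)) hs hp hv
  obtain ⟨h1, h2⟩ := exteriorForm_hermitian b hb n
  set y := exteriorPower.ιMulti ℂ n (fun i : Fin n => b i.succ) with hy
  have hΦ : ∀ x, detFunctional e v x = exteriorForm H n x (conj (c * e.det b) • y) := by
    intro x
    have : detFunctional e v = (exteriorForm H n).flip (conj (c * e.det b) • y) := by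
      apply exteriorPower.linearMap_ext
      ext w
      rw [LinearMap.compAlternatingMap_apply, LinearMap.compAlternatingMap_apply,
        LinearMap.flip_apply, LinearMap.map_smulₛₗ, Complex.conj_conj, smul_eq_mul,
        detFunctional_ιMulti, hy, exteriorForm_apply, hc]
      have h3 : e.det = e.det b • b.det := e.det.eq_smul_basis_det b
      have h4 : (Fin.cons (c • b 0) w : Fin (n + 1) → V) =
          Function.update (Fin.cons (b 0) w) 0 (c • b 0) := by simp
      rw [h4, AlternatingMap.map_update_smul]
      have h5 : Function.update (Fin.cons (b 0) w : Fin (n + 1) → V) 0 (b 0) =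
        Fin.cons (b 0) w := by simp
      rw [h5, smul_eq_mul, mul_assoc]
      congr 1
      conv_lhs => rw [h3]
      rw [AlternatingMap.smul_apply, smul_eq_mul]
      congr 1
      -- The first column is that of `b 0`, so a single minor is left. Its entries are the pairings
      -- of the `w j` with `b 1, …, b n`.
      rw [Module.Basis.det_apply, Matrix.det_succ_column_zero, Fin.sum_univ_succ]
      have h6 : ∀ i : Fin n, b.toMatrix (Fin.cons (b 0) w) i.succ 0 = 0 := fun i => by
        simp [Module.Basis.toMatrix_apply]
      have h7 : b.toMatrix (Fin.cons (b 0) w) 0 0 = 1 := by simp [Module.Basis.toMatrix_apply]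
      simp only [h6, h7, mul_zero, zero_mul, Finset.sum_const_zero, add_zero]
      simp only [Fin.val_zero, pow_zero, one_mul]
      rw [← Matrix.det_transpose]
      congr 1
      ext i j
      simp [Module.Basis.toMatrix_apply, sesqForm_eq_sum_repr b hb, Finsupp.single_apply]
    rw [this, LinearMap.flip_apply]
  rw [dualNormSq_eq_of_riesz h1 h2 hΦ]
  have hyy : exteriorForm H n y y = 1 := by
    rw [hy, exteriorForm_apply]
    have : (Matrix.of fun i j : Fin n => H (b i.succ) (b j.succ)) = 1 := by
      ext i j
      simp [hb, Matrix.one_apply]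
    rw [this, Matrix.det_one]
  have hvv : (H v v).re = ‖c‖ ^ 2 := by
    rw [hc]
    simp only [map_smul, LinearMap.map_smulₛₗ, LinearMap.smul_apply, hb, if_true, smul_eq_mul,
      mul_one]
    rw [mul_comm, Complex.mul_conj, Complex.ofReal_re, Complex.normSq_eq_norm_sq]
  have hdet : ‖e.det b‖ ^ 2 * (gram H e).det.re = 1 := by
    have h8 := det_gram_sum_smul H e (e.toMatrix b).transpose
    have h9 : (fun a => ∑ i, (e.toMatrix b).transpose a i • e i) = b := by
      funext a
      simp
    have h10 : gram H b = 1 := by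
      ext i j
      simp [gram, hb, Matrix.one_apply]
    rw [h9, h10, Matrix.det_one, Matrix.det_transpose, ← Module.Basis.det_apply,
      (posHerm_gram hs hp e.linearIndependent).det_re_pos.2] at h8
    exact_mod_cast h8.symm
  have hG := (posHerm_gram hs hp e.linearIndependent).det_re_pos.1
  simp only [map_smul, LinearMap.map_smulₛₗ, LinearMap.smul_apply, hyy, smul_eq_mul, mul_one,
    Complex.conj_conj]
  rw [Complex.mul_conj, Complex.ofReal_re, Complex.normSq_eq_norm_sq, norm_mul, hvv,
    eq_div_iff hG.ne', mul_pow, mul_assoc, hdet, mul_one]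

end Exterior

/-! ### The dual of the cokernel of the exterior powers -/

section ExtQuot

variable {V : Type*} [AddCommGroup V] [Module ℂ V] {n : ℕ}

/-- Expansion along the column of `v`: with the other columns all basis vectors except `e i`, only
the `i`-th coordinate contributes. -/
theorem detFunctional_succAbove (e : Module.Basis (Fin (n + 1)) ℂ V) (v : V) (i : Fin (n + 1)) :
    detFunctional e v (exteriorPower.ιMulti ℂ n fun j => e (i.succAbove j)) =
      (-1) ^ (i : ℕ) * e.repr v i := by
  rw [detFunctional_ιMulti, Module.Basis.det_apply, Matrix.det_succ_column_zero,
    Finset.sum_eq_single i]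
  · have : ((e.toMatrix (Fin.cons v fun j => e (i.succAbove j) : Fin (n + 1) → V)).submatrix
        i.succAbove Fin.succ) = 1 := by
      ext a b
      simp [Module.Basis.toMatrix_apply, Matrix.one_apply, Finsupp.single_apply, eq_comm]
    rw [this, Matrix.det_one, mul_one]
    simp [Module.Basis.toMatrix_apply]
  · intro j _ hj
    obtain ⟨k, hk⟩ := Fin.exists_succAbove_eq (Ne.symm hj)
    rw [Matrix.det_eq_zero_of_row_eq_zero k, mul_zero]
    intro l
    rw [Matrix.submatrix_apply, hk]
    simp [Module.Basis.toMatrix_apply]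
  · simp

theorem detFunctional_injective (e : Module.Basis (Fin (n + 1)) ℂ V) :
    Function.Injective (detFunctional e) := by
  refine (injective_iff_map_eq_zero _).2 fun v hv => e.ext_elem fun i => ?_
  have := detFunctional_succAbove e v i
  rw [hv, LinearMap.zero_apply, eq_comm, mul_eq_zero] at this
  simpa using this

/-- Both spaces have dimension `n + 1`. -/
theorem detFunctional_surjective (e : Module.Basis (Fin (n + 1)) ℂ V) :
    Function.Surjective (detFunctional e) := by
  have : Module.Finite ℂ V := Module.Finite.of_basis e
  have : Module.Finite ℂ (⋀[ℂ]^n V) := Module.Finite.of_basis (e.exteriorPower n)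
  refine (LinearMap.injective_iff_surjective_of_finrank_eq_finrank ?_).1 (detFunctional_injective e)
  rw [Subspace.dual_finrank_eq, exteriorPower.finrank_eq, Module.finrank_eq_card_basis e]
  simp

theorem eq_detFunctional (e : Module.Basis (Fin (n + 1)) ℂ V) (Φ : Module.Dual ℂ (⋀[ℂ]^n V)) :
    Φ = detFunctional e (∑ i : Fin (n + 1), ((-1) ^ (i : ℕ) *
      Φ (exteriorPower.ιMulti ℂ n fun j => e (i.succAbove j))) • e i) := by
  obtain ⟨v, rfl⟩ := detFunctional_surjective e Φ
  congr 1
  conv_lhs => rw [← e.sum_repr v]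
  refine Finset.sum_congr rfl fun i _ => ?_
  rw [detFunctional_succAbove, ← mul_assoc, ← mul_pow]
  simp

variable {F : Type*} [AddCommGroup F] [Module ℂ F] (q : V →ₗ[ℂ] F)

theorem extQuotMap_eq_zero {w : Fin n → V} (hw : ∀ i, q (w i) = 0) :
    extQuotMap n q (exteriorPower.ιMulti ℂ n w) = 0 := by
  refine (Submodule.Quotient.mk_eq_zero _).2
    ⟨exteriorPower.ιMulti ℂ n fun i => (⟨w i, hw i⟩ : LinearMap.ker q), ?_⟩
  rw [exteriorPower.map_apply_ιMulti]
  rfl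

/-- The coefficients with respect to `e₁, …, e_n` of the vector which represents a functional on the
cokernel. -/
def extCoeff (e : Fin (n + 1) → V) (Φ : Module.Dual ℂ (ExtQuot n q)) (j : Fin n) : ℂ :=
  (-1) ^ (j.succ : ℕ) * Φ (extQuotMap n q (exteriorPower.ιMulti ℂ n fun i => e (j.succ.succAbove i)))

/-- A functional from the cokernel kills `e_1 ∧ … ∧ e_n`, which lies in `⋀^n Ker q`. This value is
the coefficient of `e 0`, so the representing vector lies in `Ker q`. -/
theorem comp_extQuotMap_eq (e : Module.Basis (Fin (n + 1)) ℂ V) (hq : ∀ j : Fin n, q (e j.succ) = 0)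
    (Φ : Module.Dual ℂ (ExtQuot n q)) :
    Φ ∘ₗ extQuotMap n q = detFunctional e (∑ j : Fin n, extCoeff q e Φ j • e j.succ) := by
  conv_lhs => rw [eq_detFunctional e (Φ ∘ₗ extQuotMap n q)]
  rw [Fin.sum_univ_succ]
  congr 1
  rw [LinearMap.comp_apply, extQuotMap_eq_zero q (fun j => by simpa using hq j)]
  simp only [map_zero, mul_zero, zero_smul, zero_add]
  rfl

/-- The functional on the cokernel which is defined by a vector of the kernel of `q`. -/
def extCoframe (e : Module.Basis (Fin (n + 1)) ℂ V) (hq : ∀ j : Fin n, q (e j.succ) = 0)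
    (h0 : q (e 0) ≠ 0) (j : Fin n) : Module.Dual ℂ (ExtQuot n q) :=
  Submodule.liftQ _ (detFunctional e (e j.succ)) (by
    have hcoord : ∀ v, q v = 0 → e.repr v 0 = 0 := fun v hv => by
      rw [← e.sum_repr v, Fin.sum_univ_succ, map_add, map_sum] at hv
      simpa [hq, h0] using hv
    rw [LinearMap.range_le_ker_iff]
    apply exteriorPower.linearMap_ext
    ext w
    simp only [LinearMap.compAlternatingMap_apply, LinearMap.comp_apply,
      exteriorPower.map_apply_ιMulti, detFunctional_ιMulti, LinearMap.zero_apply,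
      Module.Basis.det_apply]
    -- All `n + 1` columns lie in `Ker q`, so their coordinates along `e 0` vanish.
    refine Matrix.det_eq_zero_of_row_eq_zero 0 fun k => ?_
    rw [Module.Basis.toMatrix_apply]
    refine hcoord _ ?_
    refine Fin.cases (hq j) (fun i => ?_) k
    simp)

variable (e : Module.Basis (Fin (n + 1)) ℂ V) (hq : ∀ j : Fin n, q (e j.succ) = 0)
  (h0 : q (e 0) ≠ 0)

theorem extCoframe_extQuotMap (j : Fin n) (x : ⋀[ℂ]^n V) :
    extCoframe q e hq h0 j (extQuotMap n q x) = detFunctional e (e j.succ) x :=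
  Submodule.liftQ_apply _ _ _

theorem linearIndependent_extCoframe : LinearIndependent ℂ (extCoframe q e hq h0) := by
  have h1 : LinearIndependent ℂ (fun j : Fin n => detFunctional e (e j.succ)) :=
    (e.linearIndependent.comp _ (Fin.succ_injective n)).map' _
      (LinearMap.ker_eq_bot.2 (detFunctional_injective e))
  refine LinearIndependent.of_comp (LinearMap.lcomp ℂ ℂ (extQuotMap n q)) ?_
  convert h1 using 1
  funext j
  ext x
  exact extCoframe_extQuotMap q e hq h0 j _

theorem span_extCoframe : ⊤ ≤ Submodule.span ℂ (Set.range (extCoframe q e hq h0)) := by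
  rintro Φ -
  have : Φ = ∑ j, extCoeff q e Φ j • extCoframe q e hq h0 j := by
    refine LinearMap.ext fun x => ?_
    obtain ⟨x, rfl⟩ := Submodule.mkQ_surjective _ x
    have h := LinearMap.congr_fun (comp_extQuotMap_eq q e hq Φ) x
    refine h.trans ?_
    simp only [map_sum, map_smul, LinearMap.sum_apply, LinearMap.smul_apply]
    exact Finset.sum_congr rfl fun j _ => congrArg _ (extCoframe_extQuotMap q e hq h0 j x).symm
  rw [this]
  exact Submodule.sum_mem _ fun j _ => Submodule.smul_mem _ _ (Submodule.subset_span ⟨j, rfl⟩)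

variable {q e}

/-- The dual norm on the cokernel in terms of a basis `e` of `V`. -/
theorem dualNormSq_comp_extQuotMap (hq : ∀ j : Fin n, q (e j.succ) = 0) {H : SesqForm V} (hs : ∀ v w, conj (H v w) = H w v)
    (hp : ∀ v, v ≠ 0 → 0 < (H v v).re) {κ : Type*} [Fintype κ] (Φ : κ → Module.Dual ℂ (ExtQuot n q))
    (x : κ → ℂ) :
    dualNormSq (exteriorForm H n) ((∑ a, x a • Φ a) ∘ₗ extQuotMap n q) =
      (sesqValue (((gram H e).det.re : ℂ)⁻¹ •
        gram H (fun a => ∑ j : Fin n, extCoeff q e (Φ a) j • e j.succ)) x).re := by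
  have h1 : (∑ a, x a • Φ a) ∘ₗ extQuotMap n q = detFunctional e
      (∑ a, x a • ∑ j : Fin n, extCoeff q e (Φ a) j • e j.succ) := by
    rw [map_sum]
    simp only [map_smul, ← comp_extQuotMap_eq q e hq]
    ext
    simp
  rw [h1, dualNormSq_detFunctional hs hp, ← sesqValue_gram]
  have h2 : ∀ c : ℂ, ∀ D : Matrix κ κ ℂ, sesqValue (c • D) x = c * sesqValue D x := fun c D => by
    simp only [sesqValue, Finset.mul_sum, Matrix.smul_apply, smul_eq_mul]
    exact Finset.sum_congr rfl fun _ _ => Finset.sum_congr rfl fun _ _ => by ring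
  rw [h2, ← Complex.ofReal_inv, Complex.re_ofReal_mul, div_eq_inv_mul]

theorem linearIndependent_extCoeff (hq : ∀ j : Fin n, q (e j.succ) = 0) {κ : Type*} [Fintype κ] {Φ : κ → Module.Dual ℂ (ExtQuot n q)}
    (hΦ : LinearIndependent ℂ Φ) :
    LinearIndependent ℂ (fun a => ∑ j : Fin n, extCoeff q e (Φ a) j • e j.succ) := by
  have h1 : LinearIndependent ℂ (fun a => Φ a ∘ₗ extQuotMap n q) :=
    hΦ.map' (LinearMap.lcomp ℂ ℂ (extQuotMap n q)) (LinearMap.ker_eq_bot.2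
      (LinearMap.lcomp_injective_of_surjective _ (Submodule.mkQ_surjective _)))
  refine LinearIndependent.of_comp (detFunctional e) ?_
  convert h1 using 1
  funext a
  exact (comp_extQuotMap_eq q e hq (Φ a)).symm

end ExtQuot

/-! ### Holomorphic functions and frames in charts -/

section Charts

variable {E : Type*} [NormedAddCommGroup E] [NormedSpace ℂ E]
  {X : Type*} [TopologicalSpace X] [ChartedSpace E X] {U : Set X} {x : X}

theorem contDiffAt_comp_extChartAt_symm {f : X → ℂ} (hU : IsOpen U) (hx : x ∈ U)
    (hf : ContMDiffOn 𝓘(ℂ, E) 𝓘(ℂ, ℂ) ω f U) :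
    ContDiffAt ℂ 2 (fun z => f ((extChartAt 𝓘(ℂ, E) x).symm z)) (extChartAt 𝓘(ℂ, E) x x) := by
  have h := (contMDiffAt_iff.1 ((hf.contMDiffAt (hU.mem_nhds hx)))).2
  simp only [modelWithCornersSelf_coe, Set.range_id, contDiffWithinAt_univ] at h
  exact h.of_le le_top

/-- The charts for the real and the complex model agree, so smooth and holomorphic functions are
read in the same coordinate. -/
theorem contDiffAt_real_comp_extChartAt_symm {f : X → ℂ} (hU : IsOpen U) (hx : x ∈ U)
    (hf : ContMDiffOn 𝓘(ℝ, E) 𝓘(ℝ, ℂ) ∞ f U) :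
    ContDiffAt ℝ 2 (fun z => f ((extChartAt 𝓘(ℂ, E) x).symm z)) (extChartAt 𝓘(ℂ, E) x x) := by
  have h := (contMDiffAt_iff.1 ((hf.contMDiffAt (hU.mem_nhds hx)))).2
  simp only [modelWithCornersSelf_coe, Set.range_id, contDiffWithinAt_univ] at h
  exact h.of_le (WithTop.coe_le_coe.2 (le_top : (2 : ℕ∞) ≤ ⊤))

theorem eventually_extChartAt_symm_mem (hU : IsOpen U) (hx : x ∈ U) :
    ∀ᶠ z in 𝓝 (extChartAt 𝓘(ℂ, E) x x), (extChartAt 𝓘(ℂ, E) x).symm z ∈ U :=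
  (continuousAt_extChartAt_symm (I := 𝓘(ℂ, E)) x).eventually
    (by rw [extChartAt_to_inv]; exact hU.mem_nhds hx)

theorem contMDiffOn_det {ι : Type*} [Fintype ι] [DecidableEq ι] {A : X → Matrix ι ι ℂ}
    (hA : ∀ i j, ContMDiffOn 𝓘(ℂ, E) 𝓘(ℂ, ℂ) ω (fun y => A y i j) U) :
    ContMDiffOn 𝓘(ℂ, E) 𝓘(ℂ, ℂ) ω (fun y => (A y).det) U := by
  simp only [Matrix.det_apply, Units.smul_def, zsmul_eq_mul]
  refine contMDiffOn_finsetSum fun σ _ => ?_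
  exact contMDiffOn_const.mul (contMDiffOn_finsetProd fun i _ => hA _ _)

end Charts

/-! ### Holomorphic frames adapted to `q` and affine charts -/

section Frames

variable {E : Type*} [NormedAddCommGroup E] [NormedSpace ℂ E]
  {X : Type*} [TopologicalSpace X] [ChartedSpace E X]
  {M : Type*} [NormedAddCommGroup M] [NormedSpace ℂ M]
  {V : X → Type*} [TopologicalSpace (Bundle.TotalSpace M V)]
  [∀ x, AddCommGroup (V x)] [∀ x, Module ℂ (V x)] [∀ x, TopologicalSpace (V x)]
  [FiberBundle M V] {F : X → Type*} [∀ x, AddCommGroup (F x)] [∀ x, Module ℂ (F x)]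

/-- A holomorphic frame of `V` around `x`, all of whose members but the first one are in the kernel
of `q`. -/
structure AdaptedFrame (E : Type*) [NormedAddCommGroup E] [NormedSpace ℂ E]
    {X : Type*} [TopologicalSpace X] [ChartedSpace E X]
    (M : Type*) [NormedAddCommGroup M] [NormedSpace ℂ M]
    {V : X → Type*} [TopologicalSpace (Bundle.TotalSpace M V)]
    [∀ x, AddCommGroup (V x)] [∀ x, Module ℂ (V x)] [∀ x, TopologicalSpace (V x)]
    [FiberBundle M V] {F : X → Type*} [∀ x, AddCommGroup (F x)] [∀ x, Module ℂ (F x)]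
    (q : ∀ x, V x →ₗ[ℂ] F x) (n : ℕ) (x : X) where
  dom : Set X
  isOpen_dom : IsOpen dom
  mem_dom : x ∈ dom
  sec : Fin (n + 1) → ∀ y, V y
  hol : ∀ i, IsHolSection (E := E) M dom (sec i)
  basis : ∀ y ∈ dom, Module.Basis (Fin (n + 1)) ℂ (V y)
  basis_apply : ∀ y hy i, basis y hy i = sec i y
  -- Holomorphy of the dual frame enters only through determinants of sections. They give the
  -- coframe of the cokernel and the changes of frame.
  det_hol : ∀ U (hU : U ⊆ dom), IsOpen U → ∀ t : Fin (n + 1) → ∀ y, V y,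
    (∀ i, IsHolSection (E := E) M U (t i)) →
    ∃ f : X → ℂ, ContMDiffOn 𝓘(ℂ, E) 𝓘(ℂ, ℂ) ω f U ∧
      ∀ y (hy : y ∈ U), f y = (basis y (hU hy)).det (fun i => t i y)
  map_succ : ∀ y ∈ dom, ∀ j : Fin n, q y (sec j.succ y) = 0
  map_zero_ne : ∀ y ∈ dom, q y (sec 0 y) ≠ 0

/-- Affine charts of the projectivised cokernel of the exterior powers. -/
theorem AdaptedFrame.nonempty_affineChart {m : ℕ} {x : X} {q : ∀ x, V x →ₗ[ℂ] F x}
    (A : AdaptedFrame E M q (m + 1) x) :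
    Nonempty (AffineChart E (W := fun x => ⋀[ℂ]^(m + 1) (V x))
      (Q := fun x => ExtQuot (m + 1) (q x)) (IsDecomposableSection (E := E) M (m + 1))
      (fun x => extQuotMap (m + 1) (q x)) m x) := by
  classical
  have h1 : ∀ y (hy : y ∈ A.dom), ∀ j : Fin (m + 1), q y (A.basis y hy j.succ) = 0 :=
    fun y hy j => by rw [A.basis_apply]; exact A.map_succ y hy j
  have h2 : ∀ y (hy : y ∈ A.dom), q y (A.basis y hy 0) ≠ 0 :=
    fun y hy => by rw [A.basis_apply]; exact A.map_zero_ne y hy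
  let fr : Fin (m + 1) → ∀ y, Module.Dual ℂ (ExtQuot (m + 1) (q y)) := fun i y =>
    if hy : y ∈ A.dom then extCoframe (q y) (A.basis y hy) (h1 y hy) (h2 y hy) i else 0
  have hfr : ∀ y (hy : y ∈ A.dom), (fun i => fr i y) =
      extCoframe (q y) (A.basis y hy) (h1 y hy) (h2 y hy) := fun y hy => by
    funext i; simp [fr, hy]
  refine ⟨⟨A.dom, A.isOpen_dom, A.mem_dom, fr, ?_, ?_, ?_⟩⟩
  · intro y hy
    rw [hfr y hy]
    exact linearIndependent_extCoframe _ _ _ _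
  · intro y hy
    rw [hfr y hy]
    exact span_extCoframe _ _ _ _
  · rintro U hU hUo s ⟨t, ht, hst⟩ i
    -- On a decomposable section `t₁ ∧ t₂ ∧ …` the coframe member `i` is the determinant of `sec
    -- i.succ, t₁, t₂, …` in the adapted frame.
    obtain ⟨f, hf, hft⟩ := A.det_hol U hU hUo (Fin.cons (A.sec i.succ) t) (fun k => by
      refine Fin.cases ((A.hol i.succ).mono hU) (fun k => ?_) k
      exact ht k)
    refine hf.congr fun y hy => ?_
    rw [hft y hy, hst y hy, congrFun (hfr y (hU hy)) i, extCoframe_extQuotMap, detFunctional_ιMulti,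
      A.basis_apply]
    congr 1
    funext k
    refine Fin.cases rfl (fun k => rfl) k

variable [TopologicalSpace (Bundle.TotalSpace ℂ F)] [∀ x, TopologicalSpace (F x)]
  [FiberBundle ℂ F] [VectorBundle ℂ ℂ F] [ContMDiffVectorBundle ω ℂ F 𝓘(ℂ, E)]
  (q : ∀ x, V x →ₗ[ℂ] F x)

/-- The expression of `q` in a trivialisation of `F` is holomorphic. -/
theorem contMDiffOn_linearMapAt_comp [IsManifold 𝓘(ℂ, E) ω X]
    (hq_hol : ContMDiff (𝓘(ℂ, E).prod 𝓘(ℂ, M)) (𝓘(ℂ, E).prod 𝓘(ℂ, ℂ)) ω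
      (fun v : Bundle.TotalSpace M V => Bundle.TotalSpace.mk' ℂ v.1 (q v.1 v.2)))
    (x : X) {U : Set X} (hU : IsOpen U) (hUx : U ⊆ (trivializationAt ℂ F x).baseSet) {s : ∀ y, V y}
    (hs : IsHolSection (E := E) M U s) :
    ContMDiffOn 𝓘(ℂ, E) 𝓘(ℂ, ℂ) ω
      (fun y => (trivializationAt ℂ F x).linearMapAt ℂ y (q y (s y))) U := by
  have h1 : ContMDiffOn 𝓘(ℂ, E) (𝓘(ℂ, E).prod 𝓘(ℂ, ℂ)) ω
      (fun y => Bundle.TotalSpace.mk' ℂ y (q y (s y))) U := hq_hol.comp_contMDiffOn hs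
  refine (((trivializationAt ℂ F x).contMDiffOn_section_iff hU hUx).1 h1).congr fun y hy => ?_
  rw [(trivializationAt ℂ F x).coe_linearMapAt_of_mem (hUx hy)]

theorem linearMapAt_ne_zero {x y : X} (hy : y ∈ (trivializationAt ℂ F x).baseSet) {v : F y}
    (hv : v ≠ 0) : (trivializationAt ℂ F x).linearMapAt ℂ y v ≠ 0 := by
  rw [Bundle.Trivialization.linearMapAt_def_of_mem _ hy]
  exact fun h => hv ((LinearEquiv.map_eq_zero_iff _).1 h)

/-- By surjectivity some member of a local frame has nonzero image under `q` at `x`. It is moved to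
the first place, and on the open set where its image is nonzero suitable multiples of it are
subtracted from the others to bring them into the kernel. -/
theorem nonempty_adaptedFrame [VectorBundle ℂ M V] [ContMDiffVectorBundle ω M V 𝓘(ℂ, E)]
    [IsManifold 𝓘(ℂ, E) ω X] [FiniteDimensional ℂ M] {n : ℕ}
    (hV : Module.finrank ℂ M = n + 1) (hq_surj : ∀ x, Function.Surjective (q x))
    (hq_hol : ContMDiff (𝓘(ℂ, E).prod 𝓘(ℂ, M)) (𝓘(ℂ, E).prod 𝓘(ℂ, ℂ)) ω
      (fun v : Bundle.TotalSpace M V => Bundle.TotalSpace.mk' ℂ v.1 (q v.1 v.2))) (x : X) :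
    Nonempty (AdaptedFrame E M q n x) := by
  set tr := trivializationAt M V x with htr
  set trF := trivializationAt ℂ F x with htrF
  have hx1 : x ∈ tr.baseSet := FiberBundle.mem_baseSet_trivializationAt' x
  have hx2 : x ∈ trF.baseSet := FiberBundle.mem_baseSet_trivializationAt' x
  let b₁ : Module.Basis (Fin (n + 1)) ℂ M := Module.finBasisOfFinrankEq ℂ M hV
  obtain ⟨j₀, hj₀⟩ : ∃ j, trF.linearMapAt ℂ x (q x (tr.basisAt b₁ hx1 j)) ≠ 0 := by
    by_contra hcon
    push Not at hcon
    have h0 : trF.linearMapAt ℂ x ∘ₗ q x = 0 := (tr.basisAt b₁ hx1).ext hcon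
    obtain ⟨v, hv⟩ := hq_surj x ((trF.linearEquivAt ℂ x hx2).symm 1)
    have h1 := LinearMap.congr_fun h0 v
    rw [LinearMap.comp_apply, hv, trF.linearMapAt_def_of_mem hx2] at h1
    exact one_ne_zero (((trF.linearEquivAt ℂ x hx2).apply_symm_apply 1).symm.trans h1)
  let b : Module.Basis (Fin (n + 1)) ℂ M := b₁.reindex (Equiv.swap 0 j₀)
  let s : Fin (n + 1) → ∀ y, V y := tr.localFrame b
  have hsB : ∀ y (hy : y ∈ tr.baseSet) i, s i y = tr.basisAt b hy i := fun y hy i =>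
    tr.localFrame_apply_of_mem_baseSet b hy
  let l : Fin (n + 1) → X → ℂ := fun i y => trF.linearMapAt ℂ y (q y (s i y))
  let U₀ := tr.baseSet ∩ trF.baseSet
  have hU₀ : IsOpen U₀ := tr.open_baseSet.inter trF.open_baseSet
  have hs : ∀ i, IsHolSection (E := E) M U₀ (s i) := fun i =>
    (tr.contMDiffOn_localFrame_baseSet ω b i).mono Set.inter_subset_left
  have hl : ∀ i, ContMDiffOn 𝓘(ℂ, E) 𝓘(ℂ, ℂ) ω (l i) U₀ := fun i =>
    contMDiffOn_linearMapAt_comp q hq_hol x hU₀ Set.inter_subset_right (hs i)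
  let U := U₀ ∩ l 0 ⁻¹' {0}ᶜ
  have hUU : U ⊆ U₀ := Set.inter_subset_left
  have hU : IsOpen U := (hl 0).continuousOn.isOpen_inter_preimage hU₀ isOpen_compl_singleton
  have hl0 : ∀ y ∈ U, l 0 y ≠ 0 := fun y hy => hy.2
  have hxU : x ∈ U := by
    refine ⟨⟨hx1, hx2⟩, ?_⟩
    change l 0 x ≠ 0
    simp only [l, hsB x hx1]
    simpa [b, Bundle.Trivialization.basisAt] using hj₀
  let sec : Fin (n + 1) → ∀ y, V y :=
    Fin.cons (s 0) fun j y => s j.succ y - (l j.succ y / l 0 y) • s 0 y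
  have hsec0 : ∀ y, sec 0 y = s 0 y := fun y => rfl
  have hsecs : ∀ j : Fin n, ∀ y, sec j.succ y = s j.succ y - (l j.succ y / l 0 y) • s 0 y :=
    fun j y => rfl
  -- The change of frame is unipotent triangular. Hence the new sections form a basis, and
  -- determinants in the two frames coincide.
  have hdet : ∀ y (hy : y ∈ U), (tr.basisAt b (hUU hy).1).det (fun i => sec i y) = 1 := by
    intro y hy
    rw [Module.Basis.det_apply, Matrix.det_of_isUpperTriangular]
    · refine Finset.prod_eq_one fun i _ => ?_
      refine Fin.cases ?_ (fun j => ?_) i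
      · simp [Module.Basis.toMatrix_apply, hsec0, hsB y (hUU hy).1]
      · simp [Module.Basis.toMatrix_apply, hsecs, hsB y (hUU hy).1]
    · intro i j hij
      have hi : i ≠ 0 := fun h => by simp [h] at hij
      rw [Module.Basis.toMatrix_apply]
      revert hij
      refine Fin.cases (fun _ => ?_) (fun j hij => ?_) j
      · simp [hsec0, hsB y (hUU hy).1, hi.symm]
      · have hij' : i ≠ j.succ := (ne_of_lt hij).symm
        simp [hsecs, hsB y (hUU hy).1, hi.symm, hij'.symm]
  have hbasis : ∀ y (hy : y ∈ U), LinearIndependent ℂ (fun i => sec i y) ∧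
      Submodule.span ℂ (Set.range fun i => sec i y) = ⊤ := fun y hy =>
    ((tr.basisAt b (hUU hy).1).is_basis_iff_det).2 (by rw [hdet y hy]; exact isUnit_one)
  have hquot : ∀ i, ContMDiffOn 𝓘(ℂ, E) 𝓘(ℂ, ℂ) ω (fun y => l i y / l 0 y) U := fun i =>
    ((hl i).mono hUU).div₀ ((hl 0).mono hUU) hl0
  refine ⟨⟨U, hU, hxU, sec, ?_, fun y hy => Module.Basis.mk (hbasis y hy).1 (hbasis y hy).2.ge,
    ?_, ?_, ?_, ?_⟩⟩
  · intro i
    refine Fin.cases ((hs 0).mono hUU) (fun j => ?_) i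
    exact ContMDiffOn.sub_section ((hs j.succ).mono hUU)
      (ContMDiffOn.smul_section (hquot j.succ) ((hs 0).mono hUU))
  · intro y hy i
    rw [Module.Basis.mk_apply]
  · intro U' hU' hU'o t ht
    refine ⟨fun y => (Matrix.of fun i j => b.coord i (tr ⟨y, t j y⟩).2).det, ?_, ?_⟩
    · refine contMDiffOn_det fun i j => ?_
      have h1 := (tr.contMDiffOn_section_iff hU'o fun y hy => (hUU (hU' hy)).1).1 (ht j)
      exact (b.coord i).toContinuousLinearMap.contMDiff.comp_contMDiffOn h1
    · intro y hy
      have hy1 := (hUU (hU' hy)).1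
      have h1 := (tr.basisAt b hy1).det.eq_smul_basis_det
        (Module.Basis.mk (hbasis y (hU' hy)).1 (hbasis y (hU' hy)).2.ge)
      rw [Module.Basis.coe_mk, hdet y (hU' hy), one_smul] at h1
      rw [← h1, Module.Basis.det_apply]
      congr 1
  · intro y hy j
    by_contra hne
    refine linearMapAt_ne_zero (x := x) (hUU hy).2 hne ?_
    rw [hsecs, map_sub, map_smul, map_sub, map_smul]
    change l j.succ y - (l j.succ y / l 0 y) • l 0 y = 0
    rw [smul_eq_mul, div_mul_cancel₀ _ (hl0 y hy), sub_self]
  · intro y hy h0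
    refine hl0 y hy ?_
    change trF.linearMapAt ℂ y (q y (sec 0 y)) = 0
    rw [h0, map_zero]

/-- Affine charts of `P(F)` for a line bundle `F`. -/
theorem nonempty_affineChart_line [IsManifold 𝓘(ℂ, E) ω X]
    (hq_hol : ContMDiff (𝓘(ℂ, E).prod 𝓘(ℂ, M)) (𝓘(ℂ, E).prod 𝓘(ℂ, ℂ)) ω
      (fun v : Bundle.TotalSpace M V => Bundle.TotalSpace.mk' ℂ v.1 (q v.1 v.2))) (x : X) :
    Nonempty (AffineChart E (IsHolSection (E := E) M) q 0 x) := by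
  have hne : ∀ y ∈ (trivializationAt ℂ F x).baseSet,
      (trivializationAt ℂ F x).linearMapAt ℂ y ≠ 0 := fun y hy h => by
    have := linearMapAt_ne_zero hy
      (v := ((trivializationAt ℂ F x).linearEquivAt ℂ y hy).symm 1)
      (fun h0 => one_ne_zero ((LinearEquiv.map_eq_zero_iff _).1 h0))
    simp [h] at this
  refine ⟨⟨(trivializationAt ℂ F x).baseSet, (trivializationAt ℂ F x).open_baseSet,
    FiberBundle.mem_baseSet_trivializationAt' x,
    fun _ y => (trivializationAt ℂ F x).linearMapAt ℂ y, ?_, ?_, ?_⟩⟩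
  · have : Subsingleton (Fin (0 + 1)) := inferInstanceAs (Subsingleton (Fin 1))
    exact fun y hy => LinearIndependent.of_subsingleton 0 (hne y hy)
  · rintro y hy Φ -
    let e := (trivializationAt ℂ F x).linearEquivAt ℂ y hy
    have : Φ = Φ (e.symm 1) • (trivializationAt ℂ F x).linearMapAt ℂ y := by
      ext v
      have hv : v = e v • e.symm 1 := by
        rw [← map_smul, smul_eq_mul, mul_one, LinearEquiv.symm_apply_apply]
      rw [(trivializationAt ℂ F x).linearMapAt_def_of_mem hy]
      conv_lhs => rw [hv, map_smul]
      rw [LinearMap.smul_apply, smul_eq_mul, smul_eq_mul, mul_comm]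
      rfl
    rw [this]
    exact Submodule.smul_mem _ _ (Submodule.subset_span ⟨0, rfl⟩)
  · intro U hU hUo s hs i
    exact contMDiffOn_linearMapAt_comp q hq_hol x hUo hU hs

end Frames

/-! ### The fibre integrals in terms of an adapted frame -/

section Pluriharmonic

variable {N : Type*} [NormedAddCommGroup N] [NormedSpace ℂ N] {z : N}

theorem contDiffAt_log_normSq {g : N → ℂ} (hg : ContDiffAt ℂ 2 g z) (hz : g z ≠ 0) :
    ContDiffAt ℝ 2 (fun y => ((Real.log (‖g y‖ ^ 2) : ℝ) : ℂ)) z := by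
  have hR := hg.restrict_scalars ℝ
  have h1 : ∀ y, (g y * conj (g y)).re = ‖g y‖ ^ 2 := fun y => by
    rw [Complex.mul_conj, Complex.ofReal_re, Complex.normSq_eq_norm_sq]
  have := contDiffAt_log_re (hR.mul (contDiffAt_conj hR)) (by
    change 0 < (g z * conj (g z)).re
    rw [h1]
    positivity)
  simpa only [h1] using this

theorem levi_add {φ ψ : N → ℂ} (hφ : ContDiffAt ℝ 2 φ z) (hψ : ContDiffAt ℝ 2 ψ z) (u v : N) :
    levi (fun y => φ y + ψ y) z u v = levi φ z u v + levi ψ z u v := by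
  have := levi_sum (φ := ![φ, ψ]) (z := z) Finset.univ (fun i _ => by fin_cases i <;> assumption) u v
  simpa using this

theorem levi_const_mul {φ : N → ℂ} (c : ℂ) (hφ : ContDiffAt ℝ 2 φ z) (u v : N) :
    levi (fun y => c * φ y) z u v = c * levi φ z u v := by
  rw [levi_mul contDiffAt_const hφ, levi_of_contDiffAt contDiffAt_const,
    dbar_of_differentiableAt (differentiableAt_const c),
    del_of_differentiableAt (differentiableAt_const c)]
  simp

/-- Discards the pluriharmonic contribution of a holomorphic factor `g`, such as the one arising
from the choice of chart or frame. -/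
theorem ddbar_of_eventuallyEq_log_normSq {φ a b : N → ℂ} {g : N → ℂ} (c : ℂ)
    (hg : ContDiffAt ℂ 2 g z) (hz : g z ≠ 0) (ha : ContDiffAt ℝ 2 a z) (hb : ContDiffAt ℝ 2 b z)
    (h : ∀ᶠ y in 𝓝 z, φ y = ((Real.log (‖g y‖ ^ 2) : ℝ) : ℂ) + (a y + c * b y)) :
    ddbar φ z = ddbar a z + c • ddbar b z := by
  have hl := contDiffAt_log_normSq hg hz
  have hcb : ContDiffAt ℝ 2 (fun y => c * b y) z := contDiffAt_const.mul hb
  rw [ddbar_congr h]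
  ext v
  rw [form_two_apply_eq, ddbar_apply (hl.add (ha.add hcb)), AlternatingMap.add_apply,
    AlternatingMap.smul_apply, form_two_apply_eq (ddbar a z), form_two_apply_eq (ddbar b z),
    ddbar_apply ha, ddbar_apply hb, levi_add hl (ha.add hcb), levi_add hl (ha.add hcb),
    levi_add ha hcb, levi_add ha hcb, levi_const_mul c hb, levi_const_mul c hb,
    levi_log_normSq hg hz, levi_log_normSq hg hz, smul_eq_mul]
  ring

end Pluriharmonic

section PosHerm

theorem PosHerm.smul {ι : Type*} [Fintype ι] {D : Matrix ι ι ℂ} (hD : PosHerm D) {c : ℝ}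
    (hc : 0 < c) : PosHerm ((c : ℂ) • D) := by
  refine ⟨fun a b => by simp [hD.conj_apply], fun W hW => ?_⟩
  have := sesqValue_add_smul 0 D c W
  rw [zero_add] at this
  rw [this]
  have h0 : sesqValue (0 : Matrix ι ι ℂ) W = 0 := by simp [sesqValue]
  rw [h0, zero_add, Complex.re_ofReal_mul]
  exact mul_pos hc (hD.pos W hW)

theorem posHerm_one {ι : Type*} [Fintype ι] [DecidableEq ι] : PosHerm (1 : Matrix ι ι ℂ) := by
  refine ⟨fun a b => by simp [Matrix.one_apply, eq_comm], fun W hW => ?_⟩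
  have h1 : sesqValue (1 : Matrix ι ι ℂ) W = ((∑ i, ‖W i‖ ^ 2 : ℝ) : ℂ) := by
    simp only [sesqValue, Matrix.one_apply, mul_ite, mul_one, mul_zero, Finset.sum_ite_eq,
      Finset.mem_univ, if_true, Complex.mul_conj, Complex.normSq_eq_norm_sq]
    push_cast
    rfl
  rw [h1, Complex.ofReal_re]
  obtain ⟨i, hi⟩ := Function.ne_iff.1 hW
  exact Finset.sum_pos' (fun _ _ => by positivity) ⟨i, Finset.mem_univ _, by
    have : W i ≠ 0 := hi
    positivity⟩

end PosHerm

/-! ### Forms pulled back from the base, and zero-dimensional fibres -/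

section CompFst

variable {E : Type*} [NormedAddCommGroup E] [NormedSpace ℂ E]

theorem smul_ddbar_comp_fst {G : Type*} [NormedAddCommGroup G] [NormedSpace ℂ G] {φ : E → ℂ}
    {z : E} (hφ : ContDiffAt ℝ 2 φ z) (c : ℂ) (w : G) :
    c • ddbar (fun q : E × G => φ q.1) (z, w) =
      (c • ddbar φ z).compLinearMap ((LinearMap.fst ℂ E G).restrictScalars ℝ) := by
  have h1 := fun u v => levi_comp_fst (F := G) (p := (z, w)) hφ u v
  have h2 : ContDiffAt ℝ 2 (fun q : E × G => φ q.1) (z, w) := contDiffAt_comp_fst hφ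
  ext v
  rw [AlternatingMap.compLinearMap_apply, AlternatingMap.smul_apply,
    AlternatingMap.smul_apply, form_two_apply_eq, form_two_apply_eq (ddbar φ z),
    ddbar_apply h2, ddbar_apply hφ, h1, h1]
  rfl

theorem wedgePow_comp_fst_append (α : Form E 2) {p : ℕ} (u : Fin (2 * p) → E)
    (h : 2 * p = 2 * p + 2 * 0) :
    wedgePow (α.compLinearMap ((LinearMap.fst ℂ E (Fin 0 → ℂ)).restrictScalars ℝ)) p
      (Fin.append (fun i => ((u i, 0) : E × (Fin 0 → ℂ))) (fun j => (0, stdRealFrame 0 j)) ∘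
        Fin.cast h) = wedgePow α p u := by
  rw [wedgePow_compLinearMap, AlternatingMap.compLinearMap_apply]
  congr 1
  funext i
  have h1 : Fin.cast h i = Fin.castAdd (2 * 0) i := rfl
  rw [Function.comp_apply, h1, Fin.append_left]
  rfl

/-- The fibre is a point and its volume is the Dirac measure, so integration is evaluation. -/
theorem fibreIntegral_of_comp_fst (α : Form E 2) {p : ℕ}
    (β : (Fin 0 → ℂ) → Form (E × (Fin 0 → ℂ)) (2 * p))
    (hβ : ∀ w, β w =
      wedgePow (α.compLinearMap ((LinearMap.fst ℂ E (Fin 0 → ℂ)).restrictScalars ℝ)) p)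
    (u : Fin (2 * p) → E) {h : 2 * p = 2 * p + 2 * 0} :
    let f : (Fin 0 → ℂ) → ℂ := fun w => β w
      (Fin.append (fun i => ((u i, 0) : E × (Fin 0 → ℂ))) (fun j => (0, stdRealFrame 0 j)) ∘
        Fin.cast h)
    MeasureTheory.Integrable f ∧ ∫ w, f w = wedgePow α p u := by
  have hv : (MeasureTheory.volume : MeasureTheory.Measure (Fin 0 → ℂ)) =
      MeasureTheory.Measure.dirac 0 := by
    rw [MeasureTheory.volume_pi]
    exact MeasureTheory.Measure.pi_of_empty _ _
  simp only [hβ, wedgePow_comp_fst_append]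
  rw [hv]
  exact ⟨MeasureTheory.integrable_const _, by simp⟩

end CompFst

/-! ### From matrices in affine charts to fibre integrals; the case of `P(F)` -/

section FibreIntegral

variable {E : Type*} [NormedAddCommGroup E] [NormedSpace ℂ E]
  {X : Type*} [TopologicalSpace X] [ChartedSpace E X]

/-- The fibre integral of the top power of a Fubini–Study form. -/
theorem hasFibreIntegral_fubiniStudy {W Q : X → Type*}
    [∀ x, AddCommGroup (W x)] [∀ x, Module ℂ (W x)]
    [∀ x, AddCommGroup (Q x)] [∀ x, Module ℂ (Q x)]
    {gen : Set X → (∀ x, W x) → Prop} {H : ∀ x, SesqForm (W x)} {pr : ∀ x, W x →ₗ[ℂ] Q x}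
    {m : ℕ} (hp : m + 1 = 1 + m) {x : X} {B : Form E 2}
    (hne : Nonempty (AffineChart E gen pr m x))
    (hc : ∀ c : AffineChart E gen pr m x, ∃ D : E → Matrix (Fin (m + 1)) (Fin (m + 1)) ℂ,
      (∀ i j, ContDiffAt ℝ 2 (fun z => D z i j) (extChartAt 𝓘(ℂ, E) x x)) ∧
      (∀ᶠ z in 𝓝 (extChartAt 𝓘(ℂ, E) x x), PosHerm (D z)) ∧
      (∀ᶠ z in 𝓝 (extChartAt 𝓘(ℂ, E) x x), ∀ w, dualNormSq (H ((extChartAt 𝓘(ℂ, E) x).symm z))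
        (c.lift ((extChartAt 𝓘(ℂ, E) x).symm z) w ∘ₗ pr ((extChartAt 𝓘(ℂ, E) x).symm z)) =
          (affineForm D (z, w)).re) ∧
      (Complex.I / (2 * Real.pi)) • ddbar (fun z => ((Real.log (D z).det.re : ℝ) : ℂ))
        (extChartAt 𝓘(ℂ, E) x x) = B) :
    HasFibreIntegral ((fubiniStudy gen H pr m).pow (m + 1)) 1 hp x B := by
  refine ⟨hne, fun c u => ?_⟩
  obtain ⟨D, hD, hP, hn, hB⟩ := hc c
  have key := integral_wedgePow_log_affineForm hD hP (by omega) u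
  have h1 : ∀ w, ddbar (fun q : E × (Fin m → ℂ) =>
      let y := (extChartAt 𝓘(ℂ, E) x).symm q.1
      ((Real.log (dualNormSq (H y) (c.lift y q.2 ∘ₗ pr y)) : ℝ) : ℂ))
        (extChartAt 𝓘(ℂ, E) x x, w) =
      ddbar (fun q => ((Real.log (affineForm D q).re : ℝ) : ℂ)) (extChartAt 𝓘(ℂ, E) x x, w) := by
    intro w
    refine ddbar_congr ?_
    have := (continuousAt_fst (p := (extChartAt 𝓘(ℂ, E) x x, w))).eventually hn
    filter_upwards [this] with q hq
    dsimp only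
    rw [hq q.2]
  rw [hB] at key
  simp only [← h1] at key
  exact key

variable {M : Type*} [NormedAddCommGroup M] [NormedSpace ℂ M]
  {V : X → Type*} [TopologicalSpace (Bundle.TotalSpace M V)]
  [∀ x, AddCommGroup (V x)] [∀ x, Module ℂ (V x)] [∀ x, TopologicalSpace (V x)]
  [FiberBundle M V] {F : X → Type*} [∀ x, AddCommGroup (F x)] [∀ x, Module ℂ (F x)]
  {q : ∀ x, V x →ₗ[ℂ] F x} {n : ℕ} {x : X}

namespace AdaptedFrame

variable (A : AdaptedFrame E M q n x) (h : HermitianMetric E M V)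

/-- The Gram matrix of an adapted frame, in the chart at `x`. -/
def gramAt (z : E) : Matrix (Fin (n + 1)) (Fin (n + 1)) ℂ :=
  gram (h.form ((extChartAt 𝓘(ℂ, E) x).symm z)) fun i => A.sec i ((extChartAt 𝓘(ℂ, E) x).symm z)

/-- The Gram matrix of an adapted frame of the kernel of `q`, in the chart at `x`. -/
def gramKerAt (z : E) : Matrix (Fin n) (Fin n) ℂ :=
  gram (h.form ((extChartAt 𝓘(ℂ, E) x).symm z))
    fun i : Fin n => A.sec i.succ ((extChartAt 𝓘(ℂ, E) x).symm z)

def logDet (z : E) : ℂ := ((Real.log (A.gramAt h z).det.re : ℝ) : ℂ)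

def logDetKer (z : E) : ℂ := ((Real.log (A.gramKerAt h z).det.re : ℝ) : ℂ)

theorem linearIndependent {y : X} (hy : y ∈ A.dom) : LinearIndependent ℂ fun i => A.sec i y := by
  rw [← funext (A.basis_apply y hy)]
  exact (A.basis y hy).linearIndependent

theorem posHerm_gramAt {z : E} (hz : (extChartAt 𝓘(ℂ, E) x).symm z ∈ A.dom) :
    PosHerm (A.gramAt h z) :=
  posHerm_gram (h.conj_symm _) (h.pos _) (A.linearIndependent hz)

theorem posHerm_gramKerAt {z : E} (hz : (extChartAt 𝓘(ℂ, E) x).symm z ∈ A.dom) :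
    PosHerm (A.gramKerAt h z) :=
  posHerm_gram (h.conj_symm _) (h.pos _)
    ((A.linearIndependent hz).comp _ (Fin.succ_injective n))

theorem contDiffAt_form (i j : Fin (n + 1)) :
    ContDiffAt ℝ 2 (fun z => h.form ((extChartAt 𝓘(ℂ, E) x).symm z)
      (A.sec i ((extChartAt 𝓘(ℂ, E) x).symm z)) (A.sec j ((extChartAt 𝓘(ℂ, E) x).symm z)))
      (extChartAt 𝓘(ℂ, E) x x) :=
  contDiffAt_real_comp_extChartAt_symm (f := fun y => h.form y (A.sec i y) (A.sec j y))
    A.isOpen_dom A.mem_dom (h.smooth A.dom A.isOpen_dom _ _ (A.hol i) (A.hol j))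

theorem mem_center : (extChartAt 𝓘(ℂ, E) x).symm (extChartAt 𝓘(ℂ, E) x x) ∈ A.dom := by
  rw [extChartAt_to_inv]
  exact A.mem_dom

theorem contDiffAt_det_gramAt :
    ContDiffAt ℝ 2 (fun z => (A.gramAt h z).det) (extChartAt 𝓘(ℂ, E) x x) :=
  contDiffAt_det fun i j => A.contDiffAt_form h i j

theorem contDiffAt_det_gramKerAt :
    ContDiffAt ℝ 2 (fun z => (A.gramKerAt h z).det) (extChartAt 𝓘(ℂ, E) x x) :=
  contDiffAt_det fun i j => A.contDiffAt_form h i.succ j.succ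

theorem contDiffAt_logDet : ContDiffAt ℝ 2 (A.logDet h) (extChartAt 𝓘(ℂ, E) x x) :=
  contDiffAt_log_re (A.contDiffAt_det_gramAt h) (A.posHerm_gramAt h A.mem_center).det_re_pos.1

theorem contDiffAt_logDetKer : ContDiffAt ℝ 2 (A.logDetKer h) (extChartAt 𝓘(ℂ, E) x x) :=
  contDiffAt_log_re (A.contDiffAt_det_gramKerAt h) (A.posHerm_gramKerAt h A.mem_center).det_re_pos.1

/-- In an affine chart of `P(F)` the dual norm is given by a `1 × 1` matrix. -/
theorem exists_affineForm_line (hq_surj : ∀ x, Function.Surjective (q x))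
    (c : AffineChart E (IsHolSection (E := E) M) q 0 x) :
    ∃ D : E → Matrix (Fin (0 + 1)) (Fin (0 + 1)) ℂ,
      (∀ i j, ContDiffAt ℝ 2 (fun z => D z i j) (extChartAt 𝓘(ℂ, E) x x)) ∧
      (∀ᶠ z in 𝓝 (extChartAt 𝓘(ℂ, E) x x), PosHerm (D z)) ∧
      (∀ᶠ z in 𝓝 (extChartAt 𝓘(ℂ, E) x x), ∀ w,
        dualNormSq (h.form ((extChartAt 𝓘(ℂ, E) x).symm z))
          (c.lift ((extChartAt 𝓘(ℂ, E) x).symm z) w ∘ₗ q ((extChartAt 𝓘(ℂ, E) x).symm z)) =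
            (affineForm D (z, w)).re) ∧
      (Complex.I / (2 * Real.pi)) • ddbar (fun z => ((Real.log (D z).det.re : ℝ) : ℂ))
        (extChartAt 𝓘(ℂ, E) x x) = (Complex.I / (2 * Real.pi)) •
          (ddbar (A.logDetKer h) (extChartAt 𝓘(ℂ, E) x x) -
            ddbar (A.logDet h) (extChartAt 𝓘(ℂ, E) x x)) := by
  set z₀ := extChartAt 𝓘(ℂ, E) x x with hz₀
  let U := A.dom ∩ c.dom
  have hU : IsOpen U := A.isOpen_dom.inter c.isOpen_dom
  have hxU : x ∈ U := ⟨A.mem_dom, c.mem_dom⟩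
  let ψ : E → X := (extChartAt 𝓘(ℂ, E) x).symm
  have hev : ∀ᶠ z in 𝓝 z₀, ψ z ∈ U := eventually_extChartAt_symm_mem hU hxU
  have hx0 : ψ z₀ ∈ U := hev.self_of_nhds
  let g : E → ℂ := fun z => c.frame 0 (ψ z) (q (ψ z) (A.sec 0 (ψ z)))
  have hg : ContDiffAt ℂ 2 g z₀ := contDiffAt_comp_extChartAt_symm hU hxU
    (c.holomorphic U Set.inter_subset_right hU _ ((A.hol 0).mono Set.inter_subset_left) 0)
  have hgR := hg.restrict_scalars ℝ
  -- The coframe member composed with `q` vanishes on the kernel members of the frame. If it also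
  -- vanished on `sec 0`, it would be zero.
  have hg0 : ∀ y ∈ U, c.frame 0 y (q y (A.sec 0 y)) ≠ 0 := by
    intro y hy h0
    refine (c.linearIndependent y hy.2).ne_zero 0 (LinearMap.ext fun v => ?_)
    obtain ⟨v, rfl⟩ := hq_surj y v
    have h1 : c.frame 0 y ∘ₗ q y = 0 := by
      refine (A.basis y hy.1).ext fun i => ?_
      rw [A.basis_apply]
      refine Fin.cases h0 (fun j => ?_) i
      rw [LinearMap.comp_apply, A.map_succ y hy.1, map_zero, LinearMap.zero_apply]
    exact LinearMap.congr_fun h1 v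
  have hG := fun z (hz : ψ z ∈ U) => A.posHerm_gramAt h hz.1
  have hK := fun z (hz : ψ z ∈ U) => A.posHerm_gramKerAt h hz.1
  -- The value of the dual norm by `dualNormSq_eq_det_div_det`. There are no fibre coordinates, so
  -- it is the only entry of `D`.
  let d : E → ℝ := fun z => ‖g z‖ ^ 2 * ((A.gramKerAt h z).det.re / (A.gramAt h z).det.re)
  have hd : ∀ z, ψ z ∈ U → 0 < d z := fun z hz => by
    have h1 := (hG z hz).det_re_pos.1
    have h2 := (hK z hz).det_re_pos.1
    have h3 : g z ≠ 0 := hg0 _ hz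
    positivity
  let D : E → Matrix (Fin (0 + 1)) (Fin (0 + 1)) ℂ := fun z => (d z : ℂ) • 1
  have hdet : ∀ z, (D z).det = d z := fun z => by
    change ((d z : ℂ) • (1 : Matrix (Fin 1) (Fin 1) ℂ)).det = d z
    simp
  have hdsmooth : ContDiffAt ℝ 2 (fun z => (d z : ℂ)) z₀ := by
    have h1 : ContDiffAt ℝ 2 (fun z => g z * conj (g z) *
        ((A.gramKerAt h z).det * ((A.gramAt h z).det)⁻¹)) z₀ :=
      (hgR.mul (contDiffAt_conj hgR)).mul ((A.contDiffAt_det_gramKerAt h).mul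
        ((A.contDiffAt_det_gramAt h).inv (hG z₀ hx0).det_ne_zero))
    refine h1.congr_of_eventuallyEq ?_
    filter_upwards [hev] with z hz
    rw [(hG z hz).det_re_pos.2, (hK z hz).det_re_pos.2, Complex.mul_conj,
      Complex.normSq_eq_norm_sq]
    simp only [d, Complex.ofReal_mul, div_eq_mul_inv,
      Complex.ofReal_inv]
  refine ⟨D, fun i j => ?_, hev.mono fun z hz => posHerm_one.smul (hd z hz), ?_, ?_⟩
  · simp only [D, Matrix.smul_apply, smul_eq_mul]
    exact hdsmooth.mul contDiffAt_const
  · filter_upwards [hev] with z hz w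
    have h1 : c.lift (ψ z) w = c.frame 0 (ψ z) := by simp [AffineChart.lift]
    have h2 := dualNormSq_eq_det_div_det (h.conj_symm (ψ z)) (h.pos (ψ z)) (A.basis (ψ z) hz.1)
      (f := c.frame 0 (ψ z) ∘ₗ q (ψ z)) (fun j => by
        rw [A.basis_apply, LinearMap.comp_apply, A.map_succ _ hz.1, map_zero])
    change dualNormSq (h.form (ψ z)) (c.lift (ψ z) w ∘ₗ q (ψ z)) = _
    rw [h1, h2]
    have h3 : affineForm D (z, w) = (d z : ℂ) := by
      change ∑ a : Fin 1, ∑ b : Fin 1, _ = _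
      simp [D]
    rw [h3, Complex.ofReal_re]
    simp only [LinearMap.comp_apply, A.basis_apply, funext (A.basis_apply (ψ z) hz.1)]
    rfl
  · congr 1
    have hlog : ∀ᶠ z in 𝓝 z₀, (((Real.log (D z).det.re : ℝ) : ℂ)) =
        ((Real.log (‖g z‖ ^ 2) : ℝ) : ℂ) + (A.logDetKer h z + (-1) * A.logDet h z) := by
      filter_upwards [hev] with z hz
      have h1 := (hG z hz).det_re_pos.1
      have h2 := (hK z hz).det_re_pos.1
      have h3 : g z ≠ 0 := hg0 _ hz
      rw [hdet, Complex.ofReal_re]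
      simp only [d]
      rw [Real.log_mul (by positivity) (by positivity), Real.log_div h2.ne' h1.ne']
      simp only [logDet, logDetKer]
      push_cast
      ring
    rw [ddbar_of_eventuallyEq_log_normSq (-1) hg (hg0 _ hx0) (A.contDiffAt_logDetKer h)
      (A.contDiffAt_logDet h) hlog, neg_one_smul, ← sub_eq_add_neg]

theorem hasFibreIntegral_etaV (hne : Nonempty (AffineChart E (IsHolSection (E := E) M) q 0 x))
    (hq_surj : ∀ x, Function.Surjective (q x)) (hp : 1 = 1 + 0) :
    HasFibreIntegral ((etaV h q).pow 1) 1 hp x ((Complex.I / (2 * Real.pi)) •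
      (ddbar (A.logDetKer h) (extChartAt 𝓘(ℂ, E) x x) -
        ddbar (A.logDet h) (extChartAt 𝓘(ℂ, E) x x)) : Form E 2) :=
  hasFibreIntegral_fubiniStudy (m := 0) hp hne (A.exists_affineForm_line h hq_surj)

/-- The fibre integrals of the powers over the trivial projective bundle of a line bundle. -/
theorem hasFibreIntegral_etaV_pow
    (hne : Nonempty (AffineChart E (IsHolSection (E := E) M) q 0 x))
    (hq_surj : ∀ x, Function.Surjective (q x)) {p : ℕ} (hp : p = p + 0) :
    HasFibreIntegral ((etaV h q).pow p) p hp x (wedgePow ((Complex.I / (2 * Real.pi)) •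
      (ddbar (A.logDetKer h) (extChartAt 𝓘(ℂ, E) x x) -
        ddbar (A.logDet h) (extChartAt 𝓘(ℂ, E) x x)) : Form E 2) p) := by
  refine ⟨hne, fun c u => ?_⟩
  obtain ⟨D, hD, hP, hn, hB⟩ := A.exists_affineForm_line h hq_surj c
  have hlog : ContDiffAt ℝ 2 (fun z => ((Real.log (D z).det.re : ℝ) : ℂ))
      (extChartAt 𝓘(ℂ, E) x x) :=
    contDiffAt_log_re (contDiffAt_det hD) hP.self_of_nhds.det_re_pos.1
  have hdet : ∀ z (w : Fin 0 → ℂ), affineForm D (z, w) = (D z).det := fun z w => by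
    change ∑ a : Fin 1, ∑ b : Fin 1, _ = Matrix.det (n := Fin 1) _
    simp
  rw [← hB]
  refine fibreIntegral_of_comp_fst _ _ (fun w => ?_) u
  refine Eq.trans (congrArg (fun β => wedgePow ((Complex.I / (2 * Real.pi)) • β) p)
    (ddbar_congr ?_)) (congrArg (fun β => wedgePow β p) (smul_ddbar_comp_fst hlog _ w))
  have := (continuousAt_fst (p := (extChartAt 𝓘(ℂ, E) x x, w))).eventually hn
  filter_upwards [this] with q' hq'
  dsimp only
  rw [hq' q'.2, hdet]

end AdaptedFrame

end FibreIntegral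

/-! ### The fibre integral over `P(F')` and the curvature of `det V` -/

namespace AdaptedFrame

variable {E : Type*} [NormedAddCommGroup E] [NormedSpace ℂ E]
  {X : Type*} [TopologicalSpace X] [ChartedSpace E X]
  {M : Type*} [NormedAddCommGroup M] [NormedSpace ℂ M]
  {V : X → Type*} [TopologicalSpace (Bundle.TotalSpace M V)]
  [∀ x, AddCommGroup (V x)] [∀ x, Module ℂ (V x)] [∀ x, TopologicalSpace (V x)]
  [FiberBundle M V] {F : X → Type*} [∀ x, AddCommGroup (F x)] [∀ x, Module ℂ (F x)]
  {q : ∀ x, V x →ₗ[ℂ] F x} {n m : ℕ} {x : X}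

/-- The metric on the dual of `F'` is that of `Ker q` divided by the scalar `det G`. In a
determinant of size `m + 1` this scalar occurs `m + 1` times, whereas it occurs once for `P(F)`. The
curvature term of the theorem is this discrepancy. -/
theorem hasFibreIntegral_etaExt (A : AdaptedFrame E M q (m + 1) x) (h : HermitianMetric E M V)
    (hp : m + 1 = 1 + m) :
    HasFibreIntegral ((etaExt h q (m + 1)).pow (m + 1)) 1 hp x ((Complex.I / (2 * Real.pi)) •
      (ddbar (A.logDetKer h) (extChartAt 𝓘(ℂ, E) x x) -
        ((m : ℂ) + 1) • ddbar (A.logDet h) (extChartAt 𝓘(ℂ, E) x x)) : Form E 2) := by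
  refine hasFibreIntegral_fubiniStudy (m := m) (W := fun x => ⋀[ℂ]^(m + 1) (V x))
    (Q := fun x => ExtQuot (m + 1) (q x)) (gen := IsDecomposableSection (E := E) M (m + 1))
    (H := fun x => exteriorForm (h.form x) (m + 1)) (pr := fun x => extQuotMap (m + 1) (q x))
    hp A.nonempty_affineChart fun c => ?_
  set z₀ := extChartAt 𝓘(ℂ, E) x x with hz₀
  let U := A.dom ∩ c.dom
  have hU : IsOpen U := A.isOpen_dom.inter c.isOpen_dom
  have hxU : x ∈ U := ⟨A.mem_dom, c.mem_dom⟩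
  let ψ : E → X := (extChartAt 𝓘(ℂ, E) x).symm
  have hev : ∀ᶠ z in 𝓝 z₀, ψ z ∈ U := eventually_extChartAt_symm_mem hU hxU
  have hx0 : ψ z₀ ∈ U := hev.self_of_nhds
  -- Holomorphic coordinates of the coframe of the chart with respect to the kernel members of the
  -- adapted frame.
  let G : E → Matrix (Fin (m + 1)) (Fin (m + 1)) ℂ := fun z => Matrix.of fun a j =>
    extCoeff (q (ψ z)) (fun i => A.sec i (ψ z)) (c.frame a (ψ z)) j
  have hGhol : ∀ a j, ContDiffAt ℂ 2 (fun z => G z a j) z₀ := by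
    intro a j
    refine contDiffAt_const.mul (contDiffAt_comp_extChartAt_symm (f := fun y => c.frame a y
      (extQuotMap (m + 1) (q y) (exteriorPower.ιMulti ℂ (m + 1)
        fun i => A.sec (j.succ.succAbove i) y))) hU hxU ?_)
    exact c.holomorphic U Set.inter_subset_right hU _
      ⟨fun i => A.sec (j.succ.succAbove i),
        fun i => (A.hol _).mono Set.inter_subset_left, fun y _ => rfl⟩ a
  have hdetG : ContDiffAt ℂ 2 (fun z => (G z).det) z₀ := contDiffAt_det hGhol
  have hG := fun z (hz : ψ z ∈ U) => A.posHerm_gramAt h hz.1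
  have hK := fun z (hz : ψ z ∈ U) => A.posHerm_gramKerAt h hz.1
  have hker : ∀ z (hz : ψ z ∈ U), ∀ j : Fin (m + 1), q (ψ z) (A.basis (ψ z) hz.1 j.succ) = 0 := fun z hz j => by rw [A.basis_apply]; exact A.map_succ _ hz.1 j
  let k : ∀ z, Fin (m + 1) → V (ψ z) := fun z a => ∑ j : Fin (m + 1), G z a j • A.sec j.succ (ψ z)
  have hgram : ∀ z, gram (h.form (ψ z)) (k z) = G z * A.gramKerAt h z * (G z).conjTranspose :=
    fun z => gram_sum_smul (h.form (ψ z)) (fun j : Fin (m + 1) => A.sec j.succ (ψ z)) (G z)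
  have hk : ∀ z, ψ z ∈ U → PosHerm (gram (h.form (ψ z)) (k z)) := fun z hz => by
    refine posHerm_gram (h.conj_symm _) (h.pos _) ?_
    have := linearIndependent_extCoeff (e := A.basis (ψ z) hz.1) (hker z hz)
      (c.linearIndependent (ψ z) hz.2)
    simp only [funext (A.basis_apply (ψ z) hz.1), A.basis_apply] at this
    exact this
  have hGdet : ∀ z, ψ z ∈ U → (G z).det ≠ 0 := fun z hz h0 => by
    have := (hk z hz).det_ne_zero
    rw [hgram, Matrix.det_mul, Matrix.det_mul, h0] at this
    simp at this
  let D : E → Matrix (Fin (m + 1)) (Fin (m + 1)) ℂ := fun z =>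
    (((A.gramAt h z).det.re)⁻¹ : ℂ) • gram (h.form (ψ z)) (k z)
  have hdet : ∀ z, ψ z ∈ U → (D z).det.re = ((A.gramAt h z).det.re)⁻¹ ^ (m + 1) *
      (‖(G z).det‖ ^ 2 * (A.gramKerAt h z).det.re) := fun z hz => by
    simp only [D]
    rw [Matrix.det_smul, Fintype.card_fin,
      det_gram_sum_smul (h.form (ψ z)) (fun j : Fin (m + 1) => A.sec j.succ (ψ z)) (G z),
      ← Complex.ofReal_inv, ← Complex.ofReal_pow, Complex.re_ofReal_mul, Complex.re_ofReal_mul]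
    rfl
  refine ⟨D, fun i j => ?_, hev.mono fun z hz => ?_, ?_, ?_⟩
  · have h1 : ContDiffAt ℝ 2 (fun z => ((A.gramAt h z).det)⁻¹ *
        (G z * A.gramKerAt h z * (G z).conjTranspose) i j) z₀ := by
      refine ((A.contDiffAt_det_gramAt h).inv (hG z₀ hx0).det_ne_zero).mul ?_
      simp only [Matrix.mul_apply, Matrix.conjTranspose_apply]
      exact ContDiffAt.sum fun b _ => (ContDiffAt.sum fun a _ =>
        ((hGhol i a).restrict_scalars ℝ).mul (A.contDiffAt_form h a.succ b.succ)).mul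
          (contDiffAt_conj ((hGhol j b).restrict_scalars ℝ))
    refine h1.congr_of_eventuallyEq ?_
    filter_upwards [hev] with z hz
    rw [← hgram, (hG z hz).det_re_pos.2]
    simp only [D, Matrix.smul_apply, smul_eq_mul]
  · have := (hk z hz).smul (inv_pos.2 (hG z hz).det_re_pos.1)
    rwa [Complex.ofReal_inv] at this
  · filter_upwards [hev] with z hz w
    have h1 : c.lift (ψ z) w = ∑ a, (Fin.cons 1 w : Fin (m + 1) → ℂ) a • c.frame a (ψ z) := by
      rw [Fin.sum_univ_succ]
      simp [AffineChart.lift]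
    have h2 := dualNormSq_comp_extQuotMap (e := A.basis (ψ z) hz.1) (hker z hz)
      (h.conj_symm (ψ z)) (h.pos (ψ z)) (fun a => c.frame a (ψ z)) (Fin.cons 1 w)
    change dualNormSq (exteriorForm (h.form (ψ z)) (m + 1))
      (c.lift (ψ z) w ∘ₗ extQuotMap (m + 1) (q (ψ z))) = _
    rw [h1, h2, affineForm_eq_sesqValue]
    simp only [funext (A.basis_apply (ψ z) hz.1), A.basis_apply]
    rfl
  · congr 1
    have hlog : ∀ᶠ z in 𝓝 z₀, (((Real.log (D z).det.re : ℝ) : ℂ)) =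
        ((Real.log (‖(G z).det‖ ^ 2) : ℝ) : ℂ) +
          (A.logDetKer h z + (-((m : ℂ) + 1)) * A.logDet h z) := by
      filter_upwards [hev] with z hz
      have h1 := (hG z hz).det_re_pos.1
      have h2 := (hK z hz).det_re_pos.1
      have h3 := hGdet z hz
      rw [hdet z hz, Real.log_mul (by positivity) (by positivity),
        Real.log_mul (by positivity) (by positivity), Real.log_pow, Real.log_inv]
      simp only [logDet, logDetKer]
      push_cast
      ring
    rw [ddbar_of_eventuallyEq_log_normSq _ hdetG (hGdet _ hx0) (A.contDiffAt_logDetKer h)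
      (A.contDiffAt_logDet h) hlog, neg_smul, ← sub_eq_add_neg]

/-- The Levi form of the logarithm of the Gram determinant does not depend on the frame. -/
theorem ddbar_log_det_gram (A : AdaptedFrame E M q n x) (h : HermitianMetric E M V) {U : Set X}
    (hU : IsOpen U) (hx : x ∈ U) {N : ℕ} (hN : N = n + 1) (s : Fin N → ∀ y, V y)
    (hs : IsLocalFrameOn 𝓘(ℂ, E) M ω s U) :
    ddbar (fun z : E => ((Real.log (Matrix.of fun j k =>
      h.form ((extChartAt 𝓘(ℂ, E) x).symm z) (s j ((extChartAt 𝓘(ℂ, E) x).symm z))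
        (s k ((extChartAt 𝓘(ℂ, E) x).symm z))).det.re : ℝ) : ℂ)) (extChartAt 𝓘(ℂ, E) x x) =
    ddbar (A.logDet h) (extChartAt 𝓘(ℂ, E) x x) := by
  subst hN
  set z₀ := extChartAt 𝓘(ℂ, E) x x with hz₀
  let ψ : E → X := (extChartAt 𝓘(ℂ, E) x).symm
  let U' := A.dom ∩ U
  have hU' : IsOpen U' := A.isOpen_dom.inter hU
  have hxU' : x ∈ U' := ⟨A.mem_dom, hx⟩
  have hev : ∀ᶠ z in 𝓝 z₀, ψ z ∈ U' := eventually_extChartAt_symm_mem hU' hxU'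
  obtain ⟨f, hf, hfs⟩ := A.det_hol U' Set.inter_subset_left hU' s
    fun i => (hs.contMDiffOn i).mono Set.inter_subset_right
  have hg : ContDiffAt ℂ 2 (fun z => f (ψ z)) z₀ := contDiffAt_comp_extChartAt_symm hU' hxU' hf
  have hf0 : ∀ y ∈ U', f y ≠ 0 := fun y hy => by
    rw [hfs y hy]
    exact (((A.basis y hy.1).is_basis_iff_det).1 ⟨hs.linearIndependent hy.2,
      top_le_iff.1 (hs.generating hy.2)⟩).ne_zero
  -- The summand with coefficient `0` only provides the shape of `ddbar_of_eventuallyEq_log_normSq`.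
  have hlog : ∀ᶠ z in 𝓝 z₀, ((Real.log (Matrix.of fun j k =>
      h.form (ψ z) (s j (ψ z)) (s k (ψ z))).det.re : ℝ) : ℂ) =
        ((Real.log (‖f (ψ z)‖ ^ 2) : ℝ) : ℂ) + (A.logDet h z + 0 * A.logDet h z) := by
    filter_upwards [hev] with z hz
    have h1 := (A.posHerm_gramAt h hz.1).det_re_pos.1
    have h3 := hf0 _ hz
    have h4 := det_gram_sum_smul (h.form (ψ z)) (fun i => A.sec i (ψ z))
      (((A.basis (ψ z) hz.1).toMatrix fun i => s i (ψ z)).transpose)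
    have h5 : (fun a => ∑ i, ((A.basis (ψ z) hz.1).toMatrix fun i => s i (ψ z)).transpose a i •
        A.sec i (ψ z)) = fun i => s i (ψ z) := by
      funext a
      have := (A.basis (ψ z) hz.1).sum_toMatrix_smul_self (fun i => s i (ψ z)) a
      simp only [A.basis_apply] at this
      exact this
    rw [h5, Matrix.det_transpose, ← Module.Basis.det_apply, ← hfs _ hz] at h4
    change ((Real.log (gram (h.form (ψ z)) fun i => s i (ψ z)).det.re : ℝ) : ℂ) = _
    rw [h4, Complex.re_ofReal_mul]
    change ((Real.log (‖f (ψ z)‖ ^ 2 * (A.gramAt h z).det.re) : ℝ) : ℂ) = _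
    rw [Real.log_mul (by positivity) h1.ne']
    simp only [logDet]
    push_cast
    ring
  rw [ddbar_of_eventuallyEq_log_normSq 0 hg (hf0 _ hev.self_of_nhds) (A.contDiffAt_logDet h)
    (A.contDiffAt_logDet h) hlog, zero_smul, add_zero]

theorem detCurvature_eq [VectorBundle ℂ M V] [ContMDiffVectorBundle ω M V 𝓘(ℂ, E)]
    [FiniteDimensional ℂ M] (hV : Module.finrank ℂ M = n + 1) (A : AdaptedFrame E M q n x)
    (h : HermitianMetric E M V) :
    detCurvature h x = (-ddbar (A.logDet h) (extChartAt 𝓘(ℂ, E) x x) : Form E 2) :=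
  congrArg Neg.neg (A.ddbar_log_det_gram h (trivializationAt M V x).open_baseSet
    (FiberBundle.mem_baseSet_trivializationAt' x) hV _
    ((trivializationAt M V x).isLocalFrameOn_localFrame_baseSet 𝓘(ℂ, E) ω (Module.finBasis ℂ M)))

/-- The Gram determinant of an orthonormal frame is `1`, and the choice of frame does not matter. -/
theorem ddbar_logDet_eq_zero (hV : Module.finrank ℂ M = n + 1)
    (A : AdaptedFrame E M q n x) (h : HermitianMetric E M V) (ht : h.IsTrivial) :
    ddbar (A.logDet h) (extChartAt 𝓘(ℂ, E) x x) = 0 := by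
  obtain ⟨U, hU, hx, s, hs, horth⟩ := ht x
  rw [← A.ddbar_log_det_gram h hU hx hV s hs]
  have hev : ∀ᶠ z in 𝓝 (extChartAt 𝓘(ℂ, E) x x), (extChartAt 𝓘(ℂ, E) x).symm z ∈ U :=
    eventually_extChartAt_symm_mem hU hx
  rw [ddbar_congr (ψ := fun _ => 0)]
  · ext v
    rw [form_two_apply_eq, ddbar_apply contDiffAt_const, levi_of_contDiffAt contDiffAt_const,
      levi_of_contDiffAt contDiffAt_const]
    simp
  · filter_upwards [hev] with z hz
    have : (Matrix.of fun j k => h.form ((extChartAt 𝓘(ℂ, E) x).symm z)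
        (s j ((extChartAt 𝓘(ℂ, E) x).symm z)) (s k ((extChartAt 𝓘(ℂ, E) x).symm z))) = 1 := by
      ext i j
      rw [Matrix.of_apply, horth _ hz, Matrix.one_apply]
    rw [this]
    simp

end AdaptedFrame

/-! ### Trivial metrics -/

section Vanishing

variable {N : Type*} [NormedAddCommGroup N] [NormedSpace ℂ N]

/-- The wedge powers of a form which factors through a map of small rank vanish. -/
theorem wedgePow_eq_zero_of_factor {Q : Type*} [AddCommGroup Q] [Module ℂ Q]
    [FiniteDimensional ℂ Q] (β : Form N 2) (L : N →ₗ[ℂ] Q) (B : Q → Q → ℂ)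
    (hβ : ∀ u v, β ![u, v] = B (L u) (L v)) {k : ℕ}
    (hk : Module.finrank ℂ (LinearMap.range L) < k) : wedgePow β k = 0 := by
  -- With a linear section `σ` of `L` onto its range, replacing `u` by `σ (L u)` does not change
  -- `β`.
  obtain ⟨σ, hσ⟩ := L.rangeRestrict.exists_rightInverse_of_surjective L.range_rangeRestrict
  let R : N →ₗ[ℝ] N := (σ ∘ₗ L.rangeRestrict).restrictScalars ℝ
  have hLR : ∀ u, L (R u) = L u := fun u =>
    congrArg Subtype.val (LinearMap.congr_fun hσ (L.rangeRestrict u))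
  have hR : β.compLinearMap R = β := by
    ext u
    rw [AlternatingMap.compLinearMap_apply, form_two_apply_eq, form_two_apply_eq β u, hβ, hβ, hLR,
      hLR]
  have h1 := wedgePow_compLinearMap β R k
  rw [hR] at h1
  ext v
  rw [h1, AlternatingMap.compLinearMap_apply, AlternatingMap.zero_apply]
  -- The `2 k` arguments now come from a space of real dimension twice the rank of `L`, which is
  -- less than `2 k`.
  refine AlternatingMap.map_linearDependent _ _ fun hli => ?_
  have h2 : LinearIndependent ℝ fun i => L.rangeRestrict (v i) :=
    LinearIndependent.of_comp (σ.restrictScalars ℝ) hli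
  have : FiniteDimensional ℝ (LinearMap.range L) := FiniteDimensional.complexToReal _
  have h3 := h2.fintype_card_le_finrank
  rw [Fintype.card_fin, finrank_real_of_complex] at h3
  omega

open Matrix in
/-- The powers of the pull-back of the Fubini–Study form of projective `r`-space vanish in degrees
greater than `2 r`. -/
theorem wedgePow_ddbar_log_sum_normSq {r k : ℕ} {κ : N → Fin (r + 1) → ℂ} {p : N}
    (hκ : ∀ i, ContDiffAt ℂ 2 (fun q => κ q i) p) (h0 : κ p ≠ 0) (hk : r < k) (c : ℂ) :
    wedgePow (c • ddbar (fun q => ((Real.log (∑ i, ‖κ q i‖ ^ 2) : ℝ) : ℂ)) p) k = 0 := by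
  let φ : N → ℂ := fun q => ∑ i, κ q i * conj (κ q i)
  have hφ : ∀ q, φ q = ((∑ i, ‖κ q i‖ ^ 2 : ℝ) : ℂ) := fun q => by
    simp only [φ, Complex.mul_conj, Complex.normSq_eq_norm_sq]
    push_cast
    rfl
  have hre : ∀ q, (φ q).re = ∑ i, ‖κ q i‖ ^ 2 := fun q => by rw [hφ, Complex.ofReal_re]
  have hR := fun i => (hκ i).restrict_scalars ℝ
  have hC := fun i => contDiffAt_conj (hR i)
  have hd := fun i => (hκ i).differentiableAt two_ne_zero
  have dR := fun i => (hR i).differentiableAt two_ne_zero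
  have dC := fun i => (hC i).differentiableAt two_ne_zero
  have hφs : ContDiffAt ℝ 2 φ p := ContDiffAt.sum fun i _ => (hR i).mul (hC i)
  have hpos : 0 < (φ p).re := by
    rw [hre]
    obtain ⟨i, hi⟩ := Function.ne_iff.1 h0
    exact Finset.sum_pos' (fun _ _ => by positivity) ⟨i, Finset.mem_univ _, by
      have : κ p i ≠ 0 := hi
      positivity⟩
  have hne : φ p ≠ 0 := fun h => by simp [h] at hpos
  have hconj : conj (φ p) = φ p := by rw [hφ, Complex.conj_ofReal]
  let T : N →ₗ[ℂ] (Fin (r + 1) → ℂ) :=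
    LinearMap.pi fun i => (fderiv ℂ (fun q => κ q i) p).toLinearMap
  have hT : ∀ i v, del (fun q => κ q i) p v = T v i := fun i v =>
    del_of_differentiableAt (hd i) v
  have hlevi : ∀ u v, levi (fun q => ((Real.log (∑ i, ‖κ q i‖ ^ 2) : ℝ) : ℂ)) p u v =
      (T u ⬝ᵥ star (T v)) / φ p -
        (T u ⬝ᵥ star (κ p)) * conj (T v ⬝ᵥ star (κ p)) / φ p ^ 2 := by
    intro u v
    have h1 := levi_log hφs (Filter.Eventually.of_forall fun q => by rw [hre, hφ]) hpos u v
    simp only [hre] at h1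
    rw [h1]
    have h2 : levi φ p u v = T u ⬝ᵥ star (T v) := by
      rw [levi_sum _ fun i _ => (hR i).mul (hC i)]
      refine Finset.sum_congr rfl fun i _ => ?_
      rw [levi_mul (hR i) (hC i), levi_of_contDiffAt (hκ i), levi_conj (hR i),
        levi_of_contDiffAt (hκ i), dbar_of_differentiableAt (hd i), dbar_conj, hT, hT]
      simp
    have h3 : del φ p u = T u ⬝ᵥ star (κ p) := by
      rw [del_sum _ fun i _ => (dR i).fun_mul (dC i)]
      refine Finset.sum_congr rfl fun i _ => ?_
      rw [del_mul (dR i) (dC i), del_conj, dbar_of_differentiableAt (hd i), hT]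
      simp
    have h4 : dbar φ p v = conj (T v ⬝ᵥ star (κ p)) := by
      rw [dbar_sum _ fun i _ => (dR i).fun_mul (dC i), dotProduct, map_sum]
      refine Finset.sum_congr rfl fun i _ => ?_
      rw [dbar_mul (dR i) (dC i), dbar_conj, dbar_of_differentiableAt (hd i), hT]
      simp
      ring
    rw [h2, h3, h4]
  let s : (Fin (r + 1) → ℂ) →ₗ[ℂ] ℂ :=
    { toFun := fun a => a ⬝ᵥ star (κ p)
      map_add' := fun a b => add_dotProduct _ _ _
      map_smul' := fun t a => smul_dotProduct _ _ _ }
  have hs : ∀ a, s a = a ⬝ᵥ star (κ p) := fun a => rfl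
  have hsκ : s (κ p) = φ p := rfl
  have hs' : ∀ a, κ p ⬝ᵥ star a = conj (s a) := fun a => by
    rw [hs, dotProduct, dotProduct, map_sum]
    exact Finset.sum_congr rfl fun i _ => by simp [mul_comm]
  -- Orthogonal projection along `κ p`. By `hPP` the Levi form at `(u, v)` is the inner product of
  -- `P (T u)` and `P (T v)` divided by `φ p`.
  let P : (Fin (r + 1) → ℂ) →ₗ[ℂ] (Fin (r + 1) → ℂ) :=
    LinearMap.id - ((φ p)⁻¹ • s).smulRight (κ p)
  have hP : ∀ a, P a = a - ((φ p)⁻¹ * s a) • κ p := fun a => rfl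
  have hPP : ∀ a b, P a ⬝ᵥ star (P b) = a ⬝ᵥ star b - s a * conj (s b) / φ p := by
    intro a b
    rw [hP, hP, star_sub, star_smul, sub_dotProduct, dotProduct_sub, dotProduct_sub,
      smul_dotProduct, smul_dotProduct, dotProduct_smul, dotProduct_smul, hs', ← hs, ← hs, hsκ]
    simp only [smul_eq_mul, star_mul', RCLike.star_def, map_inv₀, hconj]
    field_simp
    ring
  refine wedgePow_eq_zero_of_factor _ (P ∘ₗ T)
    (fun a b => c * ((a ⬝ᵥ star b) / φ p - (b ⬝ᵥ star a) / φ p)) (fun u v => ?_) ?_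
  · have hlog : ContDiffAt ℝ 2 (fun q => ((Real.log (∑ i, ‖κ q i‖ ^ 2) : ℝ) : ℂ)) p := by
      have := contDiffAt_log_re hφs hpos
      simpa only [hre] using this
    rw [AlternatingMap.smul_apply, ddbar_apply hlog, hlevi, hlevi, LinearMap.comp_apply,
      LinearMap.comp_apply, hPP, hPP, smul_eq_mul, ← hs, ← hs]
    field_simp
  -- The image lies in the orthogonal complement of `κ p`, a proper subspace, so the rank is at most
  -- `r`.
  · have h1 : LinearMap.range (P ∘ₗ T) ≤ LinearMap.ker s := by
      rintro _ ⟨v, rfl⟩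
      rw [LinearMap.mem_ker, LinearMap.comp_apply, hP, map_sub, map_smul, hsκ, smul_eq_mul]
      field_simp
      ring
    have h2 : LinearMap.ker s < ⊤ := by
      refine lt_top_iff_ne_top.2 fun h => hne ?_
      rw [← hsκ]
      exact LinearMap.mem_ker.1 (h ▸ Submodule.mem_top)
    have h3 := Submodule.finrank_lt h2.ne
    have h4 := Submodule.finrank_mono h1
    rw [Module.finrank_fin_fun] at h3
    omega

end Vanishing

/-! ### The Fubini–Study form on `P(F')` for a trivial metric -/

section Trivial

variable {E : Type*} [NormedAddCommGroup E] [NormedSpace ℂ E]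
  {X : Type*} [TopologicalSpace X] [ChartedSpace E X]
  {M : Type*} [NormedAddCommGroup M] [NormedSpace ℂ M]
  {V : X → Type*} [TopologicalSpace (Bundle.TotalSpace M V)]
  [∀ x, AddCommGroup (V x)] [∀ x, Module ℂ (V x)] [∀ x, TopologicalSpace (V x)]
  [FiberBundle M V] {F : X → Type*} [∀ x, AddCommGroup (F x)] [∀ x, Module ℂ (F x)]
  {q : ∀ x, V x →ₗ[ℂ] F x} {m : ℕ} {x : X}

/-- For a trivial metric the dual norm on the tautological line is that of a holomorphic vector. -/
theorem exists_dualNormSq_eq_sum_normSq (h : HermitianMetric E M V) {U : Set X} (hU : IsOpen U)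
    (hx : x ∈ U) {N : ℕ} (hN : N = m + 1 + 1) (s : Fin N → ∀ y, V y)
    (hs : IsLocalFrameOn 𝓘(ℂ, E) M ω s U)
    (horth : ∀ y ∈ U, ∀ i j, h.form y (s i y) (s j y) = if i = j then 1 else 0)
    (c : AffineChart E (W := fun x => ⋀[ℂ]^(m + 1) (V x))
      (Q := fun x => ExtQuot (m + 1) (q x)) (IsDecomposableSection (E := E) M (m + 1))
      (fun x => extQuotMap (m + 1) (q x)) m x) (w : Fin m → ℂ) :
    ∃ κ : E × (Fin m → ℂ) → Fin (m + 1 + 1) → ℂ,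
      (∀ i, ContDiffAt ℂ 2 (fun p => κ p i) (extChartAt 𝓘(ℂ, E) x x, w)) ∧
      κ (extChartAt 𝓘(ℂ, E) x x, w) ≠ 0 ∧
      ∀ᶠ p in 𝓝 (extChartAt 𝓘(ℂ, E) x x, w),
        dualNormSq (exteriorForm (h.form ((extChartAt 𝓘(ℂ, E) x).symm p.1)) (m + 1))
          (c.lift ((extChartAt 𝓘(ℂ, E) x).symm p.1) p.2 ∘ₗ
            extQuotMap (m + 1) (q ((extChartAt 𝓘(ℂ, E) x).symm p.1))) = ∑ i, ‖κ p i‖ ^ 2 := by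
  subst hN
  set z₀ := extChartAt 𝓘(ℂ, E) x x with hz₀
  let ψ : E → X := (extChartAt 𝓘(ℂ, E) x).symm
  let U' := c.dom ∩ U
  have hU' : IsOpen U' := c.isOpen_dom.inter hU
  have hxU' : x ∈ U' := ⟨c.mem_dom, hx⟩
  have hev : ∀ᶠ z in 𝓝 z₀, ψ z ∈ U' := eventually_extChartAt_symm_mem hU' hxU'
  let fr : Fin (m + 1) → Fin (m + 1 + 1) → X → ℂ := fun a i y => c.frame a y
    (extQuotMap (m + 1) (q y) (exteriorPower.ιMulti ℂ (m + 1) fun j => s (i.succAbove j) y))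
  have hfr : ∀ a i, ContDiffAt ℂ 2 (fun z => fr a i (ψ z)) z₀ := fun a i =>
    contDiffAt_comp_extChartAt_symm hU' hxU' (c.holomorphic U' Set.inter_subset_left hU' _
      ⟨fun j => s (i.succAbove j), fun j => (hs.contMDiffOn _).mono Set.inter_subset_right,
        fun y _ => rfl⟩ a)
  -- Coordinates, in the orthonormal frame, of the vector which represents the tautological
  -- functional. The signs are those of `eq_detFunctional`.
  let κ : E × (Fin m → ℂ) → Fin (m + 1 + 1) → ℂ := fun p i =>
    (-1) ^ (i : ℕ) * ∑ a, (Fin.cons 1 p.2 : Fin (m + 1) → ℂ) a * fr a i (ψ p.1)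
  have hκ : ∀ i, ContDiffAt ℂ 2 (fun p => κ p i) (z₀, w) := fun i =>
    contDiffAt_const.mul (ContDiffAt.sum fun a _ => (contDiff_cons_apply a).contDiffAt.mul
      ((hfr a i).comp (z₀, w) contDiffAt_fst))
  let Φ : ∀ p : E × (Fin m → ℂ), Module.Dual ℂ (⋀[ℂ]^(m + 1) (V (ψ p.1))) := fun p =>
    c.lift (ψ p.1) p.2 ∘ₗ extQuotMap (m + 1) (q (ψ p.1))
  have hlift : ∀ y w, c.lift y w = ∑ a, (Fin.cons 1 w : Fin (m + 1) → ℂ) a • c.frame a y :=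
    fun y w => by
      rw [Fin.sum_univ_succ]
      simp [AffineChart.lift]
  have hΦ : ∀ p (hp : ψ p.1 ∈ U'), Φ p = detFunctional (hs.toBasisAt hp.2)
      (∑ i, κ p i • s i (ψ p.1)) := by
    intro p hp
    rw [eq_detFunctional (hs.toBasisAt hp.2) (Φ p)]
    congr 1
    refine Finset.sum_congr rfl fun i _ => ?_
    simp only [IsLocalFrameOn.toBasisAt_coe, Φ, LinearMap.comp_apply, hlift, LinearMap.sum_apply,
      LinearMap.smul_apply, smul_eq_mul]
    rfl
  -- Otherwise the lift would be zero, although its coefficient at the first coframe member is `1`.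
  have hκ0 : κ (z₀, w) ≠ 0 := by
    intro h0
    have h1 := hΦ (z₀, w) hev.self_of_nhds
    simp only [h0, Pi.zero_apply, zero_smul, Finset.sum_const_zero, map_zero] at h1
    have h2 : c.lift (ψ z₀) w = 0 := by
      refine LinearMap.ext fun v => ?_
      obtain ⟨v, rfl⟩ := Submodule.mkQ_surjective _ v
      exact LinearMap.congr_fun h1 v
    rw [hlift] at h2
    have := Fintype.linearIndependent_iff.1 (c.linearIndependent _ hev.self_of_nhds.1) _ h2 0
    simp at this
  have hnorm : ∀ p (hp : ψ p.1 ∈ U'), dualNormSq (exteriorForm (h.form (ψ p.1)) (m + 1)) (Φ p) =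
      ∑ i, ‖κ p i‖ ^ 2 := by
    intro p hp
    have hb : ∀ i j, h.form (ψ p.1) (hs.toBasisAt hp.2 i) (hs.toBasisAt hp.2 j) =
        if i = j then 1 else 0 := fun i j => by
      rw [IsLocalFrameOn.toBasisAt_coe, IsLocalFrameOn.toBasisAt_coe]
      exact horth _ hp.2 i j
    have hgram : gram (h.form (ψ p.1)) (hs.toBasisAt hp.2) = 1 := by
      ext i j
      rw [gram, Matrix.of_apply, hb, Matrix.one_apply]
    rw [hΦ p hp, dualNormSq_detFunctional (h.conj_symm _) (h.pos _), hgram, Matrix.det_one,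
      Complex.one_re, div_one]
    have := sesqForm_sum_smul (h.form (ψ p.1)) (hs.toBasisAt hp.2) (κ p) (κ p)
    simp only [hb, mul_ite, mul_one, mul_zero, Finset.sum_ite_eq, Finset.mem_univ, if_true,
      Complex.mul_conj, Complex.normSq_eq_norm_sq] at this
    simp only [IsLocalFrameOn.toBasisAt_coe] at this
    rw [this, ← Complex.ofReal_sum, Complex.ofReal_re]
  exact ⟨κ, hκ, hκ0, ((continuousAt_fst (p := (z₀, w))).eventually hev).mono fun p hp => hnorm p hp⟩

/-- For a trivial metric the high powers of the Fubini–Study form vanish. -/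
theorem wedgePow_etaExt_eq_zero (h : HermitianMetric E M V) {U : Set X} (hU : IsOpen U)
    (hx : x ∈ U) {N : ℕ} (hN : N = m + 1 + 1) (s : Fin N → ∀ y, V y)
    (hs : IsLocalFrameOn 𝓘(ℂ, E) M ω s U)
    (horth : ∀ y ∈ U, ∀ i j, h.form y (s i y) (s j y) = if i = j then 1 else 0)
    (c : AffineChart E (W := fun x => ⋀[ℂ]^(m + 1) (V x))
      (Q := fun x => ExtQuot (m + 1) (q x)) (IsDecomposableSection (E := E) M (m + 1))
      (fun x => extQuotMap (m + 1) (q x)) m x) (w : Fin m → ℂ) {k : ℕ} (hk : m + 1 < k) :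
    wedgePow (etaExt h q (m + 1) x c (extChartAt 𝓘(ℂ, E) x x, w)) k = 0 := by
  obtain ⟨κ, hκ, hκ0, hn⟩ := exists_dualNormSq_eq_sum_normSq h hU hx hN s hs horth c w
  refine Eq.trans (congrArg (fun β => wedgePow ((Complex.I / (2 * Real.pi)) • β) k)
    (ddbar_congr (hn.mono fun p hp => ?_))) (wedgePow_ddbar_log_sum_normSq hκ hκ0 hk _)
  dsimp only
  rw [← hp]

end Trivial

end FibreIntegrals

end

/-! ### The theorem -/

theorem mainTheorem12
    {E : Type*} [NormedAddCommGroup E] [NormedSpace ℂ E] [FiniteDimensional ℂ E]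
    {X : Type*} [TopologicalSpace X] [ChartedSpace E X] [IsManifold 𝓘(ℂ, E) ω X]
    -- the holomorphic vector bundle `V` with its hermitian metric
    {M : Type*} [NormedAddCommGroup M] [NormedSpace ℂ M] [FiniteDimensional ℂ M]
    {V : X → Type*} [TopologicalSpace (Bundle.TotalSpace M V)]
    [∀ x, AddCommGroup (V x)] [∀ x, Module ℂ (V x)] [∀ x, TopologicalSpace (V x)]
    [FiberBundle M V] [VectorBundle ℂ M V] [ContMDiffVectorBundle ω M V 𝓘(ℂ, E)]
    (r : ℕ) (hr : 1 ≤ r) (hV : Module.finrank ℂ M = r + 1)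
    (h : FibreIntegrals.HermitianMetric E M V)
    -- the holomorphic line bundle `F` with a surjective morphism `q : V → F`
    {F : X → Type*} [TopologicalSpace (Bundle.TotalSpace ℂ F)]
    [∀ x, AddCommGroup (F x)] [∀ x, Module ℂ (F x)] [∀ x, TopologicalSpace (F x)]
    [FiberBundle ℂ F] [VectorBundle ℂ ℂ F] [ContMDiffVectorBundle ω ℂ F 𝓘(ℂ, E)]
    (q : ∀ x, V x →ₗ[ℂ] F x) (hq_surj : ∀ x, Function.Surjective (q x))
    (hq_hol : ContMDiff (𝓘(ℂ, E).prod 𝓘(ℂ, M)) (𝓘(ℂ, E).prod 𝓘(ℂ, ℂ)) ω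
      (fun v : Bundle.TotalSpace M V => Bundle.TotalSpace.mk' ℂ v.1 (q v.1 v.2))) :
    -- the comparison formula
    (∀ x : X, ∃ A B : FibreIntegrals.Form (TangentSpace 𝓘(ℂ, E) x) 2,
      FibreIntegrals.HasFibreIntegral ((FibreIntegrals.etaV h q).pow 1) 1 (by omega) x A ∧
      FibreIntegrals.HasFibreIntegral ((FibreIntegrals.etaExt h q r).pow r) 1 (by omega) x B ∧
      A = B - ((r : ℂ) - 1) • (Complex.I / (2 * Real.pi)) • FibreIntegrals.detCurvature h x) ∧
    -- the case of a trivial metric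
    (h.IsTrivial → ∀ x : X, ∃ α : FibreIntegrals.Form (TangentSpace 𝓘(ℂ, E) x) 2,
      FibreIntegrals.HasFibreIntegral ((FibreIntegrals.etaV h q).pow 1) 1 (by omega) x α ∧
      FibreIntegrals.HasFibreIntegral ((FibreIntegrals.etaExt h q r).pow r) 1 (by omega) x α ∧
      ∀ p : ℕ, 1 ≤ p →
        FibreIntegrals.HasFibreIntegral ((FibreIntegrals.etaV h q).pow p) p (by omega) x
          (FibreIntegrals.wedgePow α p) ∧
        FibreIntegrals.HasFibreIntegral ((FibreIntegrals.etaExt h q r).pow (r + p)) (p + 1)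
          (by omega) x 0) := by
  -- `m = r - 1` is the dimension of the fibres of `P(F')`.
  obtain ⟨m, rfl⟩ : ∃ m, r = m + 1 := ⟨r - 1, by omega⟩
  refine ⟨fun x => ?_, fun ht x => ?_⟩
  · obtain ⟨A⟩ := FibreIntegrals.nonempty_adaptedFrame q hV hq_surj hq_hol x
    have hne := FibreIntegrals.nonempty_affineChart_line q hq_hol x
    refine ⟨_, _, A.hasFibreIntegral_etaV h hne hq_surj _, A.hasFibreIntegral_etaExt h _, ?_⟩
    rw [FibreIntegrals.AdaptedFrame.detCurvature_eq hV A h]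
    -- Here `a` and `b` stand for `∂∂̄ log det` of the two Gram matrices, of the kernel and of the
    -- whole frame, and `-b` is the curvature of `det V`.
    have key : ∀ (t : ℂ) (a b : FibreIntegrals.Form E 2), t • (a - b) =
        t • (a - ((m : ℂ) + 1) • b) - (((m + 1 : ℕ) : ℂ) - 1) • t • -b := fun t a b => by
      push_cast
      module
    exact key _ _ _
  · obtain ⟨A⟩ := FibreIntegrals.nonempty_adaptedFrame q hV hq_surj hq_hol x
    have hne := FibreIntegrals.nonempty_affineChart_line q hq_hol x
    have h0 := FibreIntegrals.AdaptedFrame.ddbar_logDet_eq_zero hV A h ht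
    refine ⟨_, A.hasFibreIntegral_etaV h hne hq_surj _, ?_, fun p hp =>
      ⟨A.hasFibreIntegral_etaV_pow h hne hq_surj _, A.nonempty_affineChart, fun c u => ?_⟩⟩
    · have := A.hasFibreIntegral_etaExt h (by omega)
      rw [h0, smul_zero] at this
      rw [h0]
      exact this
    -- The form of degree `2 (r + p)` is zero at every point of the fibre, so its integral vanishes
    -- trivially.
    · obtain ⟨U, hU, hx, s, hs, horth⟩ := ht x
      have hz := fun w => FibreIntegrals.wedgePow_etaExt_eq_zero (q := q) h hU hx hV s hs horth c w
        (show m + 1 < m + 1 + p by omega)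
      have hf : ∀ w, (FibreIntegrals.etaExt h q (m + 1)).pow (m + 1 + p) x c
          (extChartAt 𝓘(ℂ, E) x x, w) = 0 := hz
      simp only [hf, AlternatingMap.zero_apply]
      exact ⟨MeasureTheory.integrable_zero _ _ _, MeasureTheory.integral_zero _ _⟩
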